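/- A (generalised) triangulation $\mathcal T$ of dimension $d$ is a finite set of abstract $d$-simplices together with gluings, i.e. pairs of distinct $(d-1)$-faces of these simplices identified affinely via a bijection of their vertices, each $(d-1)$-face being used in at most one gluing; $|\mathcal T|$ is the resulting identification space, and $f_i$ is the number of $i$-faces of $\mathcal T$ after the identifications. $\mathcal T$ is a $d$-pseudomanifold if every $(d-1)$-face is used in a gluing, $|\mathcal T|$ is connected, and no face is identified with itself under a non-identity map. The link of an $i$-face $\sigma$ is the $(d-i-1)$-dimensional triangulation that has, for each occurrence of $\sigma$ as a face of a $d$-simplex $\Delta$, a copy of the face of $\Delta$ opposite to it, these copies being glued along the gluings of the $(d-1)$-faces containing $\sigma$. A $d$-pseudomanifold is $s$-nonsingular if the link of every $s$-face is a standard PL $(d-1-s)$-sphere. The dual graph has a node for each $d$-simplex and an arc for each gluing. **Theorem.** There exist $2$-nonsingular $4$-pseudomanifolds such that $$f_0>\frac{f_4}{2}+4 .$$ Moreover, this can be attained by a ($2$-nonsingular) $4$-pseudomanifold in which every edge link is a $2$-sphere except one, which is an orientable surface of genus $3$, and every vertex link is a $3$-sphere except one, which is not, and which has (i) $16$ pentachora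 ($4$-simplices); or (ii) $64$ pentachora and a dual graph with no loops. (Both (i) and (ii) occur.) -/

import Mathlib

/-- A (finite) generalised triangulation: finitely many abstract simplices (`Facet`), together with
gluings in pairs of their ridges. The vertices of the facet `Δ` are named by the labels in
`verts Δ ⊆ L`, and its ridges by the opposite vertex. `glue Δ i Δ' g` says that the ridge of `Δ`
opposite to `i` is identified affinely with the ridge of `Δ'` opposite to `g i`, the vertex `v ≠ i`
being paired with `g v`. (In a `d`-dimensional triangulation with `L = Fin (d + 1)` every facet has
all labels, and `g` is determined by the pairing of the vertices of the two ridges.) -/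
structure GenTriangulation (L : Type) [Fintype L] [DecidableEq L] where
  Facet : Type
  finite_facet : Finite Facet
  verts : Facet → Finset L
  glue : Facet → L → Facet → Equiv.Perm L → Prop
  glue_mem : ∀ {Δ i Δ' g}, glue Δ i Δ' g → i ∈ verts Δ
  glue_verts : ∀ {Δ i Δ' g}, glue Δ i Δ' g → (verts Δ).map g.toEmbedding = verts Δ'
  glue_symm : ∀ {Δ i Δ' g}, glue Δ i Δ' g → glue Δ' (g i) Δ g⁻¹
  /-- every ridge is used in at most one gluing -/
  glue_unique : ∀ {Δ i Δ₁ g₁ Δ₂ g₂}, glue Δ i Δ₁ g₁ → glue Δ i Δ₂ g₂ → Δ₁ = Δ₂ ∧ g₁ = g₂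
  /-- no ridge is glued to itself -/
  glue_ne : ∀ {Δ i Δ' g}, glue Δ i Δ' g → (Δ', g i) ≠ (Δ, i)

namespace GenTriangulation

variable {L : Type} [Fintype L] [DecidableEq L]

/-- All facets are `d`-simplices. -/
def HasDim (T : GenTriangulation L) (d : ℕ) : Prop :=
  ∀ Δ, (T.verts Δ).card = d + 1

/-- Every ridge is used in a gluing. -/
def IsClosed (T : GenTriangulation L) : Prop :=
  ∀ Δ, ∀ i ∈ T.verts Δ, ∃ Δ' g, T.glue Δ i Δ' g

/-! ### Faces -/

/-- The `k`-faces of the facets, before identification. -/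
def PreFace (T : GenTriangulation L) (k : ℕ) : Type :=
  {p : T.Facet × Finset L // p.2 ⊆ T.verts p.1 ∧ p.2.card = k + 1}

/-- Two `k`-faces of facets are identified by a single gluing, of a ridge containing them. -/
def PreFace.Step (T : GenTriangulation L) (k : ℕ) (p q : T.PreFace k) : Prop :=
  ∃ i g, T.glue p.1.1 i q.1.1 g ∧ i ∉ p.1.2 ∧ q.1.2 = p.1.2.map g.toEmbedding

/-- The `k`-faces of the triangulation (after the identifications). -/
def Face (T : GenTriangulation L) (k : ℕ) : Type :=
  Quot (PreFace.Step T k)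

/-- The entry `f_k` of the `f`-vector. -/
noncomputable def f (T : GenTriangulation L) (k : ℕ) : ℕ :=
  Nat.card (T.Face k)

/-- `T.Carries Δ s Δ' g`: a (possibly empty) sequence of gluings of ridges identifies the face `s`
of `Δ` with the face `g(s)` of `Δ'`, the vertex `v ∈ s` being identified with `g v`. -/
inductive Carries (T : GenTriangulation L) (Δ : T.Facet) (s : Finset L) :
    T.Facet → Equiv.Perm L → Prop
  | refl : Carries T Δ s Δ 1
  | step {Δ' Δ'' : T.Facet} {i : L} {g g' : Equiv.Perm L} :
      Carries T Δ s Δ' g → T.glue Δ' i Δ'' g' → i ∉ s.map g.toEmbedding →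
      Carries T Δ s Δ'' (g' * g)

/-- No face, of any dimension, is identified with itself under a non-identity relation. -/
def IsValid (T : GenTriangulation L) : Prop :=
  ∀ Δ, ∀ s ⊆ T.verts Δ, ∀ g, T.Carries Δ s Δ g → s.map g.toEmbedding = s → ∀ v ∈ s, g v = v

/-! ### The underlying space -/

/-- The geometric simplex of the facet `Δ`, in barycentric coordinates. -/
def simplex (T : GenTriangulation L) (Δ : T.Facet) : Set (L → ℝ) :=
  {x | (∀ v, 0 ≤ x v) ∧ ∑ v, x v = 1 ∧ ∀ v, v ∉ T.verts Δ → x v = 0}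

/-- The affine identification of points made by a single gluing: the point `x` of the ridge of `Δ`
opposite to `i` goes to the point with the same barycentric coordinates at the paired vertices. -/
def PointStep (T : GenTriangulation L) (a b : Σ Δ : T.Facet, T.simplex Δ) : Prop :=
  ∃ i g, T.glue a.1 i b.1 g ∧ a.2.1 i = 0 ∧ ∀ v, b.2.1 (g v) = a.2.1 v

/-- The underlying space `|T|`: the identification space of the disjoint union of the facets. -/
def Space (T : GenTriangulation L) : Type :=
  Quot T.PointStep

instance (T : GenTriangulation L) : TopologicalSpace T.Space :=
  inferInstanceAs (TopologicalSpace (Quot T.PointStep))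

/-- The point of `|T|` given by a point of a facet. -/
def toSpace (T : GenTriangulation L) (Δ : T.Facet) (x : T.simplex Δ) : T.Space :=
  Quot.mk _ ⟨Δ, x⟩

/-! ### Piecewise linear spheres -/

/-- A closed convex polyhedron: the solutions of finitely many affine inequalities. -/
def IsConvexPolyhedron (P : Set (L → ℝ)) : Prop :=
  ∃ A : Finset ((L → ℝ) →ᵃ[ℝ] ℝ), P = {x | ∀ a ∈ A, 0 ≤ a x}

/-- A map from a subset `S` of `ℝ^L` to `ℝ^n` is piecewise linear if `S` is covered by finitely many
closed convex polyhedra on each of which the map is affine. -/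
def IsPL {n : ℕ} (S : Set (L → ℝ)) (h : S → Fin n → ℝ) : Prop :=
  ∃ C : Set (Set (L → ℝ)), C.Finite ∧ (∀ P ∈ C, IsConvexPolyhedron P) ∧ S ⊆ ⋃₀ C ∧
    ∀ P ∈ C, ∃ A : (L → ℝ) →ᵃ[ℝ] (Fin n → ℝ), ∀ x : S, x.1 ∈ P → h x = A x.1

/-- The standard PL `k`-sphere: the boundary of the `(k+1)`-simplex in `ℝ^{k+2}`. -/
def stdPLSphere (k : ℕ) : Set (Fin (k + 2) → ℝ) :=
  {y | (∀ j, 0 ≤ y j) ∧ ∑ j, y j = 1 ∧ ∃ j, y j = 0}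

/-- `|T|` is PL homeomorphic to the standard PL `k`-sphere. (A map on `|T|` is PL if it is PL on
every facet. Since `|T|` is compact, the inverse of a PL bijection is continuous, and PL.) -/
def IsPLSphere (T : GenTriangulation L) (k : ℕ) : Prop :=
  ∃ h : T.Space → Fin (k + 2) → ℝ, Function.Injective h ∧ Set.range h = stdPLSphere k ∧
    ∀ Δ, IsPL (T.simplex Δ) (fun x => h (T.toSpace Δ x))

/-! ### Links -/

/-- The link of the `k`-face `σ`: one simplex for every occurrence of `σ` as a face `s` of a facet
`Δ`, namely the face of `Δ` opposite to `s`; these are glued along the gluings of the ridges which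
contain the face `s`. -/
def link (T : GenTriangulation L) {k : ℕ} (σ : T.Face k) : GenTriangulation L where
  Facet := {p : T.PreFace k // Quot.mk (PreFace.Step T k) p = σ}
  finite_facet := by
    have := T.finite_facet
    unfold PreFace
    infer_instance
  verts p := T.verts p.1.1.1 \ p.1.1.2
  glue p i q g :=
    T.glue p.1.1.1 i q.1.1.1 g ∧ i ∉ p.1.1.2 ∧ q.1.1.2 = p.1.1.2.map g.toEmbedding
  glue_mem h := Finset.mem_sdiff.2 ⟨T.glue_mem h.1, h.2.1⟩
  glue_verts h := by
    rw [h.2.2, ← T.glue_verts h.1]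
    ext v
    simp [Finset.mem_sdiff]
  glue_symm {_ _ _ g} h := by
    refine ⟨T.glue_symm h.1, ?_, ?_⟩
    · rw [h.2.2]
      simpa using h.2.1
    · rw [h.2.2, Finset.map_map]
      have e : g.toEmbedding.trans (g⁻¹ : Equiv.Perm L).toEmbedding = Function.Embedding.refl L := by
        ext v
        exact g.symm_apply_apply v
      exact (by rw [e, Finset.map_refl] : _ = _).symm
  glue_unique := by
    rintro ⟨⟨⟨Δ, s⟩, hs⟩, hσ⟩ i ⟨⟨⟨Δ₁, s₁⟩, hs₁⟩, hσ₁⟩ g₁ ⟨⟨⟨Δ₂, s₂⟩, hs₂⟩, hσ₂⟩ g₂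
      ⟨h₁, -, e₁⟩ ⟨h₂, -, e₂⟩
    obtain ⟨h, hg⟩ := T.glue_unique h₁ h₂
    simp only at h e₁ e₂
    subst h hg e₁ e₂
    exact ⟨rfl, rfl⟩
  glue_ne h e := by
    rw [Prod.mk.injEq] at e
    exact T.glue_ne h.1 (Prod.ext (congrArg (fun p => p.1.1.1) e.1) e.2)

/-! ### Pseudomanifolds, surfaces, dual graph -/

/-- `d`-pseudomanifolds: closed, connected `d`-dimensional triangulations without faces that are
identified with themselves under a non-identity relation. -/
def IsPseudomanifold (T : GenTriangulation L) (d : ℕ) : Prop :=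
  T.HasDim d ∧ T.IsClosed ∧ ConnectedSpace T.Space ∧ T.IsValid

/-- `s`-nonsingular `d`-pseudomanifolds (`s < d`): the link of every `s`-face is a standard PL
`(d-1-s)`-sphere. For `s = 0` these are the closed connected combinatorial `d`-manifolds. -/
def IsNonsingular (T : GenTriangulation L) (d s : ℕ) : Prop :=
  T.IsPseudomanifold d ∧ ∀ σ : T.Face s, (T.link σ).IsPLSphere (d - 1 - s)

/-- The Euler characteristic of a `d`-dimensional triangulation. -/
noncomputable def eulerChar (T : GenTriangulation L) (d : ℕ) : ℤ :=
  ∑ k ∈ Finset.range (d + 1), (-1) ^ k * (T.f k : ℤ)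

/-- A `d`-dimensional triangulation is orientable if its facets can be oriented coherently. An
orientation of `Δ` is given by an ordering `o Δ` of its vertices; as `g` sends the vertex of `Δ`
opposite to the glued ridge to that of `Δ'`, two orientations are coherent if `g` reverses them. -/
def IsOrientable (T : GenTriangulation L) (d : ℕ) : Prop :=
  ∃ o : T.Facet → Fin (d + 1) → L,
    (∀ Δ, Function.Injective (o Δ) ∧ Set.range (o Δ) = T.verts Δ) ∧
    ∀ Δ i Δ' g, T.glue Δ i Δ' g →
      ∃ π : Equiv.Perm (Fin (d + 1)), Equiv.Perm.sign π = -1 ∧ ∀ k, g (o Δ k) = o Δ' (π k)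

/-- `T` triangulates the orientable surface of genus `g`: it is a closed connected surface,
orientable, of Euler characteristic `2 - 2g`. -/
def IsOrientableSurface (T : GenTriangulation L) (g : ℕ) : Prop :=
  T.IsNonsingular 2 0 ∧ T.IsOrientable 2 ∧ T.eulerChar 2 = 2 - 2 * (g : ℤ)

/-- The dual graph (a node for every facet, an arc for every gluing) has no loops. -/
def DualGraphLoopless (T : GenTriangulation L) : Prop :=
  ∀ Δ i Δ' g, T.glue Δ i Δ' g → Δ' ≠ Δ

/-- Every edge link is a `2`-sphere except one, which is an orientable surface of genus `3`, and
every vertex link is a `3`-sphere except one, which is not. -/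
def HasOneSingularEdgeAndVertex (T : GenTriangulation L) : Prop :=
  (∃ e : T.Face 1, (T.link e).IsOrientableSurface 3 ∧
    ∀ e' : T.Face 1, e' ≠ e → (T.link e').IsPLSphere 2) ∧
  (∃ v : T.Face 0, ¬ (T.link v).IsPLSphere 3 ∧
    ∀ v' : T.Face 0, v' ≠ v → (T.link v').IsPLSphere 3)

end GenTriangulation

set_option linter.unusedSectionVars false

namespace GenTriangulation

variable {L : Type} [Fintype L] [DecidableEq L] {L' : Type} [Fintype L'] [DecidableEq L']

/-! ### Piecewise linear maps -/

/-! Both examples are explicit. A pentachoron with labels 0, …, 4 is snapped by gluing the ridge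
opposite 0 to that opposite 1, and the ridge opposite 2 to that opposite 3. Its only free ridge is
then opposite 4, so it can cap any free tetrahedron; its apex, the vertex 4, is a new vertex whose
link is a one-tetrahedron 3-sphere. Four central pentachora are glued in a cycle, the ridge 3 of
each to the ridge 2 of the next, and their twelve remaining ridges are capped by snapped pentachora.
Besides the twelve apexes there is a single vertex, so f₀ = 13 > 16/2 + 4. A pillow consists of two
pentachora glued along their ridges 0, …, 3; it has two free ridges and an interior apex. Inserting
one in place of a gluing adds two pentachora and one vertex, so it preserves f₀ − f₄/2. Doing this
for the 24 self-gluings of the snapped pentachora gives 64 pentachora, 37 vertices and no loops.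

All gluings preserve the order of the labels in the glued ridges. A composite of gluings that
returns a face to itself is therefore monotone, hence the identity (`Pairing.isValid`). The link of
a triangle is a closed connected 1-dimensional triangulation, that is, a circle (`isPLSphere_one`);
so 2-nonsingularity only needs that the triangulation is closed and connected.

Up to isomorphism few triangulations occur as the other links of vertices and edges. Each is reduced
to the boundary of a simplex by a stored sequence of bistellar moves, which is only checked;
`Bistellar.isPLSphere` turns a move into an explicit PL homeomorphism. The exceptional edge link is
a closed orientable surface with Euler characteristic −4. The exceptional vertex link has Euler
characteristic 6, whereas a valid triangulation of the PL 3-sphere has 0.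

That last fact, `IsPLSphere.eulerChar_eq`, is proved by valuations in place of homology: an integral
combination of indicators of convex bodies determines the sum of its coefficients
(`HasEuler.unique`), and the images of the open faces, each contributing a sign by its dimension,
partition the standard sphere.

Counting faces and recognising links are searches for components in a finite graph whose nodes are
numbered pairs of disjoint faces of a facet (`Component.Encodes`); the searches are evaluated by the
kernel. -/

theorem IsConvexPolyhedron.inter {P Q : Set (L → ℝ)} (hP : IsConvexPolyhedron P)
    (hQ : IsConvexPolyhedron Q) : IsConvexPolyhedron (P ∩ Q) := by
  classical
  obtain ⟨A, rfl⟩ := hP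
  obtain ⟨B, rfl⟩ := hQ
  refine ⟨A ∪ B, ?_⟩
  ext x
  simp only [Set.mem_inter_iff, Set.mem_ofPred_eq, Finset.mem_union]
  exact ⟨fun h a ha => ha.elim (h.1 a) (h.2 a), fun h => ⟨fun a ha => h a (.inl ha),
    fun a ha => h a (.inr ha)⟩⟩

theorem IsConvexPolyhedron.preimage {P : Set (L' → ℝ)} (hP : IsConvexPolyhedron P)
    (φ : (L → ℝ) →ᵃ[ℝ] (L' → ℝ)) : IsConvexPolyhedron (φ ⁻¹' P) := by
  classical
  obtain ⟨A, rfl⟩ := hP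
  refine ⟨A.image fun a => a.comp φ, ?_⟩
  ext x
  simp

theorem isConvexPolyhedron_univ : IsConvexPolyhedron (Set.univ : Set (L → ℝ)) :=
  ⟨∅, by simp⟩

/-- A map between the underlying spaces of triangulations is piecewise linear if every simplex is
covered by finitely many polyhedra on each of which it is an affine map to some simplex. -/
def IsPLMap (T : GenTriangulation L) (S : GenTriangulation L') (φ : T.Space → S.Space) : Prop :=
  ∀ Δ, ∃ C : Set (Set (L → ℝ)), C.Finite ∧ (∀ P ∈ C, IsConvexPolyhedron P) ∧
    T.simplex Δ ⊆ ⋃₀ C ∧ ∀ P ∈ C, ∃ (Δ' : S.Facet) (A : (L → ℝ) →ᵃ[ℝ] (L' → ℝ)),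
      ∀ x : T.simplex Δ, x.1 ∈ P →
        ∃ hx : A x.1 ∈ S.simplex Δ', φ (T.toSpace Δ x) = S.toSpace Δ' ⟨A x.1, hx⟩

/-- Compose with `φ`. The pieces of the composite are the polyhedra for `φ` cut by the preimages,
under its affine pieces, of the polyhedra for the map on `S`. -/
theorem IsPLSphere.of_bijective {T : GenTriangulation L} {S : GenTriangulation L'} {k : ℕ}
    (hS : S.IsPLSphere k) (φ : T.Space → S.Space) (hφ : Function.Bijective φ)
    (h : IsPLMap T S φ) : T.IsPLSphere k := by
  obtain ⟨f, hf, hr, hPL⟩ := hS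
  refine ⟨f ∘ φ, hf.comp hφ.1, by rw [hφ.2.range_comp, hr], fun Δ => ?_⟩
  obtain ⟨C, hC, hCp, hcov, haff⟩ := h Δ
  choose D hD hDp hDcov hDaff using hPL
  choose t A hA using haff
  have := hC.to_subtype
  refine ⟨⋃ P : C, (fun Q => P.1 ∩ A P.1 P.2 ⁻¹' Q) '' D (t P.1 P.2), ?_, ?_, ?_, ?_⟩
  · exact Set.finite_iUnion fun P => (hD _).image _
  · intro R hR
    simp only [Set.mem_iUnion, Set.mem_image] at hR
    obtain ⟨⟨P, hP⟩, Q, hQ, rfl⟩ := hR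
    exact (hCp P hP).inter ((hDp _ Q hQ).preimage _)
  · intro x hx
    obtain ⟨P, hP, hxP⟩ := hcov hx
    obtain ⟨hm, -⟩ := hA P hP ⟨x, hx⟩ hxP
    obtain ⟨Q, hQ, hxQ⟩ := hDcov (t P hP) hm
    refine ⟨P ∩ A P hP ⁻¹' Q, ?_, hxP, hxQ⟩
    simp only [Set.mem_iUnion, Set.mem_image]
    exact ⟨⟨P, hP⟩, Q, hQ, rfl⟩
  · intro R hR
    simp only [Set.mem_iUnion, Set.mem_image] at hR
    obtain ⟨⟨P, hP⟩, Q, hQ, rfl⟩ := hR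
    obtain ⟨B, hB⟩ := hDaff (t P hP) Q hQ
    refine ⟨B.comp (A P hP), fun x hx => ?_⟩
    obtain ⟨hm, he⟩ := hA P hP x hx.1
    simp only [Function.comp, he]
    exact hB ⟨A P hP x.1, hm⟩ hx.2

/-- A map on the underlying space, given on the facets. -/
def spaceLift (T : GenTriangulation L) {α : Sort*} (F : ∀ Δ, T.simplex Δ → α)
    (h : ∀ Δ x i Δ' g y, T.glue Δ i Δ' g → x.1 i = 0 → (∀ v, y.1 (g v) = x.1 v) →
      F Δ x = F Δ' y) : T.Space → α :=
  Quot.lift (fun a => F a.1 a.2) fun a b ⟨i, g, hg, h0, hy⟩ => h a.1 a.2 i b.1 g b.2 hg h0 hy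

theorem toSpace_eq {T : GenTriangulation L} {Δ Δ' : T.Facet} {i g} (hg : T.glue Δ i Δ' g)
    {x : L → ℝ} {y : L → ℝ} (hx : x ∈ T.simplex Δ) (hy : y ∈ T.simplex Δ') (h0 : x i = 0)
    (h : ∀ v, y (g v) = x v) : T.toSpace Δ ⟨x, hx⟩ = T.toSpace Δ' ⟨y, hy⟩ :=
  Quot.sound ⟨i, g, hg, h0, h⟩

theorem space_ind {T : GenTriangulation L} {p : T.Space → Prop}
    (h : ∀ Δ x, p (T.toSpace Δ x)) : ∀ q, p q := by
  rintro ⟨Δ, x⟩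
  exact h Δ x

/-! ### Isomorphisms -/

/-- An isomorphism of triangulations, with possibly different labels. -/
structure Iso (T : GenTriangulation L) (S : GenTriangulation L') where
  e : T.Facet ≃ S.Facet
  ρ : T.Facet → L → L'
  injOn : ∀ Δ, Set.InjOn (ρ Δ) (T.verts Δ)
  image : ∀ Δ, (T.verts Δ).image (ρ Δ) = S.verts (e Δ)
  glue : ∀ {Δ i Δ' g}, T.glue Δ i Δ' g → ∃ g', S.glue (e Δ) (ρ Δ i) (e Δ') g' ∧
    ∀ v ∈ T.verts Δ, g' (ρ Δ v) = ρ Δ' (g v)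

theorem mem_verts_iff {T : GenTriangulation L} {Δ Δ' : T.Facet} {i g} (hg : T.glue Δ i Δ' g) (v) :
    g v ∈ T.verts Δ' ↔ v ∈ T.verts Δ := by
  rw [← T.glue_verts hg]
  simp

namespace Iso

variable {T : GenTriangulation L} {S : GenTriangulation L'} (I : Iso T S)

/-- The linear map which moves the barycentric coordinates. -/
noncomputable def push (Δ : T.Facet) : (L → ℝ) →ₗ[ℝ] (L' → ℝ) where
  toFun x w := ∑ v ∈ T.verts Δ with I.ρ Δ v = w, x v
  map_add' x y := by ext w; simp [Finset.sum_add_distrib]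
  map_smul' c x := by ext w; simp [Finset.mul_sum]

theorem push_apply (Δ : T.Facet) (x : L → ℝ) {v} (hv : v ∈ T.verts Δ) :
    I.push Δ x (I.ρ Δ v) = x v := by
  show ∑ u ∈ T.verts Δ with I.ρ Δ u = I.ρ Δ v, x u = x v
  rw [Finset.sum_eq_single v]
  · intro b hb hbv
    rw [Finset.mem_filter] at hb
    exact absurd (I.injOn Δ hb.1 hv hb.2) hbv
  · intro h
    exact absurd (Finset.mem_filter.2 ⟨hv, rfl⟩ : v ∈ (T.verts Δ).filter (I.ρ Δ · = I.ρ Δ v)) h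

theorem push_eq_zero (Δ : T.Facet) (x : L → ℝ) {w} (hw : w ∉ S.verts (I.e Δ)) :
    I.push Δ x w = 0 := by
  show ∑ u ∈ T.verts Δ with I.ρ Δ u = w, x u = 0
  rw [Finset.sum_eq_zero]
  intro v hv
  rw [Finset.mem_filter] at hv
  rw [← I.image, ← hv.2] at hw
  exact absurd (Finset.mem_image_of_mem _ hv.1) hw

theorem push_mem {Δ : T.Facet} {x : L → ℝ} (hx : x ∈ T.simplex Δ) :
    I.push Δ x ∈ S.simplex (I.e Δ) := by
  refine ⟨fun w => Finset.sum_nonneg fun v _ => hx.1 v, ?_, fun w => I.push_eq_zero Δ x⟩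
  show ∑ w, ∑ u ∈ T.verts Δ with I.ρ Δ u = w, x u = 1
  rw [Finset.sum_fiberwise, ← hx.2.1]
  exact Finset.sum_subset (Finset.subset_univ _) fun v _ hv => hx.2.2 v hv

/-- The inverse of `push` on the simplex. -/
noncomputable def pull (Δ : T.Facet) (y : L' → ℝ) : L → ℝ :=
  fun v => if v ∈ T.verts Δ then y (I.ρ Δ v) else 0

theorem pull_push {Δ : T.Facet} {x : L → ℝ} (hx : x ∈ T.simplex Δ) :
    I.pull Δ (I.push Δ x) = x := by
  ext v
  by_cases hv : v ∈ T.verts Δ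
  · simp [pull, hv, push_apply]
  · simp [pull, hv, hx.2.2 v hv]

theorem push_pull {Δ : T.Facet} {y : L' → ℝ} (hy : y ∈ S.simplex (I.e Δ)) :
    I.push Δ (I.pull Δ y) = y := by
  ext w
  by_cases hw : w ∈ S.verts (I.e Δ)
  · have := hw
    rw [← I.image, Finset.mem_image] at this
    obtain ⟨v, hv, rfl⟩ := this
    simp [I.push_apply Δ _ hv, pull, hv]
  · rw [hy.2.2 w hw, I.push_eq_zero Δ _ hw]

theorem pull_mem {Δ : T.Facet} {y : L' → ℝ} (hy : y ∈ S.simplex (I.e Δ)) :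
    I.pull Δ y ∈ T.simplex Δ := by
  refine ⟨fun v => ?_, ?_, fun v hv => by simp [pull, hv]⟩
  · unfold pull
    split_ifs
    exacts [hy.1 _, le_rfl]
  · rw [← hy.2.1, ← Finset.sum_subset (Finset.subset_univ (S.verts (I.e Δ)))
      fun v _ hv => hy.2.2 v hv, ← I.image, Finset.sum_image (I.injOn Δ)]
    simp [pull, Finset.sum_ite_mem]

/-- The map of underlying spaces. -/
noncomputable def map : T.Space → S.Space :=
  T.spaceLift (fun Δ x => S.toSpace (I.e Δ) ⟨I.push Δ x.1, I.push_mem x.2⟩) <| by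
    intro Δ x i Δ' g y hg h0 hxy
    obtain ⟨g', hg', hc⟩ := I.glue hg
    refine toSpace_eq hg' _ _ ?_ fun w => ?_
    · rw [I.push_apply Δ _ (T.glue_mem hg), h0]
    · by_cases hw : w ∈ S.verts (I.e Δ)
      · have := hw
        rw [← I.image, Finset.mem_image] at this
        obtain ⟨v, hv, rfl⟩ := this
        rw [hc v hv, I.push_apply Δ _ hv, I.push_apply Δ' _ ((mem_verts_iff hg v).2 hv), hxy]
      · rw [I.push_eq_zero Δ _ hw, I.push_eq_zero Δ']
        rwa [mem_verts_iff hg']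

/-- An `Iso` transports gluings only from `T` to `S`. Since `T` is closed, every ridge of `T` has a
gluing to transport, and uniqueness of gluings in `S` shows that all gluings of `S` arise in this
way; hence `pull` respects them. -/
theorem map_bijective (hT : T.IsClosed) : Function.Bijective I.map := by
  have key : ∀ Δ' (y : S.simplex Δ') i' Δ'' g' (y' : S.simplex Δ''), S.glue Δ' i' Δ'' g' →
      y.1 i' = 0 → (∀ v, y'.1 (g' v) = y.1 v) →
      ∀ h h', T.toSpace (I.e.symm Δ') ⟨I.pull (I.e.symm Δ') y.1, h⟩ =
        T.toSpace (I.e.symm Δ'') ⟨I.pull (I.e.symm Δ'') y'.1, h'⟩ := by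
    intro Δ' y i' Δ'' g' y' hg' h0 hyy h h'
    obtain ⟨Δ, rfl⟩ := I.e.surjective Δ'
    obtain ⟨Δ₁, rfl⟩ := I.e.surjective Δ''
    have hi := S.glue_mem hg'
    rw [← I.image, Finset.mem_image] at hi
    obtain ⟨i, hi, rfl⟩ := hi
    obtain ⟨Δ₂, g, hg⟩ := hT Δ i hi
    obtain ⟨g₂, hg₂, hc⟩ := I.glue hg
    obtain ⟨h1, rfl⟩ := S.glue_unique hg₂ hg'
    obtain rfl := I.e.injective h1
    -- Replacing `e.symm (e Δ)` by a variable facet equal to `Δ` avoids rewriting inside the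
    -- membership proofs.
    suffices H : ∀ Δa (_ : Δa = Δ) Δb (_ : Δb = Δ₂) ha hb,
        T.toSpace Δa ⟨I.pull Δa y.1, ha⟩ = T.toSpace Δb ⟨I.pull Δb y'.1, hb⟩ from
      H _ (I.e.symm_apply_apply _) _ (I.e.symm_apply_apply _) h h'
    rintro Δ rfl Δ₂ rfl ha hb
    refine toSpace_eq hg _ _ ?_ fun v => ?_
    · simp [pull, h0]
    · by_cases hv : v ∈ T.verts Δ
      · simp [pull, hv, (mem_verts_iff hg v).2 hv, ← hc v hv, hyy]
      · simp [pull, hv, mem_verts_iff hg v]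
  have hmem : ∀ Δ' (y : S.simplex Δ'), I.pull (I.e.symm Δ') y.1 ∈ T.simplex (I.e.symm Δ') := by
    intro Δ' y
    obtain ⟨Δ, rfl⟩ := I.e.surjective Δ'
    simpa using I.pull_mem (Δ := Δ) y.2
  let inv : S.Space → T.Space := S.spaceLift
    (fun Δ' y => T.toSpace (I.e.symm Δ') ⟨I.pull _ y.1, hmem Δ' y⟩)
    fun Δ' y i' Δ'' g' y' hg h0 hyy => key Δ' y i' Δ'' g' y' hg h0 hyy _ _
  refine Function.bijective_iff_has_inverse.2 ⟨inv, space_ind fun Δ x => ?_,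
    space_ind fun Δ' y => ?_⟩
  · have : ∀ Δ₁ (_ : Δ₁ = Δ) (h : I.pull Δ₁ (I.push Δ x.1) ∈ T.simplex Δ₁),
        T.toSpace Δ₁ ⟨_, h⟩ = T.toSpace Δ x := by
      rintro _ rfl h
      congr
      exact I.pull_push x.2
    exact this _ (I.e.symm_apply_apply Δ) (hmem (I.e Δ) ⟨_, I.push_mem x.2⟩)
  · obtain ⟨Δ, rfl⟩ := I.e.surjective Δ'
    have : ∀ Δ₁ (_ : Δ₁ = Δ) (h : I.pull Δ₁ y.1 ∈ T.simplex Δ₁),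
        I.map (T.toSpace Δ₁ ⟨_, h⟩) = S.toSpace (I.e Δ) y := by
      rintro _ rfl h
      show S.toSpace (I.e _) ⟨I.push _ (I.pull _ y.1), _⟩ = _
      congr
      exact I.push_pull y.2
    exact this _ (I.e.symm_apply_apply Δ) (hmem (I.e Δ) y)

theorem isPLMap : IsPLMap T S I.map := fun Δ =>
  ⟨{Set.univ}, Set.finite_singleton _, by simpa using isConvexPolyhedron_univ, by simp, by
    rintro P -
    exact ⟨I.e Δ, (I.push Δ).toAffineMap, fun x _ => ⟨I.push_mem x.2, rfl⟩⟩⟩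

theorem isPLSphere (I : Iso T S) {k : ℕ} (hT : T.IsClosed) (hS : S.IsPLSphere k) : T.IsPLSphere k :=
  hS.of_bijective I.map (I.map_bijective hT) I.isPLMap

end Iso

variable {V : Type} [Fintype V] [DecidableEq V]

/-! ### Bistellar moves -/

/-- The triangulations `T` and `S` differ by a bistellar move: the facets `V \ {j}`, `j ∈ τ`, of `T`
are replaced by the facets `V \ {i}`, `i ∉ τ`, of `S`. The function `c` gives for a facet of `T`
either the corresponding facet of `S`, or the label in `τ` that it misses, and `Y` gives the new
facets of `S`. -/
structure Bistellar (T S : GenTriangulation V) (τ : Finset V) where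
  c : T.Facet → S.Facet ⊕ V
  Y : V → S.Facet
  verts_inl : ∀ {Δ a}, c Δ = .inl a → T.verts Δ = S.verts a
  mem_inr : ∀ {Δ j}, c Δ = .inr j → j ∈ τ
  verts_inr : ∀ {Δ j}, c Δ = .inr j → T.verts Δ = Finset.univ.erase j
  verts_Y : ∀ {i}, i ∉ τ → S.verts (Y i) = Finset.univ.erase i
  glue_Y : ∀ {i i'}, i ∉ τ → i' ∉ τ → i ≠ i' → S.glue (Y i) i' (Y i') (Equiv.swap i i')
  inl_inl : ∀ {Δ i Δ' g a b}, T.glue Δ i Δ' g → c Δ = .inl a → c Δ' = .inl b → S.glue a i b g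
  inl_inr : ∀ {Δ i Δ' g a j}, T.glue Δ i Δ' g → c Δ = .inl a → c Δ' = .inr j →
    g i ∉ τ ∧ S.glue a i (Y (g i)) (Equiv.swap (g i) j * g)
  inr_inl : ∀ {Δ i Δ' g j b}, T.glue Δ i Δ' g → c Δ = .inr j → c Δ' = .inl b →
    i ∉ τ ∧ S.glue (Y i) j b (g * Equiv.swap i j)
  inr_inr : ∀ {Δ i Δ' g j j'}, T.glue Δ i Δ' g → c Δ = .inr j → c Δ' = .inr j' →
    (i ∈ τ ∧ i = j' ∧ g = Equiv.swap i j) ∨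
    (i ∉ τ ∧ g i ∉ τ ∧ S.glue (Y i) j (Y (g i)) (Equiv.swap (g i) j' * g * Equiv.swap i j))

namespace Bistellar

/-! ### The homeomorphism of a bistellar move in barycentric coordinates -/

section Move

variable (τ : Finset V) (hτ : τ.Nonempty) (hσ : τᶜ.Nonempty)

/-- The smallest barycentric coordinate with label outside `τ`. -/
noncomputable def low (hσ : τᶜ.Nonempty) (x : V → ℝ) : ℝ := τᶜ.inf' hσ x

theorem low_le (x : V → ℝ) {i} (hi : i ∉ τ) : low τ hσ x ≤ x i :=
  Finset.inf'_le _ (Finset.mem_compl.2 hi)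

theorem exists_low (x : V → ℝ) : ∃ i ∉ τ, low τ hσ x = x i := by
  obtain ⟨i, hi, h⟩ := Finset.exists_mem_eq_inf' hσ x
  exact ⟨i, Finset.mem_compl.1 hi, h⟩

theorem low_eq {x : V → ℝ} {i} (hi : i ∉ τ) (h : ∀ k ∉ τ, x i ≤ x k) : low τ hσ x = x i :=
  le_antisymm (low_le τ hσ x hi) (Finset.le_inf' _ _ fun k hk => h k (Finset.mem_compl.1 hk))

/-- Subtract `m` from the coordinates with labels outside `τ`, and distribute the amount over the
coordinates with labels in `τ`. -/
noncomputable def shift (m : ℝ) (x : V → ℝ) : V → ℝ :=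
  fun v => if v ∈ τ then x v + (τᶜ.card : ℝ) / τ.card * m else x v - m

include hτ in
theorem sum_shift (m : ℝ) (x : V → ℝ) : ∑ v, shift τ m x v = ∑ v, x v := by
  have h : (τ.card : ℝ) ≠ 0 := by exact_mod_cast hτ.card_pos.ne'
  rw [← Finset.sum_add_sum_compl τ, ← Finset.sum_add_sum_compl τ x]
  rw [Finset.sum_congr rfl fun v hv => show shift τ m x v = x v + (τᶜ.card : ℝ) / τ.card * m by
      simp [shift, hv],
    Finset.sum_congr (s₁ := τᶜ) rfl fun v hv => show shift τ m x v = x v - m by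
      simp [shift, Finset.mem_compl.1 hv]]
  simp only [Finset.sum_add_distrib, Finset.sum_sub_distrib, Finset.sum_const, nsmul_eq_mul]
  field_simp
  ring

/-- The map of the bistellar move on the simplices. -/
noncomputable def move (x : V → ℝ) : V → ℝ := shift τ (low τ hσ x) x

theorem move_eq_self {x : V → ℝ} (h : low τ hσ x = 0) : move τ hσ x = x := by
  ext v
  simp [move, shift, h]

theorem low_nonneg {x : V → ℝ} (hx : ∀ v, 0 ≤ x v) : 0 ≤ low τ hσ x := by
  obtain ⟨i, -, h⟩ := exists_low τ hσ x
  rw [h]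
  exact hx i

theorem low_eq_zero {x : V → ℝ} (hx : ∀ v, 0 ≤ x v) {i} (hi : i ∉ τ) (h : x i = 0) :
    low τ hσ x = 0 := by
  rw [low_eq τ hσ hi fun k _ => by rw [h]; exact hx k, h]

theorem move_nonneg {x : V → ℝ} (hx : ∀ v, 0 ≤ x v) (v) : 0 ≤ move τ hσ x v := by
  unfold move shift
  split_ifs with h
  · have := low_nonneg τ hσ hx
    have := hx v
    positivity
  · linarith [low_le τ hσ x h]

-- A point of an old facet has a zero coordinate `j` in `τ`, so after the move `j` carries the
-- smallest coordinate in `τ`: exactly the amount that was added. The reverse move thus knows what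
-- to subtract.
include hτ in
theorem low_move {x : V → ℝ} (hx : ∀ v, 0 ≤ x v) {j} (hj : j ∈ τ) (h0 : x j = 0)
    (hτ' : τᶜᶜ.Nonempty) :
    low τᶜ hτ' (move τ hσ x) = (τᶜ.card : ℝ) / τ.card * low τ hσ x := by
  rw [low_eq τᶜ hτ' (i := j) (by simpa using hj)]
  · simp [move, shift, hj, h0]
  · intro k hk
    have hk : k ∈ τ := by simpa using hk
    simp [move, shift, hj, h0, hk, hx k]

include hτ in
theorem move_move {x : V → ℝ} (hx : ∀ v, 0 ≤ x v) {j} (hj : j ∈ τ) (h0 : x j = 0)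
    (hτ' : τᶜᶜ.Nonempty) : move τᶜ hτ' (move τ hσ x) = x := by
  have h : (τ.card : ℝ) ≠ 0 := by exact_mod_cast hτ.card_pos.ne'
  have h' : (τᶜ.card : ℝ) ≠ 0 := by exact_mod_cast hσ.card_pos.ne'
  ext v
  unfold move
  rw [show low τᶜ hτ' (shift τ (low τ hσ x) x) = _ from low_move τ hτ hσ hx hj h0 hτ']
  by_cases hv : v ∈ τ
  · simp [shift, hv]
  · simp only [shift, Finset.mem_compl, hv, not_false_eq_true, if_true, if_false, compl_compl]
    field_simp
    ring

end Move

variable {T S : GenTriangulation V} {τ : Finset V} (B : Bistellar T S τ)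

theorem mem_Y (B : Bistellar T S τ) {y : V → ℝ} (hy : ∀ v, 0 ≤ y v) (hs : ∑ v, y v = 1) {i}
    (hi : i ∉ τ) (h0 : y i = 0) : y ∈ S.simplex (B.Y i) := by
  refine ⟨hy, hs, fun v hv => ?_⟩
  rw [B.verts_Y hi] at hv
  simp only [Finset.mem_erase, Finset.mem_univ, and_true, not_not] at hv
  rw [hv, h0]

/-- The smallest coordinate outside `τ` may be attained twice. Then the moved point lies on the
common ridge of the two new facets, so the choice is immaterial. -/
theorem toSpace_Y (B : Bistellar T S τ) {y : V → ℝ} {i i'} (hi : i ∉ τ) (hi' : i' ∉ τ) (h0 : y i = 0)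
    (h0' : y i' = 0) (h h') : S.toSpace (B.Y i) ⟨y, h⟩ = S.toSpace (B.Y i') ⟨y, h'⟩ := by
  by_cases e : i = i'
  · subst e; rfl
  · refine toSpace_eq (B.glue_Y hi hi' e) _ _ h0' fun v => ?_
    rcases eq_or_ne v i with rfl | hv
    · simp [h0, h0']
    rcases eq_or_ne v i' with rfl | hv'
    · simp [h0, h0']
    rw [Equiv.swap_apply_of_ne_of_ne hv hv']

theorem move_mem {Δ : T.Facet} {x : V → ℝ} (hx : x ∈ T.simplex Δ) {j} (hj : B.c Δ = .inr j)
    (hσ : τᶜ.Nonempty) {i} (hi : i ∉ τ) (h : low τ hσ x = x i) :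
    move τ hσ x ∈ S.simplex (B.Y i) :=
  B.mem_Y (move_nonneg τ hσ hx.1) (by
    unfold move; rw [sum_shift τ ⟨j, B.mem_inr hj⟩, hx.2.1]) hi (by simp [move, shift, hi, h])

/-- The map of the bistellar move on the facets. -/
noncomputable def facetMap (hσ : τᶜ.Nonempty) (Δ : T.Facet) (x : T.simplex Δ) : S.Space :=
  match h : B.c Δ with
  | .inl a => S.toSpace a ⟨x.1, by
      have := x.2
      simpa only [simplex, B.verts_inl h] using this⟩
  | .inr _ => S.toSpace (B.Y (exists_low τ hσ x.1).choose)
      ⟨move τ hσ x.1, B.move_mem x.2 h hσ (exists_low τ hσ x.1).choose_spec.1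
        (exists_low τ hσ x.1).choose_spec.2⟩

theorem facetMap_inl (hσ : τᶜ.Nonempty) {Δ : T.Facet} (x : T.simplex Δ) {a} (h : B.c Δ = .inl a)
    (hx) : B.facetMap hσ Δ x = S.toSpace a ⟨x.1, hx⟩ := by
  unfold facetMap
  split
  · rename_i b hb
    obtain rfl : b = a := Sum.inl_injective (hb.symm.trans h)
    rfl
  · rename_i b hb
    exact absurd (hb.symm.trans h) (by simp)

theorem facetMap_inr (hσ : τᶜ.Nonempty) {Δ : T.Facet} (x : T.simplex Δ) {j} (h : B.c Δ = .inr j)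
    {i} (hi : i ∉ τ) (hx : move τ hσ x.1 i = 0) (hm) :
    B.facetMap hσ Δ x = S.toSpace (B.Y i) ⟨move τ hσ x.1, hm⟩ := by
  unfold facetMap
  split
  · rename_i b hb
    exact absurd (hb.symm.trans h) (by simp)
  · have h1 := (exists_low τ hσ x.1).choose_spec
    refine B.toSpace_Y h1.1 hi ?_ hx _ _
    simp [move, shift, h1.1, h1.2.symm]

/-- The map of underlying spaces. -/
noncomputable def map (hσ : τᶜ.Nonempty) : T.Space → S.Space :=
  T.spaceLift (B.facetMap hσ) <| by
    intro Δ x i Δ' g y hg h0 hxy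
    have hy0 : y.1 (g i) = 0 := by rw [hxy, h0]
    have hout : ∀ {Δ j} (x : T.simplex Δ), B.c Δ = .inr j → x.1 j = 0 := fun x hj =>
      x.2.2.2 _ (by simp [B.verts_inr hj])
    -- The transpositions in the new gluings exchange two labels at which the point vanishes, so
    -- they do not affect it.
    have hswap : ∀ {z : V → ℝ} {a b : V}, z a = 0 → z b = 0 → ∀ v, z (Equiv.swap a b v) = z v := by
      intro z a b ha hb v
      rcases eq_or_ne v a with rfl | hv
      · simp [ha, hb]
      rcases eq_or_ne v b with rfl | hv'
      · simp [ha, hb]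
      rw [Equiv.swap_apply_of_ne_of_ne hv hv']
    -- On the boundary of the replaced ball, where a coordinate outside `τ` vanishes, the move is
    -- the identity. This makes it fit with the unchanged facets.
    have hlow : ∀ {Δ j} (x : T.simplex Δ) {i} (_ : B.c Δ = .inr j), i ∉ τ → x.1 i = 0 →
        ∃ hm, B.facetMap hσ Δ x = S.toSpace (B.Y i) ⟨x.1, hm⟩ := by
      intro Δ j x i hj hi hx0
      have h1 := move_eq_self τ hσ (low_eq_zero τ hσ x.2.1 hi hx0)
      refine ⟨B.mem_Y x.2.1 x.2.2.1 hi hx0, ?_⟩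
      rw [B.facetMap_inr hσ x hj hi (by rw [h1, hx0]) (by
        rw [h1]; exact B.mem_Y x.2.1 x.2.2.1 hi hx0)]
      congr
    have hin : ∀ {Δ a} (x : T.simplex Δ) (h : B.c Δ = .inl a),
        ∃ hm, B.facetMap hσ Δ x = S.toSpace a ⟨x.1, hm⟩ := fun x h =>
      ⟨by simpa only [simplex, B.verts_inl h] using x.2, B.facetMap_inl hσ x h _⟩
    cases h : B.c Δ with
    | inl a =>
      obtain ⟨m, e⟩ := hin x h
      rw [e]
      cases h' : B.c Δ' with
      | inl b =>
        obtain ⟨m', e'⟩ := hin y h'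
        rw [e']
        exact toSpace_eq (B.inl_inl hg h h') _ _ h0 hxy
      | inr j =>
        obtain ⟨h1, h2⟩ := B.inl_inr hg h h'
        obtain ⟨m', e'⟩ := hlow y h' h1 hy0
        rw [e']
        refine toSpace_eq h2 _ _ h0 fun v => ?_
        rw [Equiv.Perm.mul_apply, hswap hy0 (hout y h'), hxy]
    | inr j =>
      cases h' : B.c Δ' with
      | inl b =>
        obtain ⟨m', e'⟩ := hin y h'
        obtain ⟨h1, h2⟩ := B.inr_inl hg h h'
        obtain ⟨m, e⟩ := hlow x h h1 h0
        rw [e, e']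
        refine toSpace_eq h2 _ _ (hout x h) fun v => ?_
        rw [Equiv.Perm.mul_apply, hxy, hswap h0 (hout x h)]
      | inr j' =>
        -- In the first case the ridge is interior to the ball and both sides see the same point of
        -- the simplex; in the second the ball meets itself along its boundary.
        rcases B.inr_inr hg h h' with ⟨h1, rfl, rfl⟩ | ⟨h1, h2, h3⟩
        · have exy : y.1 = x.1 := by
            ext v
            rw [← hxy]
            exact (hswap (hout y h') (by simpa using hy0) v).symm
          obtain ⟨k, hk, hlk⟩ := exists_low τ hσ x.1
          have hk0 : move τ hσ x.1 k = 0 := by simp [move, shift, hk, hlk]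
          rw [B.facetMap_inr hσ x h hk hk0 (B.move_mem x.2 h hσ hk hlk),
            B.facetMap_inr hσ y h' hk (by rw [exy, hk0]) (by
              rw [exy]; exact B.move_mem x.2 h hσ hk hlk)]
          simp only [exy]
        · obtain ⟨m, e⟩ := hlow x h h1 h0
          obtain ⟨m', e'⟩ := hlow y h' h2 hy0
          rw [e, e']
          refine toSpace_eq h3 _ _ (hout x h) fun v => ?_
          rw [Equiv.Perm.mul_apply, Equiv.Perm.mul_apply, hswap hy0 (hout y h'), hxy,
            hswap h0 (hout x h)]

/-- Two bistellar moves are inverse to each other. -/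
structure IsInverse (B : Bistellar T S τ) (B' : Bistellar S T τᶜ) : Prop where
  inl : ∀ {Δ a}, B.c Δ = .inl a → B'.c a = .inl Δ
  Y : ∀ {i}, i ∉ τ → B'.c (B.Y i) = .inr i
  inr : ∀ {Δ j}, B.c Δ = .inr j → B'.Y j = Δ

theorem IsInverse.leftInverse {B : Bistellar T S τ} {B' : Bistellar S T τᶜ} (h : IsInverse B B')
    (hσ : τᶜ.Nonempty) (hτ' : τᶜᶜ.Nonempty) :
    Function.LeftInverse (B'.map hτ') (B.map hσ) := by
  refine space_ind fun Δ x => ?_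
  show B'.map hτ' (B.facetMap hσ Δ x) = _
  cases hc : B.c Δ with
  | inl a =>
    have hx : x.1 ∈ S.simplex a := by simpa only [simplex, B.verts_inl hc] using x.2
    rw [B.facetMap_inl hσ x hc hx]
    exact B'.facetMap_inl hτ' ⟨x.1, hx⟩ (h.inl hc) x.2
  | inr j =>
    obtain ⟨k, hk, hlk⟩ := exists_low τ hσ x.1
    have hk0 : move τ hσ x.1 k = 0 := by simp [move, shift, hk, hlk]
    have hj := B.mem_inr hc
    have hx0 : x.1 j = 0 := x.2.2.2 _ (by simp [B.verts_inr hc])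
    have hmm := move_move τ ⟨j, hj⟩ hσ x.2.1 hj hx0 hτ'
    rw [B.facetMap_inr hσ x hc hk hk0 (B.move_mem x.2 hc hσ hk hlk)]
    have hY : B'.Y j = Δ := h.inr hc
    refine (B'.facetMap_inr hτ' ⟨_, B.move_mem x.2 hc hσ hk hlk⟩ (h.Y hk) (i := j)
      (by simpa using hj) (by simp only [hmm, hx0]) (by simp only [hmm, hY, x.2])).trans ?_
    simp only [hmm]
    subst hY
    rfl

theorem isPLMap (B : Bistellar T S τ) (hσ : τᶜ.Nonempty) : IsPLMap T S (B.map hσ) := by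
  intro Δ
  cases hc : B.c Δ with
  | inl a =>
    refine ⟨{Set.univ}, Set.finite_singleton _, by simpa using isConvexPolyhedron_univ, by simp, ?_⟩
    rintro P -
    refine ⟨a, AffineMap.id ℝ _, fun x _ => ?_⟩
    have hx : x.1 ∈ S.simplex a := by simpa only [simplex, B.verts_inl hc] using x.2
    exact ⟨hx, B.facetMap_inl hσ x hc hx⟩
  | inr j =>
    refine ⟨(fun i => {x : V → ℝ | ∀ k ∉ τ, x i ≤ x k}) '' (τᶜ : Finset V),
      (Finset.finite_toSet _).image _, ?_, ?_, ?_⟩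
    · rintro _ ⟨i, hi, rfl⟩
      classical
      refine ⟨τᶜ.image fun k => ((LinearMap.proj k : (V → ℝ) →ₗ[ℝ] ℝ) -
        LinearMap.proj i).toAffineMap, ?_⟩
      ext x
      simp
    · intro x hx
      obtain ⟨i, hi, h⟩ := exists_low τ hσ x
      refine ⟨_, ⟨i, by simpa using hi, rfl⟩, fun k hk => ?_⟩
      rw [← h]
      exact low_le τ hσ x hk
    · rintro _ ⟨i, hi, rfl⟩
      have hi : i ∉ τ := by simpa using hi
      let A : (V → ℝ) →ₗ[ℝ] (V → ℝ) :=
        { toFun := fun x => shift τ (x i) x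
          map_add' := fun x y => by ext v; simp only [shift, Pi.add_apply]; split_ifs <;> ring
          map_smul' := fun c x => by
            ext v
            simp only [shift, Pi.smul_apply, smul_eq_mul, RingHom.id_apply]
            split_ifs <;> ring }
      refine ⟨B.Y i, A.toAffineMap, fun x hx => ?_⟩
      have hl : low τ hσ x.1 = x.1 i := low_eq τ hσ hi hx
      have hA : A x.1 = move τ hσ x.1 := by show shift τ _ _ = shift τ _ _; rw [hl]
      have hm := B.move_mem x.2 hc hσ hi hl
      refine ⟨by show A x.1 ∈ _; rwa [hA], ?_⟩
      refine (B.facetMap_inr hσ x hc hi (by simp [move, shift, hi, hl]) hm).trans ?_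
      congr 2
      exact hA.symm

theorem isPLSphere {B : Bistellar T S τ} {B' : Bistellar S T τᶜ} (h : IsInverse B B')
    (h' : ∀ {Δ a}, B'.c Δ = .inl a → B.c a = .inl Δ) (h'' : ∀ {Δ j}, B'.c Δ = .inr j → B.Y j = Δ)
    (h₃ : ∀ {i}, i ∈ τ → B.c (B'.Y i) = .inr i)
    (hσ : τᶜ.Nonempty) (hτ : τ.Nonempty) {k : ℕ} (hS : S.IsPLSphere k) : T.IsPLSphere k := by
  have hτ' : τᶜᶜ.Nonempty := by rwa [compl_compl]
  refine hS.of_bijective (B.map hσ) ⟨(h.leftInverse hσ hτ').injective, ?_⟩ (B.isPLMap hσ)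
  refine fun q => ⟨B'.map hτ' q, ?_⟩
  -- The second composite needs a move indexed by `τᶜᶜ`. The index is made a variable so that `B`
  -- can be used along `τᶜᶜ = τ`.
  have key : ∀ (υ : Finset V) (e : υ = τᶜᶜ) (B₀ : Bistellar T S υ) (hυ : υᶜ.Nonempty)
      (_ : ∀ Δ, B₀.c Δ = B.c Δ) (_ : ∀ i, B₀.Y i = B.Y i), B₀.map hυ (B'.map hτ' q) = q := by
    rintro _ rfl B₀ hυ hc hY
    refine IsInverse.leftInverse (B := B') (B' := B₀) ⟨?_, ?_, ?_⟩ hτ' hυ q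
    · intro Δ a e; rw [hc]; exact h' e
    · intro i hi; rw [hc]; exact h₃ (by simpa using hi)
    · intro Δ j e; rw [hY]; exact h'' e
  exact key τ (compl_compl τ).symm B hσ (fun _ => rfl) fun _ => rfl

end Bistellar

variable {L : Type} [Fintype L] [DecidableEq L] {L' : Type} [Fintype L'] [DecidableEq L']

/-! ### Closed triangulations given by maps -/

/-- The closed triangulation in which the ridge of `Δ` opposite to `i` is glued to a ridge of
`nbr Δ i`, the vertices being identified by `act Δ i`. -/
def ofMaps {F : Type} [Finite F] (verts : F → Finset L) (nbr : F → L → F) (act : F → L → L → L)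
    (h : ∀ Δ, ∀ i ∈ verts Δ, (∀ v, act Δ i v ∈ verts (nbr Δ i) ↔ v ∈ verts Δ) ∧
      nbr (nbr Δ i) (act Δ i i) = Δ ∧ (∀ v, act (nbr Δ i) (act Δ i i) (act Δ i v) = v) ∧
      (nbr Δ i, act Δ i i) ≠ (Δ, i)) : GenTriangulation L where
  Facet := F
  finite_facet := inferInstance
  verts := verts
  glue Δ i Δ' g := i ∈ verts Δ ∧ nbr Δ i = Δ' ∧ ∀ v, g v = act Δ i v
  glue_mem h := h.1
  glue_verts := by
    rintro Δ i _ g ⟨hi, rfl, hg⟩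
    ext v
    rw [Finset.mem_map_equiv, ← (h Δ i hi).1, ← hg, Equiv.apply_symm_apply]
  glue_symm := by
    rintro Δ i _ g ⟨hi, rfl, hg⟩
    obtain ⟨h1, h2, h3, -⟩ := h Δ i hi
    refine ⟨by rwa [hg, h1], by rw [hg, h2], fun v => ?_⟩
    rw [hg, Equiv.Perm.inv_eq_iff_eq, hg]
    obtain ⟨w, rfl⟩ := g.surjective v
    rw [hg w, h3]
  glue_unique := by
    rintro Δ i _ g₁ _ g₂ ⟨-, rfl, h₁⟩ ⟨-, rfl, h₂⟩
    exact ⟨rfl, Equiv.ext fun v => (h₁ v).trans (h₂ v).symm⟩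
  glue_ne := by
    rintro Δ i _ g ⟨hi, rfl, hg⟩
    rw [hg]
    exact (h Δ i hi).2.2.2

section ofMaps

variable {F : Type} [Finite F] {verts : F → Finset L} {nbr : F → L → F} {act : F → L → L → L}
  (h : ∀ Δ, ∀ i ∈ verts Δ, (∀ v, act Δ i v ∈ verts (nbr Δ i) ↔ v ∈ verts Δ) ∧
      nbr (nbr Δ i) (act Δ i i) = Δ ∧ (∀ v, act (nbr Δ i) (act Δ i i) (act Δ i v) = v) ∧
      (nbr Δ i, act Δ i i) ≠ (Δ, i))

include h in
theorem exists_perm_act {Δ i} (hi : i ∈ verts Δ) : ∃ g : Equiv.Perm L, ∀ v, g v = act Δ i v :=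
  have hinj : Function.Injective (act Δ i) := fun v w e => by
    rw [← (h Δ i hi).2.2.1 v, e, (h Δ i hi).2.2.1 w]
  ⟨Equiv.ofBijective _ (Finite.injective_iff_bijective.1 hinj), fun _ => rfl⟩

theorem ofMaps_isClosed : (ofMaps verts nbr act h).IsClosed := fun Δ i hi =>
  have ⟨g, hg⟩ := exists_perm_act h hi
  ⟨nbr Δ i, g, hi, rfl, hg⟩

end ofMaps

/-- An isomorphism to a triangulation given by maps. -/
def Iso.toMaps {T : GenTriangulation L'} {F : Type} [Finite F] {verts : F → Finset L}
    {nbr : F → L → F} {act : F → L → L → L} (h)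
    (e : T.Facet ≃ F) (ρ : T.Facet → L' → L) (injOn : ∀ Δ, Set.InjOn (ρ Δ) (T.verts Δ))
    (image : ∀ Δ, (T.verts Δ).image (ρ Δ) = verts (e Δ))
    (glue : ∀ {Δ i Δ' g}, T.glue Δ i Δ' g → nbr (e Δ) (ρ Δ i) = e Δ' ∧
      ∀ v ∈ T.verts Δ, act (e Δ) (ρ Δ i) (ρ Δ v) = ρ Δ' (g v)) :
    Iso T (ofMaps verts nbr act h) where
  e := e
  ρ := ρ
  injOn := injOn
  image := image
  glue {Δ i Δ' g} hg := by
    have hi : ρ Δ i ∈ verts (e Δ) := by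
      rw [← image]
      exact Finset.mem_image_of_mem _ (T.glue_mem hg)
    obtain ⟨g', hg'⟩ := exists_perm_act h hi
    exact ⟨g', ⟨hi, (glue hg).1, hg'⟩, fun v hv => by rw [hg', (glue hg).2 v hv]⟩

/-! ### The boundary of the simplex -/

/-- The barycentric coordinates themselves are the homeomorphism. The transposition in a gluing only
exchanges two zero coordinates. -/
theorem isPLSphere_of_boundary {k : ℕ} {T : GenTriangulation (Fin (k + 2))}
    (c : T.Facet ≃ Fin (k + 2)) (hv : ∀ Δ, T.verts Δ = Finset.univ.erase (c Δ))
    (hg : ∀ Δ i, i ≠ c Δ → T.glue Δ i (c.symm i) (Equiv.swap (c Δ) i)) : T.IsPLSphere k := by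
  have hout : ∀ {Δ} {x : Fin (k + 2) → ℝ}, x ∈ T.simplex Δ → x (c Δ) = 0 := fun hx =>
    hx.2.2 _ (by simp [hv])
  refine ⟨T.spaceLift (fun Δ x => x.1) ?_, ?_, ?_, fun Δ => ?_⟩
  · intro Δ x i Δ' g y h h0 hxy
    obtain ⟨rfl, rfl⟩ := T.glue_unique h (hg Δ i (by
      have := T.glue_mem h
      rw [hv] at this
      exact Finset.ne_of_mem_erase this))
    have hyi : y.1 i = 0 := by simpa using hout y.2
    have hyc : y.1 (c Δ) = 0 := by rw [← h0, ← hxy]; simp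
    ext v
    rw [← hxy]
    rcases eq_or_ne v i with rfl | h1
    · simp [hyi, hyc]
    rcases eq_or_ne v (c Δ) with rfl | h2
    · simp [hyi, hyc]
    rw [Equiv.swap_apply_of_ne_of_ne h2 h1]
  · refine space_ind fun Δ x => space_ind fun Δ' y (hxy : x.1 = y.1) => ?_
    obtain ⟨x, hx⟩ := x
    obtain ⟨y, hy⟩ := y
    obtain rfl : x = y := hxy
    by_cases e : Δ' = Δ
    · subst e; rfl
    have e' : c Δ' ≠ c Δ := fun h => e (c.injective h)
    have hg' := hg Δ (c Δ') e'
    rw [Equiv.symm_apply_apply] at hg'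
    refine toSpace_eq hg' _ _ (hout hy) fun v => ?_
    rcases eq_or_ne v (c Δ) with rfl | h1
    · simp [hout hx, hout hy]
    rcases eq_or_ne v (c Δ') with rfl | h2
    · simp [hout hx, hout hy]
    rw [Equiv.swap_apply_of_ne_of_ne h1 h2]
  · ext y
    constructor
    · rintro ⟨q, rfl⟩
      revert q
      refine space_ind fun Δ x => ?_
      exact ⟨x.2.1, x.2.2.1, c Δ, hout x.2⟩
    · rintro ⟨h1, h2, j, hj⟩
      refine ⟨T.toSpace (c.symm j) ⟨y, h1, h2, fun v hv' => ?_⟩, rfl⟩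
      rw [hv] at hv'
      simp only [Equiv.apply_symm_apply, Finset.mem_erase, Finset.mem_univ, and_true,
        not_not] at hv'
      rw [hv', hj]
  · exact ⟨{Set.univ}, Set.finite_singleton _, by simpa using isConvexPolyhedron_univ, by simp, by
      rintro P -
      exact ⟨AffineMap.id ℝ _, fun x _ => rfl⟩⟩

/-! ### Tables -/

/-- A table describes a closed triangulation with labels in `Fin m`, each facet of which misses
exactly one label. The row of a facet is the pair of the missing label and the list of the gluings
of the ridges, opposite to the labels `0, …, m - 1`. The last `m` decimal digits of a gluing, from
the right to the left, are the images of the labels, the others are the number of the glued facet.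
(The entry at the missing label is of no importance.) -/
abbrev Table := List (ℕ × List ℕ)

namespace Table

variable {m : ℕ} [NeZero m]

def miss (t : Table) (m : ℕ) [NeZero m] (Δ : Fin t.length) : Fin m := Fin.ofNat m (t.get Δ).1

def entry (t : Table) (Δ : Fin t.length) (i : Fin m) : ℕ := (t.get Δ).2.getD i 0

def nbr (t : Table) (Δ : Fin t.length) (i : Fin m) : Fin t.length :=
  ⟨t.entry Δ i / 10 ^ m % t.length, Nat.mod_lt _ Δ.pos⟩

def act (t : Table) (Δ : Fin t.length) (i v : Fin m) : Fin m :=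
  Fin.ofNat m (t.entry Δ i / 10 ^ v.1 % 10)

def verts (t : Table) (m : ℕ) [NeZero m] (Δ : Fin t.length) : Finset (Fin m) :=
  Finset.univ.erase (t.miss m Δ)

/-- The gluings of the table fit together. -/
def IsValid (t : Table) (m : ℕ) [NeZero m] : Prop :=
  ∀ (Δ : Fin t.length) (i : Fin m), i ≠ t.miss m Δ →
    t.act Δ i (t.miss m Δ) = t.miss m (t.nbr Δ i) ∧
    t.nbr (t.nbr Δ i) (t.act Δ i i) = Δ ∧
    (∀ v, t.act (t.nbr Δ i) (t.act Δ i i) (t.act Δ i v) = v) ∧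
    (t.nbr Δ i = Δ → t.act Δ i i ≠ i)

instance (t : Table) : Decidable (t.IsValid m) := by unfold IsValid; infer_instance

theorem IsValid.maps {t : Table} (h : t.IsValid m) (Δ) (i : Fin m) (hi : i ∈ t.verts m Δ) :
    (∀ v, t.act Δ i v ∈ t.verts m (t.nbr Δ i) ↔ v ∈ t.verts m Δ) ∧
      t.nbr (t.nbr Δ i) (t.act Δ i i) = Δ ∧
      (∀ v, t.act (t.nbr Δ i) (t.act Δ i i) (t.act Δ i v) = v) ∧
      (t.nbr Δ i, t.act Δ i i) ≠ (Δ, i) := by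
  obtain ⟨h1, h2, h3, h4⟩ := h Δ i (by simpa [verts] using hi)
  refine ⟨fun v => ?_, h2, h3, fun e => h4 (congrArg Prod.fst e) (congrArg Prod.snd e)⟩
  simp only [verts, Finset.mem_erase, Finset.mem_univ, and_true, ← h1, not_iff_not, ne_eq]
  exact ⟨fun e => by rw [← h3 v, e, h3], fun e => by rw [e]⟩

/-- The triangulation given by a table. -/
def toGenTriangulation (t : Table) (h : t.IsValid m) : GenTriangulation (Fin m) :=
  ofMaps (t.verts m) t.nbr t.act h.maps

/-- The map on facets `c` and the facets `Y` give a bistellar move. -/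
def bistellarCheck (t s : Table) (τ : Finset (Fin m)) (c : Fin t.length → Fin s.length ⊕ Fin m)
    (Y : Fin m → Fin s.length) : Bool :=
  (decide <| ∀ Δ, (match c Δ with
    | .inl a => decide (t.miss m Δ = s.miss m a)
    | .inr j => decide (j ∈ τ ∧ t.miss m Δ = j) : Bool) = true) &&
  (decide <| ∀ i ∉ τ, s.miss m (Y i) = i ∧ ∀ i' ∉ τ, i ≠ i' →
    s.nbr (Y i) i' = Y i' ∧ ∀ v, s.act (Y i) i' v = Equiv.swap i i' v) &&
  (decide <| ∀ (Δ : Fin t.length) (i : Fin m), i ≠ t.miss m Δ →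
    (match c Δ, c (t.nbr Δ i) with
    | .inl a, .inl b => decide (s.nbr a i = b ∧ ∀ v, s.act a i v = t.act Δ i v)
    | .inl a, .inr j => decide (t.act Δ i i ∉ τ ∧ s.nbr a i = Y (t.act Δ i i) ∧
        ∀ v, s.act a i v = Equiv.swap (t.act Δ i i) j (t.act Δ i v))
    | .inr j, .inl b => decide (i ∉ τ ∧ s.nbr (Y i) j = b ∧
        ∀ v, s.act (Y i) j v = t.act Δ i (Equiv.swap i j v))
    | .inr j, .inr j' => decide ((i ∈ τ ∧ i = j' ∧ ∀ v, t.act Δ i v = Equiv.swap i j v) ∨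
        (i ∉ τ ∧ t.act Δ i i ∉ τ ∧ s.nbr (Y i) j = Y (t.act Δ i i) ∧
          ∀ v, s.act (Y i) j v = Equiv.swap (t.act Δ i i) j' (t.act Δ i (Equiv.swap i j v)))) : Bool) = true)

/-- The bistellar move given by a check. -/
def bistellar {t s : Table} {ht : t.IsValid m} {hs : s.IsValid m} {τ : Finset (Fin m)}
    {c : Fin t.length → Fin s.length ⊕ Fin m} {Y : Fin m → Fin s.length}
    (h : bistellarCheck t s τ c Y) :
    Bistellar (t.toGenTriangulation ht) (s.toGenTriangulation hs) τ := by
  simp only [bistellarCheck, Bool.and_eq_true, decide_eq_true_eq] at h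
  have h1 := h.1.1
  have h2 := h.1.2
  have h3 := h.2
  have hne : ∀ {Δ} {i : Fin m}, i ∈ t.verts m Δ → i ≠ t.miss m Δ := fun hi => by
    simpa [verts] using hi
  have hmem : ∀ {Δ} {i : Fin m}, i ≠ s.miss m Δ → i ∈ s.verts m Δ := fun hi => by
    simpa [verts] using hi
  refine
    { c := c
      Y := Y
      verts_inl := fun {Δ a} e => ?_
      mem_inr := fun {Δ j} e => ?_
      verts_inr := fun {Δ j} e => ?_
      verts_Y := fun {i} hi => ?_
      glue_Y := fun {i i'} hi hi' hii => ?_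
      inl_inl := ?_
      inl_inr := ?_
      inr_inl := ?_
      inr_inr := ?_ }
  · have := h1 Δ
    simp only [e, decide_eq_true_eq] at this
    show t.verts m Δ = s.verts m a
    simp only [Table.verts, this]
  · have := h1 Δ
    simp only [e, decide_eq_true_eq] at this
    exact this.1
  · have := h1 Δ
    simp only [e, decide_eq_true_eq] at this
    show t.verts m Δ = _
    simp only [Table.verts, this.2]
  · show s.verts m (Y i) = _
    simp only [Table.verts, (h2 i hi).1]
  · obtain ⟨e1, e2⟩ := (h2 i hi).2 i' hi' hii
    exact ⟨hmem (by rw [(h2 i hi).1]; exact hii.symm), e1, fun v => (e2 v).symm⟩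
  · rintro Δ i Δ' g a b ⟨hi, rfl, hg⟩ ha hb
    have := h3 Δ i (hne hi)
    have h1' := h1 Δ
    simp only [ha, hb, decide_eq_true_eq] at this h1'
    exact ⟨hmem (by rw [← h1']; exact hne hi), this.1, fun v => by rw [hg, this.2]⟩
  · rintro Δ i Δ' g a j ⟨hi, rfl, hg⟩ ha hb
    have := h3 Δ i (hne hi)
    have h1' := h1 Δ
    simp only [ha, hb, decide_eq_true_eq] at this h1'
    refine ⟨by rw [hg]; exact this.1, hmem (by rw [← h1']; exact hne hi), ?_, fun v => ?_⟩
    · rw [hg]; exact this.2.1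
    · rw [this.2.2, Equiv.Perm.mul_apply, hg, hg]
  · rintro Δ i Δ' g j b ⟨hi, rfl, hg⟩ ha hb
    have := h3 Δ i (hne hi)
    have h1' := h1 Δ
    simp only [ha, hb, decide_eq_true_eq] at this h1'
    refine ⟨this.1, hmem ?_, this.2.1, fun v => ?_⟩
    · rw [(h2 i this.1).1]; rintro rfl; exact this.1 h1'.1
    · rw [this.2.2, Equiv.Perm.mul_apply, hg]
  · rintro Δ i Δ' g j j' ⟨hi, rfl, hg⟩ ha hb
    have := h3 Δ i (hne hi)
    have h1' := h1 Δ
    simp only [ha, hb, decide_eq_true_eq] at this h1'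
    rcases this with ⟨k1, k2, k3⟩ | ⟨k1, k2, k3, k4⟩
    · exact .inl ⟨k1, k2, Equiv.ext fun v => by rw [hg, k3]⟩
    · refine .inr ⟨k1, by rw [hg]; exact k2, hmem ?_, ?_, fun v => ?_⟩
      · rw [(h2 i k1).1]; rintro rfl; exact k1 h1'.1
      · rw [hg]; exact k3
      · rw [k4, Equiv.Perm.mul_apply, Equiv.Perm.mul_apply, hg, hg]

end Table

/-! ### Certificates for moves, isomorphisms and reductions -/

namespace Table

variable {m : ℕ} [NeZero m]

/-- The reduction modulo the length only makes the stored numbers total; the checks confirm whatever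
facet results. -/
def pick (t : Table) (h : 0 < t.length) (n : ℕ) : Fin t.length := ⟨n % t.length, Nat.mod_lt _ h⟩

/-- The first `o` facets are not changed, the others miss the labels from `a` on. -/
def split (t s : Table) (m : ℕ) [NeZero m] (h : 0 < s.length) (o a : ℕ) (Δ : Fin t.length) :
    Fin s.length ⊕ Fin m :=
  if Δ.1 < o then .inl (s.pick h Δ) else .inr (Fin.ofNat m (a + Δ.1 - o))

def firstLabels (m a : ℕ) : Finset (Fin m) := Finset.univ.filter (·.1 < a)

/-- The last `a` facets of `t` miss the labels `0, …, a - 1`, and are replaced by the other facets of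
the boundary of a simplex, which are the last facets of `s`. -/
def moveCheck (t s : Table) (m : ℕ) [NeZero m] (a : ℕ) : Bool :=
  if h : 0 < t.length ∧ 0 < s.length then
    let o := t.length - a
    let τ := firstLabels m a
    let c := split t s m h.2 o 0
    let c' := split s t m h.1 o a
    -- The new facets stand at the end of `s` and miss the labels from `a` on, so the one missing
    -- `i` has number `o + (i - a)`.
    let Y := fun i : Fin m => s.pick h.2 (o + i - a)
    let Y' := fun i : Fin m => t.pick h.1 (o + i)
    bistellarCheck t s τ c Y && bistellarCheck s t τᶜ c' Y' &&
    (decide <| ∀ Δ, (match c Δ with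
      | .inl a => decide (c' a = .inl Δ)
      | .inr j => decide (Y' j = Δ) : Bool) = true) &&
    (decide <| ∀ Δ, (match c' Δ with
      | .inl a => decide (c a = .inl Δ)
      | .inr j => decide (Y j = Δ) : Bool) = true) &&
    (decide <| (∀ i ∉ τ, c' (Y i) = .inr i) ∧ (∀ i ∈ τ, c (Y' i) = .inr i) ∧
      (∃ i, i ∈ τ) ∧ ∃ i, i ∉ τ)
  else false

theorem isPLSphere_of_moveCheck {t s : Table} {a k : ℕ} (h : moveCheck t s m a)
    (ht : t.IsValid m) (hs : s.IsValid m) (hk : (s.toGenTriangulation hs).IsPLSphere k) :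
    (t.toGenTriangulation ht).IsPLSphere k := by
  unfold moveCheck at h
  split at h
  · rename_i h0
    simp only [Bool.and_eq_true, decide_eq_true_eq] at h
    obtain ⟨⟨⟨⟨h1, h2⟩, h3⟩, h4⟩, h5, h6, ⟨i, hi⟩, ⟨j, hj⟩⟩ := h
    refine Bistellar.isPLSphere (B := bistellar h1) (B' := bistellar h2)
      ⟨fun {Δ b} e => ?_, fun {i} hi => h5 i hi, fun {Δ j} e => ?_⟩ (fun {Δ b} e => ?_)
      (fun {Δ j} e => ?_) (fun {i} hi => h6 i hi) ⟨j, Finset.mem_compl.2 hj⟩ ⟨i, hi⟩ hk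
    · have e' : split t s m h0.2 (t.length - a) 0 Δ = .inl b := e
      have := h3 Δ
      rw [e'] at this
      simp only [decide_eq_true_eq] at this
      exact this
    · have e' : split t s m h0.2 (t.length - a) 0 Δ = .inr j := e
      have := h3 Δ
      rw [e'] at this
      simp only [decide_eq_true_eq] at this
      exact this
    · have e' : split s t m h0.1 (t.length - a) a Δ = .inl b := e
      have := h4 Δ
      rw [e'] at this
      simp only [decide_eq_true_eq] at this
      exact this
    · have e' : split s t m h0.1 (t.length - a) a Δ = .inr j := e
      have := h4 Δ
      rw [e'] at this
      simp only [decide_eq_true_eq] at this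
      exact this
  · simp at h

/-- The decimal digits of the codes `ρ` give the maps of the labels of the facets. -/
def relabel (ρ : List ℕ) (m : ℕ) [NeZero m] (n : ℕ) (v : Fin m) : Fin m :=
  Fin.ofNat m (ρ.getD n 0 / 10 ^ v.1 % 10)

/-- The map of the facets `e` and the maps of the labels `ρ` give an isomorphism. -/
def isoCheck (t s : Table) (m : ℕ) [NeZero m] (e ρ : List ℕ) : Bool :=
  if h : 0 < s.length then
    let f := fun Δ : Fin t.length => s.pick h (e.getD Δ 0)
    (decide <| t.length = s.length ∧ ∀ Δ Δ', f Δ = f Δ' → Δ = Δ') &&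
    (decide <| ∀ Δ : Fin t.length, (∀ v w : Fin m, relabel ρ m Δ v = relabel ρ m Δ w → v = w) ∧
      relabel ρ m Δ (t.miss m Δ) = s.miss m (f Δ) ∧
      ∀ i, i ≠ t.miss m Δ → s.nbr (f Δ) (relabel ρ m Δ i) = f (t.nbr Δ i) ∧
        ∀ v, s.act (f Δ) (relabel ρ m Δ i) (relabel ρ m Δ v) =
          relabel ρ m (t.nbr Δ i) (t.act Δ i v))
  else false

theorem isPLSphere_of_isoCheck {t s : Table} {e ρ : List ℕ} {k : ℕ} (h : isoCheck t s m e ρ)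
    (ht : t.IsValid m) (hs : s.IsValid m) (hk : (s.toGenTriangulation hs).IsPLSphere k) :
    (t.toGenTriangulation ht).IsPLSphere k := by
  unfold isoCheck at h
  split at h
  · rename_i h0
    simp only [Bool.and_eq_true, decide_eq_true_eq] at h
    obtain ⟨⟨h1, h2⟩, h3⟩ := h
    have hinj : Function.Injective fun Δ : Fin t.length => s.pick h0 (e.getD Δ 0) :=
      fun Δ Δ' => h2 Δ Δ'
    have hbij := (Fintype.bijective_iff_injective_and_card _).2 ⟨hinj, by simpa using h1⟩
    have hρ : ∀ Δ : Fin t.length, Function.Injective (relabel ρ m Δ.1) := fun Δ v w =>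
      (h3 Δ).1 v w
    have himg : ∀ Δ : Fin t.length, (t.verts m Δ).image (relabel ρ m Δ.1) =
        s.verts m (s.pick h0 (e.getD Δ.1 0)) := fun Δ => by
      unfold Table.verts
      rw [Finset.image_erase (hρ Δ), (h3 Δ).2.1,
        Finset.image_univ_of_surjective (Finite.injective_iff_surjective.1 (hρ Δ))]
    refine Iso.isPLSphere (T := t.toGenTriangulation ht) (Iso.toMaps hs.maps
      (Equiv.ofBijective _ hbij) (fun Δ : Fin t.length => relabel ρ m Δ.1)
      (fun Δ => (hρ Δ).injOn) himg ?_) (ofMaps_isClosed _) hk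
    · rintro Δ i _ g ⟨hi, rfl, hg⟩
      have hi' : i ≠ t.miss m Δ := by simpa [Table.verts] using hi
      obtain ⟨k1, k2⟩ := (h3 Δ).2.2 i hi'
      exact ⟨k1, fun v _ => by rw [hg]; exact k2 v⟩
  · simp at h

/-- The table is the boundary of a simplex. -/
def boundaryCheck (t : Table) (m : ℕ) [NeZero m] : Bool :=
  decide <| t.length = m ∧ (∀ Δ Δ', t.miss m Δ = t.miss m Δ' → Δ = Δ') ∧
    ∀ (Δ : Fin t.length) (i : Fin m), i ≠ t.miss m Δ → t.miss m (t.nbr Δ i) = i ∧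
      ∀ v, t.act Δ i v = Equiv.swap (t.miss m Δ) i v

theorem isPLSphere_of_boundaryCheck {t : Table} {k : ℕ} (h : boundaryCheck t (k + 2))
    (ht : t.IsValid (k + 2)) : (t.toGenTriangulation ht).IsPLSphere k := by
  obtain ⟨h1, h2, h3⟩ := of_decide_eq_true h
  have hinj : Function.Injective fun Δ : Fin t.length => t.miss (k + 2) Δ := fun Δ Δ' => h2 Δ Δ'
  have hbij := (Fintype.bijective_iff_injective_and_card _).2 ⟨hinj, by simpa using h1⟩
  refine isPLSphere_of_boundary (T := t.toGenTriangulation ht) (Equiv.ofBijective _ hbij)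
    (fun _ => rfl) fun Δ i hi => ?_
  obtain ⟨k1, k2⟩ := h3 Δ i hi
  have hi' : i ∈ t.verts (k + 2) Δ := Finset.mem_erase.2 ⟨hi, Finset.mem_univ _⟩
  exact ⟨hi', (Equiv.eq_symm_apply (Equiv.ofBijective _ hbij)).2 k1, fun v => (k2 v).symm⟩

/-- A step of a reduction: a bistellar move which replaces the last `size` facets, followed by an
isomorphism. -/
structure Step where
  size : ℕ
  replaced : Table
  facets : List ℕ
  labels : List ℕ
  result : Table

/-- The steps reduce the table to the boundary of a simplex. -/
def reduces (m : ℕ) [NeZero m] : Table → List Step → Bool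
  | t, [] => boundaryCheck t m
  | t, c :: l => moveCheck t c.replaced m c.size && isoCheck c.replaced c.result m c.facets c.labels &&
      decide (c.replaced.IsValid m) && decide (c.result.IsValid m) && reduces m c.result l

theorem isPLSphere_of_reduces {k : ℕ} {t : Table} {l : List Step} (h : reduces (k + 2) t l)
    (ht : t.IsValid (k + 2)) : (t.toGenTriangulation ht).IsPLSphere k := by
  induction l generalizing t with
  | nil => exact isPLSphere_of_boundaryCheck h ht
  | cons c l ih =>
    simp only [reduces, Bool.and_eq_true, decide_eq_true_eq] at h
    obtain ⟨⟨⟨⟨h1, h2⟩, h3⟩, h4⟩, h5⟩ := h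
    exact isPLSphere_of_moveCheck h1 ht h3 (isPLSphere_of_isoCheck h2 h3 h4 (ih h5 h4))

end Table

namespace Table

/-! ### The spheres which occur as links -/

/-- The link of the edge `{0, 1}` of the central pentachora: four triangles around a vertex, each
outer edge of which is capped by a triangle with its other two edges glued together. -/
def fan : Table :=
  [(3, [23201, 71023, 33210, 0]), (3, [71023, 23201, 43210, 0]), (3, [13201, 3201, 53210, 0]), (3, [33201, 33201, 3210, 0]), (3, [43201, 43201, 13210, 0]), (3, [53201, 53201, 23210, 0]), (0, [0, 73201, 62310, 62310]), (1, [63201, 0, 132, 10132])]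

def fanSteps : List Step := [
  ⟨2, [(3, [23201, 62013, 33210, 0]), (3, [73021, 23201, 43210, 0]), (3, [13201, 3201, 53210, 0]), (3, [33201, 33201, 3210, 0]), (3, [43201, 43201, 13210, 0]), (3, [53201, 53201, 23210, 0]), (2, [72310, 312, 0, 72310]), (3, [62310, 13102, 62310, 0])],
    [7, 0, 1, 2, 3, 4, 6, 5], [1302, 3210, 3210, 3210, 3210, 3210, 2013, 3210],
    [(3, [53021, 13201, 33210, 0]), (3, [3201, 71320, 43210, 0]), (3, [23201, 23201, 71302, 0]), (3, [33201, 33201, 3210, 0]), (3, [43201, 43201, 13210, 0]), (3, [60213, 3102, 60213, 0]), (0, [0, 73201, 50213, 50213]), (1, [63201, 0, 12130, 22031])]⟩,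
  ⟨2, [(3, [53021, 13201, 33210, 0]), (3, [3201, 62310, 43210, 0]), (3, [23201, 23201, 73102, 0]), (3, [33201, 33201, 3210, 0]), (3, [43201, 43201, 13210, 0]), (3, [73210, 3102, 62013, 0]), (2, [50312, 12310, 0, 72310]), (3, [53210, 23021, 62310, 0])],
    [0, 1, 2, 3, 4, 7, 6, 5], [3210, 3210, 3210, 3210, 3210, 2130, 132, 132],
    [(3, [72013, 13201, 33210, 0]), (3, [3201, 61032, 43210, 0]), (3, [23201, 23201, 50321, 0]), (3, [33201, 33201, 3210, 0]), (3, [43201, 43201, 13210, 0]), (0, [0, 63201, 73012, 22103]), (1, [53201, 0, 73120, 11032]), (2, [53012, 63120, 0, 312])]⟩,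
  ⟨3, [(3, [53012, 13201, 33210, 0]), (3, [3201, 53012, 43210, 0]), (3, [23201, 23201, 53021, 0]), (3, [33201, 33201, 3210, 0]), (3, [43201, 43201, 13210, 0]), (3, [23102, 13012, 3012, 0])],
    [5, 4, 0, 1, 2, 3], [2310, 1302, 3210, 3210, 3210, 213],
    [(3, [3201, 3201, 30321, 0]), (3, [13201, 13201, 52310, 0]), (3, [23201, 23201, 41302, 0]), (0, [0, 43201, 53012, 2103]), (1, [33201, 0, 53120, 22031]), (2, [33012, 43120, 0, 12310])]⟩,
  ⟨3, [(3, [3201, 3201, 33021, 0]), (3, [13201, 13201, 33210, 0]), (3, [23201, 23201, 33102, 0]), (3, [3102, 23021, 13210, 0])],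
    [3, 0, 1, 2], [1032, 3210, 3210, 321],
    [(3, [3201, 3201, 20321, 0]), (3, [13201, 13201, 20213, 0]), (0, [0, 33201, 10213, 2103]), (1, [23201, 0, 32310, 32310])]⟩,
  ⟨2, [(3, [3201, 3201, 33021, 0]), (3, [13201, 13201, 22013, 0]), (2, [10312, 32310, 0, 32310]), (3, [3102, 22310, 22310, 0])],
    [3, 0, 1, 2], [1032, 3210, 3210, 321],
    [(3, [3201, 3201, 12013, 0]), (2, [312, 23021, 0, 23021]), (0, [0, 33201, 13102, 13102]), (1, [23201, 0, 32310, 32310])]⟩,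
  ⟨2, [(3, [3201, 3201, 12013, 0]), (2, [312, 23201, 0, 30321]), (2, [13201, 32310, 0, 32310]), (3, [12103, 22310, 22310, 0])],
    [3, 2, 0, 1], [1032, 2031, 3210, 3210],
    [(2, [22013, 12310, 0, 12310]), (3, [20312, 2310, 2310, 0]), (0, [0, 33201, 12013, 312]), (1, [23201, 0, 32310, 32310])]⟩,
  ⟨2, [(2, [32310, 12310, 0, 12310]), (3, [22310, 2310, 2310, 0]), (2, [12310, 32310, 0, 32310]), (3, [2310, 22310, 22310, 0])],
    [3, 0, 1, 2], [3120, 3210, 3210, 321],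
    [(3, [12310, 31320, 31320, 0]), (2, [2310, 23021, 0, 23021]), (0, [0, 33201, 13102, 13102]), (1, [23201, 0, 2130, 2130])]⟩,
  ⟨2, [(3, [12310, 22310, 33120, 0]), (2, [2310, 23201, 0, 30321]), (2, [13201, 2310, 0, 32310]), (3, [12103, 3120, 22310, 0])],
    [0, 1, 2, 3], [321, 3120, 3201, 3201],
    [(0, [0, 13201, 23012, 30213]), (1, [3201, 0, 23120, 31230]), (2, [3012, 13120, 0, 32310]), (3, [213, 11230, 22310, 0])]⟩]

theorem fan_isValid : fan.IsValid 4 := by decide +kernel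

theorem fan_reduces : reduces 4 fan fanSteps := by decide +kernel

theorem isPLSphere_fan : (fan.toGenTriangulation fan_isValid).IsPLSphere 2 :=
  isPLSphere_of_reduces fan_reduces _

/-- The link of an edge at the apex of a snapped pentachoron: such an edge occurs twice, since two
labels have been identified. -/
def snappedPair : Table :=
  [(0, [0, 13201, 2310, 2310]), (1, [3201, 0, 12310, 12310])]

def snappedPairSteps : List Step := [
  ⟨2, [(2, [12310, 12310, 0, 12310]), (3, [2310, 2310, 2310, 0])],
    [1, 0], [3021, 3210],
    [(3, [10321, 10321, 10321, 0]), (0, [0, 2103, 2103, 2103])]⟩,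
  ⟨1, [(3, [11320, 22301, 33021, 0]), (1, [2130, 0, 23120, 31230]), (2, [2301, 13120, 0, 32310]), (3, [3102, 11230, 22310, 0])],
    [0, 1, 2, 3], [321, 3210, 3210, 3210],
    [(0, [0, 13201, 23012, 30213]), (1, [3201, 0, 23120, 31230]), (2, [3012, 13120, 0, 32310]), (3, [213, 11230, 22310, 0])]⟩]

theorem snappedPair_isValid : snappedPair.IsValid 4 := by decide +kernel

theorem snappedPair_reduces : reduces 4 snappedPair snappedPairSteps := by decide +kernel

theorem isPLSphere_snappedPair : (snappedPair.toGenTriangulation snappedPair_isValid).IsPLSphere 2 :=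
  isPLSphere_of_reduces snappedPair_reduces _

/-- The link of the apex of a snapped pentachoron. With a single tetrahedron the first move can only
subdivide it, so the reduction starts by growing. -/
def oneTetrahedron : Table :=
  [(0, [0, 43120, 43120, 34210, 34210])]

def oneTetrahedronSteps : List Step := [
  ⟨1, [(1, [143120, 0, 143120, 241230, 313240]), (2, [43120, 43120, 0, 242310, 323410]), (3, [334210, 41230, 142310, 0, 334210]), (4, [234210, 13240, 123410, 234210, 0])],
    [3, 0, 1, 2], [10423, 43210, 10423, 10423],
    [(2, [310243, 310243, 0, 114023, 240123]), (0, [0, 243201, 343012, 243201, 30142]), (1, [143201, 0, 343120, 143201, 40123]), (2, [143012, 243120, 0, 10243, 10243])]⟩,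
  ⟨3, [(2, [110342, 210423, 0, 210423, 210423]), (3, [143201, 143201, 12043, 0, 234210]), (4, [20143, 20143, 20143, 134210, 0])],
    [2, 0, 1], [43210, 10243, 10243],
    [(0, [0, 143201, 243012, 34210, 34210]), (1, [43201, 0, 243120, 243120, 243120]), (2, [43012, 143120, 0, 143120, 143120])]⟩,
  ⟨3, [(3, [134210, 43120, 43120, 0, 134210]), (4, [34210, 143120, 143120, 34210, 0])],
    [1, 0], [40321, 43210],
    [(4, [104321, 43120, 43120, 104321, 0]), (0, [0, 32104, 142310, 142310, 32104])]⟩,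
  ⟨1, [(4, [114320, 43120, 43120, 440321, 0]), (1, [32140, 0, 243120, 341230, 413240]), (2, [342310, 143120, 0, 342310, 423410]), (3, [242310, 141230, 242310, 0, 434210]), (4, [42103, 113240, 223410, 334210, 0])],
    [0, 4, 1, 2, 3], [43210, 10423, 43210, 10423, 10423],
    [(4, [421043, 43120, 43120, 313042, 0]), (2, [214023, 410243, 0, 214023, 340123]), (0, [0, 343201, 443012, 130142, 130142]), (1, [243201, 0, 443120, 13042, 140123]), (2, [243012, 343120, 0, 10432, 110243])]⟩,
  ⟨3, [(4, [231042, 43120, 43120, 231042, 0]), (2, [214320, 310423, 0, 310423, 310423]), (3, [132140, 14032, 14032, 0, 334210]), (4, [120143, 120143, 120143, 234210, 0])],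
    [0, 3, 1, 2], [43210, 41230, 10342, 10342],
    [(4, [104213, 43120, 43120, 104213, 0]), (0, [0, 243201, 343012, 30214, 30214]), (1, [143201, 0, 343120, 343120, 343120]), (2, [143012, 243120, 0, 243120, 243120])]⟩,
  ⟨3, [(4, [134210, 43120, 43120, 240213, 0]), (3, [34210, 143120, 143120, 0, 234210]), (4, [40213, 243120, 243120, 134210, 0])],
    [2, 0, 1], [21430, 10432, 10432],
    [(0, [0, 143201, 243012, 34210, 34210]), (1, [43201, 0, 243120, 134210, 134210]), (2, [43012, 143120, 0, 234210, 234210])]⟩,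
  ⟨3, [(3, [134210, 134210, 134210, 0, 134210]), (4, [34210, 34210, 34210, 34210, 0])],
    [1, 0], [40321, 43210],
    [(4, [104321, 104321, 104321, 104321, 0]), (0, [0, 32104, 32104, 32104, 32104])]⟩,
  ⟨1, [(4, [114320, 224301, 334021, 440321, 0]), (1, [32140, 0, 243120, 341230, 413240]), (2, [32401, 143120, 0, 342310, 423410]), (3, [34102, 141230, 242310, 0, 434210]), (4, [42103, 113240, 223410, 334210, 0])],
    [0, 1, 2, 3, 4], [4321, 43210, 43210, 43210, 43210],
    [(0, [0, 143201, 243012, 340213, 403214]), (1, [43201, 0, 243120, 341230, 413240]), (2, [43012, 143120, 0, 342310, 423410]), (3, [40213, 141230, 242310, 0, 434210]), (4, [3214, 113240, 223410, 334210, 0])]⟩]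

theorem oneTetrahedron_isValid : oneTetrahedron.IsValid 5 := by decide +kernel

theorem oneTetrahedron_reduces : reduces 5 oneTetrahedron oneTetrahedronSteps := by decide +kernel

theorem isPLSphere_oneTetrahedron : (oneTetrahedron.toGenTriangulation oneTetrahedron_isValid).IsPLSphere 3 :=
  isPLSphere_of_reduces oneTetrahedron_reduces _

/-- The counterpart of `fan` among 64 pentachora: each of its four self-gluings is replaced by two
triangles glued along two edges, giving 8 + 8 triangles. -/
def fanPillows : Table :=
  [(3, [13201, 23201, 33210, 0]), (3, [43201, 3201, 141302, 0]), (3, [3201, 43201, 53210, 0]), (3, [63102, 73120, 3210, 0]), (3, [23201, 13201, 83210, 0]), (3, [93102, 103120, 23210, 0]), (3, [73210, 73210, 33021, 0]), (3, [63210, 63210, 33120, 0]), (3, [113102, 123120, 43210, 0]), (3, [103210, 103210, 53021, 0]), (3, [93210, 93210, 53120, 0]), (3, [123210, 123210, 83021, 0]), (3, [113210, 113210, 83120, 0]), (0, [0, 143201, 153012, 153012]), (1, [133201, 0, 153120, 12031]), (2, [133012, 143120, 0, 133012])]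

def fanPillowsSteps : List Step := [
  ⟨3, [(3, [13201, 23201, 33210, 0]), (3, [43201, 3201, 133102, 0]), (3, [3201, 43201, 53210, 0]), (3, [63102, 73120, 3210, 0]), (3, [23201, 13201, 83210, 0]), (3, [93102, 103120, 23210, 0]), (3, [73210, 73210, 33021, 0]), (3, [63210, 63210, 33120, 0]), (3, [113102, 123120, 43210, 0]), (3, [103210, 103210, 53021, 0]), (3, [93210, 93210, 53120, 0]), (3, [123210, 123210, 83021, 0]), (3, [113210, 113210, 83120, 0]), (3, [133012, 13021, 133012, 0])],
    [0, 1, 2, 3, 4, 12, 5, 6, 7, 11, 13, 8, 9, 10], [3210, 3210, 3210, 3210, 3210, 1320, 3210, 3210, 3210, 132, 2130, 3210, 3210, 3210],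
    [(3, [13201, 23201, 33210, 0]), (3, [43201, 3201, 103102, 0]), (3, [3201, 43201, 121320, 0]), (3, [53102, 63120, 3210, 0]), (3, [23201, 13201, 73210, 0]), (3, [63210, 63210, 33021, 0]), (3, [53210, 53210, 33120, 0]), (3, [83102, 93120, 43210, 0]), (3, [93210, 93210, 73021, 0]), (3, [83210, 83210, 73120, 0]), (3, [103012, 13021, 103012, 0]), (0, [0, 123201, 133012, 133012]), (1, [113201, 0, 133120, 22130]), (2, [113012, 123120, 0, 113012])]⟩,
  ⟨3, [(3, [13201, 23201, 33210, 0]), (3, [43201, 3201, 103102, 0]), (3, [3201, 43201, 113120, 0]), (3, [53102, 63120, 3210, 0]), (3, [23201, 13201, 73210, 0]), (3, [63210, 63210, 33021, 0]), (3, [53210, 53210, 33120, 0]), (3, [83102, 93120, 43210, 0]), (3, [93210, 93210, 73021, 0]), (3, [83210, 83210, 73120, 0]), (3, [103012, 13021, 103012, 0]), (3, [113012, 23120, 113012, 0])],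
    [0, 1, 2, 11, 3, 9, 10, 4, 5, 6, 7, 8], [3210, 3210, 3210, 2310, 3210, 231, 1230, 3210, 3210, 3210, 3210, 3210],
    [(3, [13201, 23201, 112310, 0]), (3, [33201, 3201, 73102, 0]), (3, [3201, 33201, 83120, 0]), (3, [23201, 13201, 43210, 0]), (3, [53102, 63120, 33210, 0]), (3, [63210, 63210, 43021, 0]), (3, [53210, 53210, 43120, 0]), (3, [73012, 13021, 73012, 0]), (3, [83012, 23120, 83012, 0]), (0, [0, 103201, 113012, 103201]), (1, [93201, 0, 113120, 93201]), (2, [93012, 103120, 0, 2310])]⟩,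
  ⟨3, [(3, [13201, 23201, 93210, 0]), (3, [33201, 3201, 73102, 0]), (3, [3201, 33201, 83120, 0]), (3, [23201, 13201, 43210, 0]), (3, [53102, 63120, 33210, 0]), (3, [63210, 63210, 43021, 0]), (3, [53210, 53210, 43120, 0]), (3, [73012, 13021, 73012, 0]), (3, [83012, 23120, 83012, 0]), (3, [93201, 93201, 3210, 0])],
    [0, 1, 2, 3, 8, 9, 7, 4, 5, 6], [3210, 3210, 3210, 3210, 1302, 2130, 132, 3210, 3210, 3210],
    [(3, [13201, 23201, 63210, 0]), (3, [33201, 3201, 43102, 0]), (3, [3201, 33201, 53120, 0]), (3, [23201, 13201, 81302, 0]), (3, [43012, 13021, 43012, 0]), (3, [53012, 23120, 53012, 0]), (3, [63201, 63201, 3210, 0]), (0, [0, 83201, 93012, 93012]), (1, [73201, 0, 93120, 32031]), (2, [73012, 83120, 0, 73012])]⟩,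
  ⟨3, [(3, [13201, 23201, 63210, 0]), (3, [33201, 3201, 43102, 0]), (3, [3201, 33201, 53120, 0]), (3, [23201, 13201, 73102, 0]), (3, [43012, 13021, 43012, 0]), (3, [53012, 23120, 53012, 0]), (3, [63201, 63201, 3210, 0]), (3, [73012, 33021, 73012, 0])],
    [0, 1, 2, 6, 3, 4, 5, 7], [3210, 3210, 3210, 123, 3210, 3210, 3210, 1302],
    [(3, [13201, 23201, 53210, 0]), (3, [60132, 3201, 33102, 0]), (3, [3201, 60132, 43120, 0]), (3, [33012, 13021, 33012, 0]), (3, [43012, 23120, 43012, 0]), (3, [53201, 53201, 3210, 0]), (0, [0, 73201, 11023, 21023]), (1, [63201, 0, 72310, 72310])]⟩,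
  ⟨2, [(3, [13201, 23201, 53210, 0]), (3, [62130, 3201, 33102, 0]), (3, [3201, 73102, 43120, 0]), (3, [33012, 13021, 33012, 0]), (3, [43012, 23120, 43012, 0]), (3, [53201, 53201, 3210, 0]), (2, [11320, 72310, 0, 72310]), (3, [23021, 62310, 62310, 0])],
    [0, 6, 1, 2, 3, 4, 7, 5], [3210, 231, 3210, 3210, 3210, 3210, 3120, 3210],
    [(3, [60213, 13201, 43210, 0]), (3, [3201, 53102, 33120, 0]), (3, [23012, 60123, 23012, 0]), (3, [33012, 13120, 33012, 0]), (3, [43201, 43201, 3210, 0]), (3, [13021, 71320, 71320, 0]), (0, [0, 73201, 20123, 213]), (1, [63201, 0, 52130, 52130])]⟩,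
  ⟨2, [(3, [73210, 13201, 43210, 0]), (3, [3201, 53102, 33120, 0]), (3, [23012, 62103, 23012, 0]), (3, [33012, 13120, 33012, 0]), (3, [43201, 43201, 3210, 0]), (3, [13021, 62310, 73120, 0]), (2, [20321, 52310, 0, 72310]), (3, [3210, 53120, 62310, 0])],
    [0, 1, 2, 3, 4, 5, 7, 6], [3210, 3210, 3210, 3210, 3210, 123, 1203, 1203],
    [(3, [61203, 13201, 43210, 0]), (3, [3201, 50231, 33120, 0]), (3, [23012, 72031, 23012, 0]), (3, [33012, 13120, 33012, 0]), (3, [43201, 43201, 3210, 0]), (0, [0, 63201, 73012, 11203]), (1, [53201, 0, 73120, 231]), (2, [53012, 63120, 0, 21302])]⟩,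
  ⟨3, [(3, [53201, 13201, 43210, 0]), (3, [3201, 53201, 33120, 0]), (3, [23012, 53021, 23012, 0]), (3, [33012, 13120, 33012, 0]), (3, [43201, 43201, 3210, 0]), (3, [13201, 3201, 23102, 0])],
    [3, 5, 0, 1, 2, 4], [321, 2310, 3210, 3210, 3210, 1302],
    [(3, [3012, 41230, 3012, 0]), (3, [13012, 52130, 13012, 0]), (3, [23201, 23201, 30321, 0]), (0, [0, 43201, 53012, 22103]), (1, [33201, 0, 53120, 1230]), (2, [33012, 43120, 0, 11320])]⟩,
  ⟨3, [(3, [3012, 33210, 3012, 0]), (3, [13012, 33120, 13012, 0]), (3, [23201, 23201, 33021, 0]), (3, [23102, 3210, 13120, 0])],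
    [3, 0, 1, 2], [1302, 3210, 3210, 312],
    [(3, [3012, 20132, 3012, 0]), (3, [13201, 13201, 20231, 0]), (0, [0, 33201, 11203, 1023]), (1, [23201, 0, 32310, 32310])]⟩,
  ⟨2, [(3, [3012, 33102, 3012, 0]), (3, [13201, 13201, 22031, 0]), (2, [11302, 32310, 0, 32310]), (3, [3021, 22310, 22310, 0])],
    [3, 0, 1, 2], [1302, 3210, 3210, 231],
    [(3, [3201, 3201, 12031, 0]), (2, [1302, 22031, 0, 22031]), (0, [0, 33201, 11302, 11302]), (1, [23201, 0, 32310, 32310])]⟩,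
  ⟨2, [(3, [3201, 3201, 12031, 0]), (2, [1302, 32301, 0, 20231]), (2, [11203, 32310, 0, 32310]), (3, [12301, 22310, 22310, 0])],
    [3, 2, 0, 1], [1032, 3021, 3210, 3210],
    [(2, [22013, 12310, 0, 12310]), (3, [20312, 2310, 2310, 0]), (0, [0, 33201, 12013, 312]), (1, [23201, 0, 32310, 32310])]⟩,
  ⟨2, [(2, [32310, 12310, 0, 12310]), (3, [22310, 2310, 2310, 0]), (2, [12310, 32310, 0, 32310]), (3, [2310, 22310, 22310, 0])],
    [3, 0, 1, 2], [3120, 3210, 3210, 321],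
    [(3, [12310, 31320, 31320, 0]), (2, [2310, 23021, 0, 23021]), (0, [0, 33201, 13102, 13102]), (1, [23201, 0, 2130, 2130])]⟩,
  ⟨2, [(3, [12310, 22310, 33120, 0]), (2, [2310, 23201, 0, 30321]), (2, [13201, 2310, 0, 32310]), (3, [12103, 3120, 22310, 0])],
    [0, 1, 2, 3], [321, 3120, 3201, 3201],
    [(0, [0, 13201, 23012, 30213]), (1, [3201, 0, 23120, 31230]), (2, [3012, 13120, 0, 32310]), (3, [213, 11230, 22310, 0])]⟩]

theorem fanPillows_isValid : fanPillows.IsValid 4 := by decide +kernel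

theorem fanPillows_reduces : reduces 4 fanPillows fanPillowsSteps := by decide +kernel

theorem isPLSphere_fanPillows : (fanPillows.toGenTriangulation fanPillows_isValid).IsPLSphere 2 :=
  isPLSphere_of_reduces fanPillows_reduces _

/-- The counterpart of `snappedPair`: all three gluings there come from self-gluings of the
pentachoron, so three pairs of triangles are inserted. -/
def snappedPairPillows : Table :=
  [(3, [13102, 23120, 33210, 0]), (3, [23210, 23210, 3021, 0]), (3, [13210, 13210, 3120, 0]), (3, [43210, 43210, 3210, 0]), (3, [33210, 33210, 72310, 0]), (0, [0, 63201, 73012, 63201]), (1, [53201, 0, 73120, 53201]), (2, [53012, 63120, 0, 42310])]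

def snappedPairPillowsSteps : List Step := [
  ⟨3, [(3, [13102, 23120, 33210, 0]), (3, [23210, 23210, 3021, 0]), (3, [13210, 13210, 3120, 0]), (3, [43210, 43210, 3210, 0]), (3, [33210, 33210, 53210, 0]), (3, [53201, 53201, 43210, 0])],
    [4, 5, 3, 0, 1, 2], [1302, 2130, 132, 3210, 3210, 3210],
    [(3, [13210, 13210, 41302, 0]), (3, [3210, 3210, 23210, 0]), (3, [23201, 23201, 13210, 0]), (0, [0, 43201, 53012, 53012]), (1, [33201, 0, 53120, 2031]), (2, [33012, 43120, 0, 33012])]⟩,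
  ⟨3, [(3, [13210, 13210, 33102, 0]), (3, [3210, 3210, 23210, 0]), (3, [23201, 23201, 13210, 0]), (3, [33012, 3021, 33012, 0])],
    [3, 0, 1, 2], [1032, 3210, 3210, 213],
    [(3, [31032, 31032, 13210, 0]), (3, [13201, 13201, 3210, 0]), (0, [0, 33201, 22310, 22310]), (1, [23201, 0, 1032, 1032])]⟩,
  ⟨2, [(3, [22031, 33012, 13210, 0]), (3, [13201, 13201, 3210, 0]), (2, [32310, 1302, 0, 32310]), (3, [22310, 3012, 22310, 0])],
    [3, 2, 0, 1], [1032, 132, 3210, 3210],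
    [(2, [12310, 33120, 0, 12310]), (3, [2310, 31230, 2310, 0]), (0, [0, 33201, 22310, 22310]), (1, [23201, 0, 3120, 11230])]⟩,
  ⟨2, [(2, [12310, 23210, 0, 12310]), (3, [2310, 33210, 2310, 0]), (2, [32310, 3210, 0, 32310]), (3, [22310, 13210, 22310, 0])],
    [3, 0, 2, 1], [3102, 3210, 3012, 3210],
    [(3, [31302, 13210, 31302, 0]), (3, [20312, 3210, 20312, 0]), (0, [0, 33201, 12013, 12013]), (1, [23201, 0, 2031, 2031])]⟩,
  ⟨2, [(3, [22301, 13210, 33102, 0]), (3, [22310, 3210, 33012, 0]), (2, [12310, 2301, 0, 32310]), (3, [13012, 3021, 22310, 0])],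
    [0, 2, 1, 3], [321, 2301, 3102, 3102],
    [(0, [0, 13201, 23012, 30213]), (1, [3201, 0, 23120, 31230]), (2, [3012, 13120, 0, 32310]), (3, [213, 11230, 22310, 0])]⟩]

theorem snappedPairPillows_isValid : snappedPairPillows.IsValid 4 := by decide +kernel

theorem snappedPairPillows_reduces : reduces 4 snappedPairPillows snappedPairPillowsSteps := by decide +kernel

theorem isPLSphere_snappedPairPillows : (snappedPairPillows.toGenTriangulation snappedPairPillows_isValid).IsPLSphere 2 :=
  isPLSphere_of_reduces snappedPairPillows_reduces _

/-- The link of an edge at the apex of a pillow. -/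
def doubleTriangle : Table :=
  [(3, [10321, 10321, 10321, 0]), (0, [0, 2103, 2103, 2103])]

def doubleTriangleSteps : List Step := [
  ⟨1, [(3, [11320, 22301, 33021, 0]), (1, [2130, 0, 23120, 31230]), (2, [2301, 13120, 0, 32310]), (3, [3102, 11230, 22310, 0])],
    [0, 1, 2, 3], [321, 3210, 3210, 3210],
    [(0, [0, 13201, 23012, 30213]), (1, [3201, 0, 23120, 31230]), (2, [3012, 13120, 0, 32310]), (3, [213, 11230, 22310, 0])]⟩]

theorem doubleTriangle_isValid : doubleTriangle.IsValid 4 := by decide +kernel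

theorem doubleTriangle_reduces : reduces 4 doubleTriangle doubleTriangleSteps := by decide +kernel

theorem isPLSphere_doubleTriangle : (doubleTriangle.toGenTriangulation doubleTriangle_isValid).IsPLSphere 2 :=
  isPLSphere_of_reduces doubleTriangle_reduces _

/-- The counterpart of `oneTetrahedron`, with two pairs of tetrahedra inserted in place of its two
gluings. -/
def oneTetrahedronPillows : Table :=
  [(4, [143210, 143210, 143210, 423104, 0]), (4, [43210, 43210, 43210, 424103, 0]), (0, [0, 343201, 443012, 343201, 343201]), (1, [243201, 0, 443120, 243201, 243201]), (2, [243012, 343120, 0, 3421, 130421])]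

def oneTetrahedronPillowsSteps : List Step := [
  ⟨3, [(4, [143210, 143210, 143210, 232104, 0]), (4, [43210, 43210, 43210, 342103, 0]), (3, [243201, 243201, 4321, 0, 334210]), (4, [343201, 343201, 140321, 234210, 0])],
    [3, 0, 2, 1], [10432, 43210, 20143, 43210],
    [(4, [310432, 310432, 310432, 142103, 0]), (4, [143201, 143201, 40321, 202143, 0]), (0, [0, 343201, 110324, 234210, 234210]), (1, [243201, 0, 21043, 21043, 21043])]⟩,
  ⟨2, [(4, [220431, 330412, 440132, 142103, 0]), (4, [143201, 143201, 40321, 220143, 0]), (2, [110423, 21403, 0, 342310, 423410]), (3, [434210, 24013, 242310, 0, 434210]), (4, [334210, 41023, 223410, 334210, 0])],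
    [4, 0, 2, 1, 3], [24130, 43210, 13024, 43210, 13024],
    [(4, [43201, 43201, 420413, 204213, 0]), (3, [331024, 412034, 210324, 0, 331024]), (0, [0, 343201, 443012, 102143, 30214]), (1, [243201, 0, 443120, 104132, 104132]), (2, [243012, 343120, 0, 101342, 20413])]⟩,
  ⟨3, [(4, [43201, 43201, 340213, 340213, 0]), (3, [334021, 213024, 213024, 0, 213024]), (3, [103142, 103142, 103142, 0, 334210]), (4, [40213, 134102, 40213, 234210, 0])],
    [0, 3, 2, 1], [43210, 12430, 1324, 1324],
    [(4, [43201, 43201, 104321, 104321, 0]), (0, [0, 243201, 343012, 32104, 32104]), (1, [143201, 0, 343120, 343120, 343120]), (2, [143012, 243120, 0, 243120, 243120])]⟩,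
  ⟨3, [(4, [43201, 43201, 134021, 240321, 0]), (3, [34102, 143120, 143120, 0, 234210]), (4, [42103, 243120, 243120, 134210, 0])],
    [2, 0, 1], [21043, 10432, 10432],
    [(0, [0, 143201, 243012, 34210, 34210]), (1, [43201, 0, 243120, 134210, 134210]), (2, [43012, 143120, 0, 234210, 234210])]⟩,
  ⟨3, [(3, [134210, 134210, 134210, 0, 134210]), (4, [34210, 34210, 34210, 34210, 0])],
    [1, 0], [40321, 43210],
    [(4, [104321, 104321, 104321, 104321, 0]), (0, [0, 32104, 32104, 32104, 32104])]⟩,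
  ⟨1, [(4, [114320, 224301, 334021, 440321, 0]), (1, [32140, 0, 243120, 341230, 413240]), (2, [32401, 143120, 0, 342310, 423410]), (3, [34102, 141230, 242310, 0, 434210]), (4, [42103, 113240, 223410, 334210, 0])],
    [0, 1, 2, 3, 4], [4321, 43210, 43210, 43210, 43210],
    [(0, [0, 143201, 243012, 340213, 403214]), (1, [43201, 0, 243120, 341230, 413240]), (2, [43012, 143120, 0, 342310, 423410]), (3, [40213, 141230, 242310, 0, 434210]), (4, [3214, 113240, 223410, 334210, 0])]⟩]

theorem oneTetrahedronPillows_isValid : oneTetrahedronPillows.IsValid 5 := by decide +kernel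

theorem oneTetrahedronPillows_reduces : reduces 5 oneTetrahedronPillows oneTetrahedronPillowsSteps := by decide +kernel

theorem isPLSphere_oneTetrahedronPillows : (oneTetrahedronPillows.toGenTriangulation oneTetrahedronPillows_isValid).IsPLSphere 3 :=
  isPLSphere_of_reduces oneTetrahedronPillows_reduces _

/-- The link of the apex of a pillow. -/
def doubleTetrahedron : Table :=
  [(4, [104321, 104321, 104321, 104321, 0]), (0, [0, 32104, 32104, 32104, 32104])]

def doubleTetrahedronSteps : List Step := [
  ⟨1, [(4, [114320, 224301, 334021, 440321, 0]), (1, [32140, 0, 243120, 341230, 413240]), (2, [32401, 143120, 0, 342310, 423410]), (3, [34102, 141230, 242310, 0, 434210]), (4, [42103, 113240, 223410, 334210, 0])],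
    [0, 1, 2, 3, 4], [4321, 43210, 43210, 43210, 43210],
    [(0, [0, 143201, 243012, 340213, 403214]), (1, [43201, 0, 243120, 341230, 413240]), (2, [43012, 143120, 0, 342310, 423410]), (3, [40213, 141230, 242310, 0, 434210]), (4, [3214, 113240, 223410, 334210, 0])]⟩]

theorem doubleTetrahedron_isValid : doubleTetrahedron.IsValid 5 := by decide +kernel

theorem doubleTetrahedron_reduces : reduces 5 doubleTetrahedron doubleTetrahedronSteps := by decide +kernel

theorem isPLSphere_doubleTetrahedron : (doubleTetrahedron.toGenTriangulation doubleTetrahedron_isValid).IsPLSphere 3 :=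
  isPLSphere_of_reduces doubleTetrahedron_reduces _

end Table

variable {L : Type} [Fintype L] [DecidableEq L]

/-! ### Connectedness -/

/-- Two facets are adjacent if a ridge of the one is glued to a ridge of the other. -/
def Adj (T : GenTriangulation L) (Δ Δ' : T.Facet) : Prop := ∃ i g, T.glue Δ i Δ' g

theorem Adj.symm {T : GenTriangulation L} {Δ Δ' : T.Facet} : T.Adj Δ Δ' → T.Adj Δ' Δ :=
  fun ⟨i, g, h⟩ => ⟨g i, g⁻¹, T.glue_symm h⟩

/-- Any two facets are joined by a sequence of adjacent facets. -/
def FacetConnected (T : GenTriangulation L) : Prop :=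
  ∀ Δ Δ', Relation.ReflTransGen T.Adj Δ Δ'

theorem convex_simplex (T : GenTriangulation L) (Δ : T.Facet) : Convex ℝ (T.simplex Δ) := by
  intro x hx y hy a b ha hb hab
  refine ⟨fun v => ?_, ?_, fun v hv => ?_⟩
  · have := hx.1 v
    have := hy.1 v
    simp only [Pi.add_apply, Pi.smul_apply, smul_eq_mul]
    positivity
  · simp only [Pi.add_apply, Pi.smul_apply, smul_eq_mul, Finset.sum_add_distrib, ← Finset.mul_sum,
      hx.2.1, hy.2.1, mul_one, hab]
  · simp [hx.2.2 v hv, hy.2.2 v hv]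

theorem single_mem_simplex {T : GenTriangulation L} {Δ : T.Facet} {v : L} (hv : v ∈ T.verts Δ) :
    Pi.single v (1 : ℝ) ∈ T.simplex Δ := by
  refine ⟨fun w => ?_, by simp, fun w hw => ?_⟩
  · by_cases h : w = v
    · subst h; simp
    · simp [h]
  · rw [Pi.single_eq_of_ne]
    rintro rfl
    exact hw hv

/-- Simplices are connected, and adjacent ones share a vertex of the glued ridge; `1 ≤ d` ensures
that ridges have vertices. -/
theorem FacetConnected.connectedSpace {T : GenTriangulation L} (hT : T.FacetConnected) {d : ℕ}
    (hd : T.HasDim d) (h1 : 1 ≤ d) [Nonempty T.Facet] : ConnectedSpace T.Space := by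
  have hv : ∀ Δ, ∃ v, v ∈ T.verts Δ := fun Δ => by
    have := hd Δ
    exact Finset.card_pos.1 (by omega)
  have hpre : ∀ Δ, IsPreconnected (Set.range (T.toSpace Δ)) := fun Δ => by
    have : PreconnectedSpace (T.simplex Δ) :=
      isPreconnected_iff_preconnectedSpace.1 (T.convex_simplex Δ).isPreconnected
    exact isPreconnected_range (continuous_quot_mk.comp continuous_sigmaMk)
  obtain ⟨Δ₀⟩ := ‹Nonempty T.Facet›
  have key : ∀ Δ, Relation.ReflTransGen T.Adj Δ₀ Δ → ∃ t : Set T.Space, IsPreconnected t ∧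
      Set.range (T.toSpace Δ₀) ⊆ t ∧ Set.range (T.toSpace Δ) ⊆ t := by
    intro Δ h
    induction h with
    | refl => exact ⟨_, hpre Δ₀, le_rfl, le_rfl⟩
    | @tail Δ' Δ'' _ h ih =>
      obtain ⟨t, ht, h0, h'⟩ := ih
      obtain ⟨i, g, hg⟩ := h
      obtain ⟨v, hv, hvi⟩ : ∃ v ∈ T.verts Δ', v ≠ i := by
        have := hd Δ'
        have := Finset.card_erase_of_mem (T.glue_mem hg)
        obtain ⟨v, hv⟩ := Finset.card_pos.1 (show 0 < ((T.verts Δ').erase i).card by omega)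
        exact ⟨v, Finset.mem_of_mem_erase hv, Finset.ne_of_mem_erase hv⟩
      have e := toSpace_eq hg (single_mem_simplex hv)
        (single_mem_simplex ((mem_verts_iff hg v).2 hv)) (by simp [hvi.symm]) fun w => by
          by_cases h : w = v
          · subst h; simp
          · rw [Pi.single_eq_of_ne h, Pi.single_eq_of_ne (fun h' => h (g.injective h'))]
      refine ⟨t ∪ Set.range (T.toSpace Δ''), ht.union _ (h' ⟨_, rfl⟩) ⟨_, e.symm⟩ (hpre Δ''),
        h0.trans Set.subset_union_left, Set.subset_union_right⟩
  obtain ⟨v, hv⟩ := hv Δ₀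
  have : Nonempty T.Space := ⟨T.toSpace Δ₀ ⟨_, single_mem_simplex hv⟩⟩
  have hp : IsPreconnected (Set.univ : Set T.Space) := by
    refine isPreconnected_of_forall (T.toSpace Δ₀ ⟨_, single_mem_simplex hv⟩) ?_
    rintro q -
    revert q
    refine space_ind fun Δ x => ?_
    obtain ⟨t, ht, h0, h'⟩ := key Δ (hT _ _)
    exact ⟨t, Set.subset_univ _, h0 ⟨_, rfl⟩, h' ⟨_, rfl⟩, ht⟩
  exact { isPreconnected_univ := hp, toNonempty := this }

theorem reflTransGen_of_eqvGen {α : Type*} {r : α → α → Prop} (hr : ∀ a b, r a b → r b a) {a b : α}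
    (h : Relation.EqvGen r a b) : Relation.ReflTransGen r a b := by
  induction h with
  | rel _ _ h => exact .single h
  | refl => exact .refl
  | symm _ _ _ ih =>
    clear * - ih hr
    induction ih with
    | refl => exact .refl
    | tail _ h ih => exact .head (hr _ _ h) ih
  | trans _ _ _ _ _ ih₁ ih₂ => exact ih₁.trans ih₂

/-! ### Links -/

section Link

variable {T : GenTriangulation L} {k : ℕ} (σ : T.Face k)

theorem map_subset_verts {Δ Δ' : T.Facet} {i g} (hg : T.glue Δ i Δ' g) {s : Finset L}
    (hs : s ⊆ T.verts Δ) : s.map g.toEmbedding ⊆ T.verts Δ' := by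
  rw [← T.glue_verts hg]
  exact Finset.map_subset_map.2 hs

/-- The face to which a face of a glued ridge is glued. -/
def PreFace.move (p : T.PreFace k) {i Δ' g} (hg : T.glue p.1.1 i Δ' g) : T.PreFace k :=
  ⟨(Δ', p.1.2.map g.toEmbedding), map_subset_verts hg p.2.1, by rw [Finset.card_map, p.2.2]⟩

theorem PreFace.step_move (p : T.PreFace k) {i Δ' g} (hg : T.glue p.1.1 i Δ' g) (hi : i ∉ p.1.2) :
    PreFace.Step T k p (p.move hg) := ⟨i, g, hg, hi, rfl⟩

theorem link_isClosed (hT : T.IsClosed) : (T.link σ).IsClosed := by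
  rintro ⟨p, hp⟩ i hi
  obtain ⟨hi, his⟩ := Finset.mem_sdiff.1 hi
  obtain ⟨Δ', g, hg⟩ := hT p.1.1 i hi
  exact ⟨⟨p.move hg, by rw [← hp]; exact (Quot.sound (p.step_move hg his)).symm⟩, g, hg, his, rfl⟩

theorem link_hasDim {d e : ℕ} (hT : T.HasDim d) (h : d = e + k + 1) : (T.link σ).HasDim e := by
  rintro ⟨p, hp⟩
  show (T.verts p.1.1 \ p.1.2).card = e + 1
  rw [Finset.card_sdiff_of_subset p.2.1, hT, p.2.2]
  omega

theorem PreFace.Step.symm {p q : T.PreFace k} (h : PreFace.Step T k p q) :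
    PreFace.Step T k q p := by
  obtain ⟨i, g, hg, hi, hs⟩ := h
  refine ⟨g i, g⁻¹, T.glue_symm hg, by simpa [hs] using hi, ?_⟩
  rw [hs, Finset.map_map]
  ext v
  simp

/-- The facets of the link are the members of one class of occurrences, and the steps that generate
the class are the gluings of the link. -/
theorem link_facetConnected : (T.link σ).FacetConnected := by
  rintro ⟨p, hp⟩ ⟨q, hq⟩
  have h := reflTransGen_of_eqvGen (fun _ _ h => PreFace.Step.symm h)
    (Quot.eqvGen_exact (hp.trans hq.symm))
  induction h with
  | refl => exact .refl
  | @tail b c _ h ih =>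
    have hb : Quot.mk (PreFace.Step T k) b = σ := (Quot.sound (r := PreFace.Step T k) h).trans hq
    refine (ih hb).tail ?_
    obtain ⟨i, g, h1, h2, h3⟩ := h
    exact ⟨i, g, h1, h2, h3⟩

instance : Nonempty (T.link σ).Facet := by
  induction σ using Quot.ind with
  | mk p => exact ⟨⟨p, rfl⟩⟩

/-- A chain of gluings in the link that carries `s` carries in `T` the join of `s` with the
occurrence of `σ`. If it returns to the same facet of the link, the occurrence is fixed as a set, so
validity of `T` applies to the join. -/
theorem link_isValid (hT : T.IsValid) : (T.link σ).IsValid := by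
  have key : ∀ (p : (T.link σ).Facet) (s : Finset L) (q : (T.link σ).Facet) (g),
      (T.link σ).Carries p s q g → T.Carries p.1.1.1 (p.1.1.2 ∪ s) q.1.1.1 g ∧
        q.1.1.2 = p.1.1.2.map g.toEmbedding := by
    intro p s q g h
    induction h with
    | refl => exact ⟨.refl, (Finset.map_refl).symm⟩
    | @step q r i g g' _ hg hi ih =>
      obtain ⟨h1, h2⟩ := ih
      obtain ⟨k1, k2, k3⟩ := hg
      refine ⟨.step h1 k1 ?_, ?_⟩
      · rw [Finset.map_union, Finset.mem_union, not_or]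
        exact ⟨by rwa [← h2], hi⟩
      · rw [k3, h2, Finset.map_map]
        rfl
  intro p s hs g h he v hv
  obtain ⟨h1, h2⟩ := key p s p g h
  refine hT _ (p.1.1.2 ∪ s) (Finset.union_subset p.1.2.1 (hs.trans Finset.sdiff_subset)) g h1 ?_ v
    (Finset.mem_union_right _ hv)
  rw [Finset.map_union, ← h2, he]

end Link

variable {L : Type} [Fintype L] [DecidableEq L]

/-! ### Closed one-dimensional triangulations -/

/-- The parametrization of the boundary of the triangle by `[0, 3]`. -/
noncomputable def triangleLoop (t : ℝ) : Fin 3 → ℝ :=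
  ![max 0 (max (1 - t) (t - 2)), max 0 (1 - |t - 1|), max 0 (1 - |t - 2|)]

theorem triangleLoop_of_le_one {t : ℝ} (h0 : 0 ≤ t) (h1 : t ≤ 1) :
    triangleLoop t = ![1 - t, t, 0] := by
  unfold triangleLoop
  rw [max_eq_left (by linarith : t - 2 ≤ 1 - t), max_eq_right (by linarith : 0 ≤ 1 - t),
    abs_of_nonpos (by linarith : t - 1 ≤ 0), abs_of_nonpos (by linarith : t - 2 ≤ 0),
    max_eq_right (by linarith : (0 : ℝ) ≤ 1 - -(t - 1)),
    max_eq_left (by linarith : 1 - -(t - 2) ≤ 0)]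
  congr 2
  ring

theorem triangleLoop_of_le_two {t : ℝ} (h0 : 1 ≤ t) (h1 : t ≤ 2) :
    triangleLoop t = ![0, 2 - t, t - 1] := by
  unfold triangleLoop
  rw [max_eq_left (max_le (by linarith) (by linarith)),
    abs_of_nonneg (by linarith : 0 ≤ t - 1), abs_of_nonpos (by linarith : t - 2 ≤ 0),
    max_eq_right (by linarith : (0 : ℝ) ≤ 1 - (t - 1)),
    max_eq_right (by linarith : (0 : ℝ) ≤ 1 - -(t - 2))]
  congr 2
  · ring
  · congr 1; ring

theorem triangleLoop_of_le_three {t : ℝ} (h0 : 2 ≤ t) (h1 : t ≤ 3) :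
    triangleLoop t = ![t - 2, 0, 3 - t] := by
  unfold triangleLoop
  rw [max_eq_right (by linarith : 1 - t ≤ t - 2), max_eq_right (by linarith : 0 ≤ t - 2),
    abs_of_nonneg (by linarith : 0 ≤ t - 1), abs_of_nonneg (by linarith : 0 ≤ t - 2),
    max_eq_left (by linarith : 1 - (t - 1) ≤ 0),
    max_eq_right (by linarith : (0 : ℝ) ≤ 1 - (t - 2))]
  congr 3
  ring

theorem triangleLoop_injective {s t : ℝ} (hs : 0 ≤ s) (hst : s < t) (ht : t ≤ 3)
    (h : triangleLoop s = triangleLoop t) : s = 0 ∧ t = 3 := by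
  have e : ∀ i, triangleLoop s i = triangleLoop t i := fun i => congrFun h i
  have e0 := e 0
  have e1 := e 1
  have e2 := e 2
  rcases le_total s 1 with a | a
  · rw [triangleLoop_of_le_one hs a] at e0 e1 e2
    rcases le_total t 1 with b | b
    · rw [triangleLoop_of_le_one (by linarith) b] at e0 e1 e2
      simp at e0 e1 e2
      constructor <;> linarith
    rcases le_total t 2 with c | c
    · rw [triangleLoop_of_le_two b c] at e0 e1 e2
      simp at e0 e1 e2
      constructor <;> linarith
    · rw [triangleLoop_of_le_three c ht] at e0 e1 e2
      simp at e0 e1 e2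
      constructor <;> linarith
  rcases le_total s 2 with a' | a'
  · rw [triangleLoop_of_le_two a a'] at e0 e1 e2
    rcases le_total t 2 with c | c
    · rw [triangleLoop_of_le_two (by linarith) c] at e0 e1 e2
      simp at e0 e1 e2
      constructor <;> linarith
    · rw [triangleLoop_of_le_three c ht] at e0 e1 e2
      simp at e0 e1 e2
      constructor <;> linarith
  · rw [triangleLoop_of_le_three a' (by linarith), triangleLoop_of_le_three (by linarith) ht]
      at e0 e1 e2
    simp at e0 e1 e2
    constructor <;> linarith

theorem triangleLoop_zero : triangleLoop 0 = triangleLoop 3 := by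
  rw [triangleLoop_of_le_one le_rfl (by norm_num), triangleLoop_of_le_three (by norm_num) le_rfl]
  norm_num

theorem triangleLoop_mem {t : ℝ} (h0 : 0 ≤ t) (h3 : t ≤ 3) : triangleLoop t ∈ stdPLSphere 1 := by
  rcases le_total t 1 with a | a
  · rw [triangleLoop_of_le_one h0 a]
    refine ⟨fun j => ?_, by simp [Fin.sum_univ_three], 2, by simp⟩
    fin_cases j <;> simp <;> linarith
  rcases le_total t 2 with b | b
  · rw [triangleLoop_of_le_two a b]
    refine ⟨fun j => ?_, by simp [Fin.sum_univ_three]; ring, 0, by simp⟩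
    fin_cases j <;> simp <;> linarith
  · rw [triangleLoop_of_le_three b h3]
    refine ⟨fun j => ?_, by simp [Fin.sum_univ_three]; ring, 1, by simp⟩
    fin_cases j <;> simp <;> linarith

theorem exists_triangleLoop {y : Fin 3 → ℝ} (hy : y ∈ stdPLSphere 1) :
    ∃ t, 0 ≤ t ∧ t ≤ 3 ∧ triangleLoop t = y := by
  obtain ⟨h0, hs, j, hj⟩ := hy
  rw [Fin.sum_univ_three] at hs
  have k0 := h0 0
  have k1 := h0 1
  have k2 := h0 2
  fin_cases j <;> simp at hj
  · refine ⟨1 + y 2, by linarith, by linarith, ?_⟩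
    rw [triangleLoop_of_le_two (by linarith) (by linarith)]
    ext i; fin_cases i <;> simp <;> linarith
  · refine ⟨2 + y 0, by linarith, by linarith, ?_⟩
    rw [triangleLoop_of_le_three (by linarith) (by linarith)]
    ext i; fin_cases i <;> simp <;> linarith
  · refine ⟨y 1, by linarith, by linarith, ?_⟩
    rw [triangleLoop_of_le_one (by linarith) (by linarith)]
    ext i; fin_cases i <;> simp <;> linarith

/-- A cyclic numbering of the facets of a closed one-dimensional triangulation, in which the vertex
`b k` of the facet `F k` is glued to the vertex `a (k + 1)` of the facet `F (k + 1)`. -/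
structure Cyclic (T : GenTriangulation L) (n : ℕ) where
  F : ℕ → T.Facet
  a : ℕ → L
  b : ℕ → L
  idx : T.Facet → ℕ
  pos : 0 < n
  idx_lt : ∀ Δ, idx Δ < n
  F_idx : ∀ Δ, F (idx Δ) = Δ
  idx_F : ∀ k < n, idx (F k) = k
  F_n : F n = F 0
  b_n : b n = b 0
  ne : ∀ k, a k ≠ b k
  verts : ∀ k, T.verts (F k) = {a k, b k}
  glue : ∀ k, ∃ g, T.glue (F k) (a k) (F (k + 1)) g ∧ g (a k) = b (k + 1) ∧ g (b k) = a (k + 1)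

namespace Cyclic

variable {T : GenTriangulation L} {n : ℕ} (C : Cyclic T n)

theorem simplex_add {k : ℕ} {x : L → ℝ} (hx : x ∈ T.simplex (C.F k)) :
    x (C.a k) + x (C.b k) = 1 := by
  rw [← hx.2.1, ← Finset.sum_subset (Finset.subset_univ (T.verts (C.F k)))
    fun v _ hv => hx.2.2 v hv, C.verts, Finset.sum_pair (C.ne k)]

theorem simplex_ext {k : ℕ} {x y : L → ℝ} (hx : x ∈ T.simplex (C.F k))
    (hy : y ∈ T.simplex (C.F k)) (h : x (C.b k) = y (C.b k)) : x = y := by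
  have h1 := C.simplex_add hx
  have h2 := C.simplex_add hy
  ext v
  by_cases hv : v ∈ T.verts (C.F k)
  · rw [C.verts, Finset.mem_insert, Finset.mem_singleton] at hv
    rcases hv with rfl | rfl
    · linarith
    · exact h
  · rw [hx.2.2 v hv, hy.2.2 v hv]

theorem toSpace_succ {k : ℕ} {x y : L → ℝ} (hx : x ∈ T.simplex (C.F k))
    (hy : y ∈ T.simplex (C.F (k + 1))) (hxb : x (C.b k) = 1) (hyb : y (C.b (k + 1)) = 0) :
    T.toSpace _ ⟨x, hx⟩ = T.toSpace _ ⟨y, hy⟩ := by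
  obtain ⟨g, hg, h1, h2⟩ := C.glue k
  have e1 := C.simplex_add hx
  have e2 := C.simplex_add hy
  refine toSpace_eq hg _ _ (by linarith) fun v => ?_
  by_cases hv : v ∈ T.verts (C.F k)
  · rw [C.verts, Finset.mem_insert, Finset.mem_singleton] at hv
    rcases hv with rfl | rfl
    · rw [h1]; linarith
    · rw [h2]; linarith
  · rw [hx.2.2 v hv, hy.2.2]
    rwa [mem_verts_iff hg]

/-- The arc length. -/
noncomputable def time (Δ : T.Facet) (x : L → ℝ) : ℝ := C.idx Δ + x (C.b (C.idx Δ))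

theorem mem_idx {Δ : T.Facet} {x : L → ℝ} (hx : x ∈ T.simplex Δ) :
    x ∈ T.simplex (C.F (C.idx Δ)) := by rwa [C.F_idx]

theorem b_bounds {k : ℕ} {x : L → ℝ} (hx : x ∈ T.simplex (C.F k)) :
    0 ≤ x (C.b k) ∧ x (C.b k) ≤ 1 :=
  ⟨hx.1 _, by have := C.simplex_add hx; have := hx.1 (C.a k); linarith⟩

/-- The parametrization by the boundary of the triangle. -/
noncomputable def curve (t : ℝ) : Fin 3 → ℝ := triangleLoop (t * (3 / n))

theorem curve_zero (C : Cyclic T n) : curve (n := n) 0 = curve (n := n) n := by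
  have : (n : ℝ) ≠ 0 := by exact_mod_cast C.pos.ne'
  unfold curve
  rw [zero_mul, mul_div_cancel₀ _ this, triangleLoop_zero]

/-- The successor of the last facet is the first one, of index `0` instead of `n`. The
parametrization does not notice because it is closed. -/
theorem curve_succ {k l : ℕ} (hk : k < n) (hl : l < n) (h : C.F l = C.F (k + 1)) :
    curve (n := n) l = curve (n := n) (k + 1 : ℕ) ∧ C.b l = C.b (k + 1) := by
  rcases Nat.lt_or_ge (k + 1) n with h' | h'
  · have := congrArg C.idx h
    rw [C.idx_F l hl, C.idx_F _ h'] at this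
    rw [this]
    exact ⟨rfl, rfl⟩
  · obtain rfl : k + 1 = n := by omega
    rw [C.F_n] at h
    have := congrArg C.idx h
    rw [C.idx_F l hl, C.idx_F _ C.pos] at this
    subst this
    exact ⟨by simpa using C.curve_zero, C.b_n.symm⟩

theorem exists_pred (k : ℕ) (hk : k < n) : ∃ l < n, C.F k = C.F (l + 1) := by
  rcases k with - | k
  · refine ⟨n - 1, Nat.sub_lt C.pos one_pos, ?_⟩
    rw [Nat.sub_add_cancel (show 1 ≤ n from C.pos), C.F_n]
  · exact ⟨k, by omega, rfl⟩

theorem time_bounds {Δ : T.Facet} {x : L → ℝ} (hx : x ∈ T.simplex Δ) :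
    0 ≤ C.time Δ x ∧ C.time Δ x ≤ n := by
  obtain ⟨h0, h1⟩ := C.b_bounds (C.mem_idx hx)
  have h2 : (C.idx Δ : ℝ) + 1 ≤ n := by exact_mod_cast C.idx_lt Δ
  unfold time
  constructor
  · positivity
  · linarith

theorem curve_time_F {k : ℕ} (hk : k < n) (x : L → ℝ) : C.time (C.F k) x = k + x (C.b k) := by
  rw [time, C.idx_F k hk]

/-- The values agree on glued points. -/
theorem curve_time_succ {k : ℕ} (hk : k < n) {x y : L → ℝ}
    (hx : x ∈ T.simplex (C.F k)) (hxa : x (C.a k) = 0)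
    (hyb : y (C.b (k + 1)) = 0) :
    curve (n := n) (C.time (C.F k) x) = curve (n := n) (C.time (C.F (k + 1)) y) := by
  have e1 := C.simplex_add hx
  obtain ⟨h1, h2⟩ := C.curve_succ hk (C.idx_lt (C.F (k + 1))) (C.F_idx _)
  rw [C.curve_time_F hk, show x (C.b k) = 1 by linarith, time, h2, hyb, add_zero, h1]
  push_cast
  rfl

/-- The map to the boundary of the triangle. -/
noncomputable def map : T.Space → Fin 3 → ℝ :=
  T.spaceLift (fun Δ x => curve (n := n) (C.time Δ x.1)) <| by
    have key : ∀ k < n, ∀ (x : T.simplex (C.F k)) Δ' g (y : T.simplex Δ'),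
        T.glue (C.F k) (C.a k) Δ' g → x.1 (C.a k) = 0 → (∀ v, y.1 (g v) = x.1 v) →
        curve (n := n) (C.time (C.F k) x.1) = curve (n := n) (C.time Δ' y.1) := by
      intro k hk x Δ' g y hg h0 hxy
      obtain ⟨g', hg', h1, h2⟩ := C.glue k
      obtain ⟨rfl, rfl⟩ := T.glue_unique hg hg'
      exact C.curve_time_succ hk x.2 h0 (by rw [← h1, hxy, h0])
    intro Δ x i Δ' g y hg h0 hxy
    obtain ⟨k, hk, rfl⟩ : ∃ k < n, C.F k = Δ := ⟨_, C.idx_lt Δ, C.F_idx Δ⟩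
    have hi := T.glue_mem hg
    rw [C.verts, Finset.mem_insert, Finset.mem_singleton] at hi
    rcases hi with rfl | rfl
    · exact key k hk x Δ' g y hg h0 hxy
    · obtain ⟨l, hl, e⟩ := C.exists_pred k hk
      obtain ⟨g', hg', h1, h2⟩ := C.glue l
      have hb : C.b k = C.b (l + 1) := (C.curve_succ hl hk e).2
      have hs := T.glue_symm hg'
      rw [h1, ← e, ← hb] at hs
      obtain ⟨rfl, rfl⟩ := T.glue_unique hg hs
      rw [← e] at hg'
      refine (key l hl y (C.F k) g' x hg' ?_ fun v => ?_).symm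
      · rw [← h0, ← hxy, hb, ← h1]
        simp
      · rw [← hxy]
        simp

theorem scale_injective (C : Cyclic T n) {s t : ℝ} (hs : 0 ≤ s) (hst : s < t) (ht : t ≤ n)
    (h : curve (n := n) s = curve (n := n) t) : s = 0 ∧ t = n := by
  have hn : (0 : ℝ) < n := by exact_mod_cast C.pos
  obtain ⟨h1, h2⟩ := triangleLoop_injective (by positivity)
    (by gcongr : s * (3 / n) < t * (3 / n))
    (by rw [mul_div_assoc', div_le_iff₀ hn]; linarith) h
  constructor
  · rcases mul_eq_zero.1 h1 with h | h
    · exact h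
    · have : (3 : ℝ) / n > 0 := by positivity
      linarith
  · field_simp at h2
    linarith

theorem map_injective : Function.Injective C.map := by
  have key : ∀ Δ (x : T.simplex Δ) Δ' (y : T.simplex Δ'), C.time Δ x.1 ≤ C.time Δ' y.1 →
      curve (n := n) (C.time Δ x.1) = curve (n := n) (C.time Δ' y.1) →
      T.toSpace Δ x = T.toSpace Δ' y := by
    intro Δ x Δ' y hle he
    obtain ⟨k, hk, rfl⟩ : ∃ k < n, C.F k = Δ := ⟨_, C.idx_lt Δ, C.F_idx Δ⟩
    obtain ⟨l, hl, rfl⟩ : ∃ k < n, C.F k = Δ' := ⟨_, C.idx_lt Δ', C.F_idx Δ'⟩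
    obtain ⟨x, hx⟩ := x
    obtain ⟨y, hy⟩ := y
    obtain ⟨x0, x1⟩ := C.b_bounds hx
    obtain ⟨y0, y1⟩ := C.b_bounds hy
    simp only [C.curve_time_F hk, C.curve_time_F hl] at hle he
    rcases hle.eq_or_lt with h | h
    -- At equal arc lengths the points lie on the same edge, where they agree, or at the common end
    -- of consecutive edges.
    · rcases lt_trichotomy k l with hkl | rfl | hkl
      · have : (k : ℝ) + 1 ≤ l := by exact_mod_cast hkl
        obtain rfl : l = k + 1 := by
          have : (l : ℝ) < (k + 2 : ℕ) := by
            rcases Nat.lt_or_ge l (k + 2) with h' | h'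
            · exact_mod_cast h'
            · have : ((k + 2 : ℕ) : ℝ) ≤ l := by exact_mod_cast h'
              push_cast at this
              linarith
          have : l < k + 2 := by exact_mod_cast this
          omega
        push_cast at h
        exact C.toSpace_succ hx hy (by linarith) (by linarith)
      · have := C.simplex_ext hx hy (by linarith)
        subst this
        rfl
      · have : (l : ℝ) + 1 ≤ k := by exact_mod_cast hkl
        obtain rfl : k = l + 1 := by
          have : k < l + 2 := by
            by_contra h'
            have : ((l + 2 : ℕ) : ℝ) ≤ k := by exact_mod_cast not_lt.1 h'
            push_cast at this
            linarith
          omega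
        push_cast at h
        exact (C.toSpace_succ hy hx (by linarith) (by linarith)).symm
    -- Distinct arc lengths with the same value are `0` and `n`: the start of the first edge and the
    -- end of the last, which are glued.
    · obtain ⟨h1, h2⟩ := C.scale_injective (by positivity) h
        (by have : (l : ℝ) + 1 ≤ n := by exact_mod_cast hl
            linarith) he
      have hk0 : k = 0 := by
        have : (k : ℝ) ≤ 0 := by linarith
        exact_mod_cast le_antisymm (by exact_mod_cast this) (Nat.zero_le k)
      have hl1 : n = l + 1 := by
        have : (n : ℝ) ≤ (l + 1 : ℕ) := by push_cast; linarith
        have : n ≤ l + 1 := by exact_mod_cast this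
        omega
      subst hk0
      subst hl1
      have hx' : x ∈ T.simplex (C.F (l + 1)) := by rwa [C.F_n]
      push_cast at h1 h2
      have e := C.toSpace_succ hy hx' (by linarith) (by rw [C.b_n]; linarith)
      rw [e]
      have : ∀ Δ (_ : Δ = C.F 0) (h : x ∈ T.simplex Δ),
          T.toSpace _ ⟨x, hx⟩ = T.toSpace Δ ⟨x, h⟩ := by
        rintro _ rfl h; rfl
      exact this _ C.F_n _
  refine space_ind fun Δ x => space_ind fun Δ' y h => ?_
  rcases le_total (C.time Δ x.1) (C.time Δ' y.1) with h' | h'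
  · exact key Δ x Δ' y h' h
  · exact (key Δ' y Δ x h' h.symm).symm

theorem range_map : Set.range C.map = stdPLSphere 1 := by
  have hn : (0 : ℝ) < n := by exact_mod_cast C.pos
  ext y
  constructor
  · rintro ⟨q, rfl⟩
    revert q
    refine space_ind fun Δ x => ?_
    obtain ⟨h0, h1⟩ := C.time_bounds x.2
    refine triangleLoop_mem (by positivity) ?_
    rw [mul_div_assoc', div_le_iff₀ hn]
    linarith
  · intro hy
    obtain ⟨t, h0, h3, rfl⟩ := exists_triangleLoop hy
    have hu : ∃ k < n, ∃ r : ℝ, 0 ≤ r ∧ r ≤ 1 ∧ (k + r) * (3 / n) = t := by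
      rcases h3.eq_or_lt with rfl | h3
      · refine ⟨n - 1, Nat.sub_lt C.pos one_pos, 1, by norm_num, le_rfl, ?_⟩
        rw [Nat.cast_sub (show 1 ≤ n from C.pos)]
        push_cast
        field_simp
        ring
      · refine ⟨⌊t * (n / 3)⌋₊, ?_, t * (n / 3) - ⌊t * (n / 3)⌋₊, ?_, ?_, ?_⟩
        · rw [Nat.floor_lt (by positivity)]
          calc t * (n / 3) < 3 * (n / 3) := by gcongr
            _ = n := by ring
        · linarith [Nat.floor_le (by positivity : 0 ≤ t * (n / 3))]
        · linarith [Nat.lt_floor_add_one (t * (n / 3))]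
        · field_simp
          ring
    obtain ⟨k, hk, r, hr0, hr1, rfl⟩ := hu
    have hmem : ((1 - r) • Pi.single (C.a k) (1 : ℝ) + r • Pi.single (C.b k) (1 : ℝ) : L → ℝ) ∈
        T.simplex (C.F k) :=
      T.convex_simplex _ (single_mem_simplex (by simp [C.verts]))
        (single_mem_simplex (by simp [C.verts])) (by linarith) hr0 (by ring)
    refine ⟨T.toSpace (C.F k) ⟨_, hmem⟩, ?_⟩
    show triangleLoop (C.time _ _ * _) = _
    rw [C.curve_time_F hk]
    simp [(C.ne k).symm]

theorem isPLSphere (C : Cyclic T n) : T.IsPLSphere 1 := by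
  have hn : (0 : ℝ) < n := by exact_mod_cast C.pos
  refine ⟨C.map, C.map_injective, C.range_map, fun Δ => ?_⟩
  let τ : (L → ℝ) →ᵃ[ℝ] ℝ := (3 / n : ℝ) • (AffineMap.const ℝ (L → ℝ) (C.idx Δ : ℝ) +
    (LinearMap.proj (C.b (C.idx Δ)) : (L → ℝ) →ₗ[ℝ] ℝ).toAffineMap)
  have hτ : ∀ x, τ x = C.time Δ x * (3 / n) := fun x => by
    simp [τ, time]
    ring
  let c : ℝ → (L → ℝ) →ᵃ[ℝ] ℝ := fun r => AffineMap.const ℝ _ r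
  have hP : ∀ p q : ℝ, IsConvexPolyhedron {x : L → ℝ | p ≤ τ x ∧ τ x ≤ q} := by
    classical
    intro p q
    refine ⟨{τ - c p, c q - τ}, ?_⟩
    ext x
    simp [c]
  refine ⟨{{x | 0 ≤ τ x ∧ τ x ≤ 1}, {x | 1 ≤ τ x ∧ τ x ≤ 2}, {x | 2 ≤ τ x ∧ τ x ≤ 3}},
    by simp, ?_, ?_, ?_⟩
  · rintro P (rfl | rfl | rfl) <;> exact hP _ _
  · intro x hx
    obtain ⟨h0, h1⟩ := C.time_bounds hx
    have h0' : 0 ≤ τ x := by rw [hτ]; positivity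
    have h1' : τ x ≤ 3 := by rw [hτ, mul_div_assoc', div_le_iff₀ hn]; linarith
    simp only [Set.mem_sUnion, Set.mem_insert_iff, Set.mem_singleton_iff, exists_eq_or_imp,
      exists_eq_left, Set.mem_ofPred_eq]
    rcases le_total (τ x) 1 with h | h
    · exact .inl ⟨h0', h⟩
    rcases le_total (τ x) 2 with h2 | h2
    · exact .inr (.inl ⟨h, h2⟩)
    · exact .inr (.inr ⟨h2, h1'⟩)
  · have hval : ∀ x : T.simplex Δ, C.map (T.toSpace Δ x) = triangleLoop (τ x.1) := fun x => by
      rw [hτ]; rfl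
    rintro P (rfl | rfl | rfl)
    · refine ⟨AffineMap.pi ![c 1 - τ, τ, c 0], fun x hx => ?_⟩
      refine (hval x).trans ?_
      rw [triangleLoop_of_le_one hx.1 hx.2]
      ext i; fin_cases i <;> simp [c]
    · refine ⟨AffineMap.pi ![c 0, c 2 - τ, τ - c 1], fun x hx => ?_⟩
      refine (hval x).trans ?_
      rw [triangleLoop_of_le_two hx.1 hx.2]
      ext i; fin_cases i <;> simp [c]
    · refine ⟨AffineMap.pi ![τ - c 2, c 0, c 3 - τ], fun x hx => ?_⟩
      refine (hval x).trans ?_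
      rw [triangleLoop_of_le_three hx.1 hx.2]
      ext i; fin_cases i <;> simp [c]

end Cyclic

/-- On pairs (edge, end) there are two fixed-point-free involutions: `c` crosses the gluing and `r`
passes to the other end. Iterating `f = r ∘ c` walks along the curve. The walk is periodic, never
traverses an edge in both directions, and by connectedness visits every edge; one period is the
required cyclic numbering. -/
theorem isPLSphere_one {T : GenTriangulation L} (hd : T.HasDim 1) (hc : T.IsClosed)
    (hf : T.FacetConnected) [Nonempty T.Facet] : T.IsPLSphere 1 := by
  have := T.finite_facet
  let D := {d : T.Facet × L // d.2 ∈ T.verts d.1}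
  have hcr : ∀ d : D, ∃ d' : D, ∃ g, T.glue d.1.1 d.1.2 d'.1.1 g ∧ g d.1.2 = d'.1.2 := fun d => by
    obtain ⟨Δ', g, hg⟩ := hc d.1.1 d.1.2 d.2
    exact ⟨⟨(Δ', g d.1.2), (mem_verts_iff hg _).2 d.2⟩, g, hg, rfl⟩
  choose c hcg using hcr
  have hot : ∀ d : D, ∃ d' : D, d'.1.1 = d.1.1 ∧ d'.1.2 ≠ d.1.2 ∧
      T.verts d.1.1 = {d.1.2, d'.1.2} := fun d => by
    obtain ⟨j, hj⟩ := Finset.card_eq_one.1 (show ((T.verts d.1.1).erase d.1.2).card = 1 by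
      rw [Finset.card_erase_of_mem d.2, hd])
    have hj' : j ∈ (T.verts d.1.1).erase d.1.2 := by simp [hj]
    refine ⟨⟨(d.1.1, j), Finset.mem_of_mem_erase hj'⟩, rfl, Finset.ne_of_mem_erase hj', ?_⟩
    exact (Finset.insert_erase d.2).symm.trans (by rw [hj])
  choose r hr1 hr2 hr3 using hot
  have heq : ∀ d e : D, e.1.1 = d.1.1 → e = d ∨ e = r d := by
    rintro d ⟨⟨Δ, i⟩, hi⟩ (rfl : Δ = _)
    have hi' : i ∈ T.verts d.1.1 := hi
    rw [hr3, Finset.mem_insert, Finset.mem_singleton] at hi'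
    rcases hi' with rfl | rfl
    · exact .inl rfl
    · exact .inr (Subtype.ext (Prod.ext (hr1 d).symm rfl))
  have hrr : ∀ d, r (r d) = d := fun d => by
    rcases heq d (r (r d)) ((hr1 _).trans (hr1 d)) with h | h
    · exact h
    · exact absurd (congrArg (fun d : D => d.1.2) h) (hr2 (r d))
  have hcc : ∀ d, c (c d) = d := fun d => by
    obtain ⟨g, hg, h1⟩ := hcg d
    obtain ⟨g', hg', h1'⟩ := hcg (c d)
    have hs := T.glue_symm hg
    rw [h1] at hs
    obtain ⟨e, rfl⟩ := T.glue_unique hg' hs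
    refine Subtype.ext (Prod.ext e ?_)
    rw [← h1', ← h1]
    simp
  have hcne : ∀ d, c d ≠ d := fun d h => by
    obtain ⟨g, hg, h1⟩ := hcg d
    exact T.glue_ne hg (by rw [h1, h])
  have hrne : ∀ d, r d ≠ d := fun d h => hr2 d (by rw [h])
  let f : D → D := fun d => r (c d)
  have hfi : Function.Injective f := fun d e h => by
    rw [← hcc d, ← hrr (c d), show r (c d) = r (c e) from h, hrr, hcc]
  -- If the walk from `e` met `e` reversed after `k` steps, then the walk from `f e` would meet `f
  -- e` reversed after `k - 2`. The descent ends in a fixed point of `r` or of `c`.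
  have hrev : ∀ k e, r e ≠ f^[k] e := by
    intro k
    induction k using Nat.strong_induction_on with
    | _ k ih =>
      intro e h
      match k, ih, h with
      | 0, _, h => exact hrne e h
      | 1, _, h =>
        apply hcne e
        have h : r e = r (c e) := h
        rw [← hrr (c e), ← h, hrr]
      | k + 2, ih, h =>
        refine ih k (by omega) (f e) ?_
        rw [Function.iterate_succ_apply', Function.iterate_succ_apply] at h
        have h : r e = r (c (f^[k] (f e))) := h
        have h' : e = c (f^[k] (f e)) := (hrr e).symm.trans ((congrArg r h).trans (hrr _))
        show r (r (c e)) = _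
        rw [hrr, ← hcc (f^[k] (f e)), ← h']
  obtain ⟨Δ₀⟩ := ‹Nonempty T.Facet›
  obtain ⟨i₀, hi₀⟩ := Finset.card_pos.1 (show 0 < (T.verts Δ₀).card by rw [hd]; omega)
  let d : ℕ → D := fun k => f^[k] ⟨(Δ₀, i₀), hi₀⟩
  have hrev' : ∀ k l, r (d k) ≠ d l := by
    have : ∀ k l, k ≤ l → r (d k) ≠ d l := fun k l h => by
      obtain ⟨j, rfl⟩ := Nat.exists_eq_add_of_le' h
      show r (d k) ≠ f^[j + k] _
      rw [Function.iterate_add_apply]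
      exact hrev j (d k)
    intro k l
    rcases le_total k l with h | h
    · exact this k l h
    · intro e
      exact this l k h (by rw [← e, hrr])
  have hper : ⟨(Δ₀, i₀), hi₀⟩ ∈ Function.periodicPts f := hfi.mem_periodicPts _
  set n := Function.minimalPeriod f ⟨(Δ₀, i₀), hi₀⟩ with hn
  have hpos : 0 < n := Function.minimalPeriod_pos_of_mem_periodicPts hper
  have hmod : ∀ k, d (k % n) = d k := fun k => Function.iterate_mod_minimalPeriod_eq
  have hdn : d n = d 0 := by rw [← hmod n, Nat.mod_self]
  have hinj : ∀ k < n, ∀ l < n, (d k).1.1 = (d l).1.1 → k = l := fun k hk l hl h => by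
    rcases heq _ _ h with h | h
    · exact Function.iterate_injOn_Iio_minimalPeriod hk hl h
    · exact absurd h.symm (hrev' l k)
  have hsurj : ∀ Δ, ∃ k, (d k).1.1 = Δ := fun Δ => by
    have := hf Δ₀ Δ
    induction this with
    | refl => exact ⟨0, rfl⟩
    | @tail Δ' Δ'' _ h ih =>
      obtain ⟨k, rfl⟩ := ih
      obtain ⟨i, g, hg⟩ := h
      have hi := T.glue_mem hg
      rw [hr3, Finset.mem_insert, Finset.mem_singleton] at hi
      rcases hi with rfl | rfl
      · refine ⟨k + 1, ?_⟩
        obtain ⟨g', hg', -⟩ := hcg (d k)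
        rw [← (T.glue_unique hg' hg).1]
        show (f^[k + 1] _).1.1 = _
        rw [Function.iterate_succ_apply']
        exact hr1 _
      -- The edge behind the walker is reached by going almost once around.
      · refine ⟨k + (n - 1), ?_⟩
        have e : d (k + (n - 1)) = c (r (d k)) := by
          apply hfi
          show f (f^[_] _) = r (c (c (r (d k))))
          rw [← Function.iterate_succ_apply' f, hcc, hrr, show (k + (n - 1)).succ = k + n by omega,
            Function.iterate_add_apply]
          show f^[k] (d n) = _
          rw [hdn]
          rfl
        obtain ⟨g', hg', -⟩ := hcg (r (d k))
        rw [e]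
        rw [hr1] at hg'
        exact (T.glue_unique hg' hg).1
  choose idx hidx using hsurj
  refine Cyclic.isPLSphere (n := n)
    { F := fun k => (d k).1.1
      a := fun k => (d k).1.2
      b := fun k => (r (d k)).1.2
      idx := fun Δ => idx Δ % n
      pos := hpos
      idx_lt := fun Δ => Nat.mod_lt _ hpos
      F_idx := fun Δ => by rw [hmod, hidx]
      idx_F := fun k hk => hinj _ (Nat.mod_lt _ hpos) k hk (by rw [hmod, hidx])
      F_n := by rw [hdn]
      b_n := by rw [hdn]
      ne := fun k => (hr2 _).symm
      verts := fun k => hr3 _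
      glue := fun k => ?_ }
  obtain ⟨g, hg, h1⟩ := hcg (d k)
  have hd1 : d (k + 1) = r (c (d k)) := Function.iterate_succ_apply' f k _
  have hF : (d (k + 1)).1.1 = (c (d k)).1.1 := by rw [hd1, hr1]
  have hb : (r (d (k + 1))).1.2 = (c (d k)).1.2 := by rw [hd1, hrr]
  rw [← hF] at hg
  refine ⟨g, hg, by rw [h1, hb], ?_⟩
  have hmem : g (r (d k)).1.2 ∈ T.verts (d (k + 1)).1.1 :=
    (mem_verts_iff hg _).2 (by rw [hr3]; simp)
  rw [hr3, Finset.mem_insert, Finset.mem_singleton] at hmem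
  rcases hmem with h | h
  · exact h
  · rw [hb, ← h1] at h
    exact absurd (g.injective h) (hr2 _)

/-- In a closed `d`-dimensional triangulation, the link of a `(d - 2)`-face is a circle. -/
theorem link_isPLSphere_one {T : GenTriangulation L} {d k : ℕ} (hd : T.HasDim d)
    (hc : T.IsClosed) (h : d = k + 2) (σ : T.Face k) : (T.link σ).IsPLSphere 1 :=
  isPLSphere_one (link_hasDim σ hd (by omega)) (link_isClosed σ hc) (link_facetConnected σ)

end GenTriangulation

/-! ### Euler characteristics of combinations of convex sets -/

/-- `f` is an integral combination of indicators of members of `𝒦`, with coefficients of sum `c`. -/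
inductive HasEuler {E : Type*} (𝒦 : Set (Set E)) : (E → ℤ) → ℤ → Prop
  | zero : HasEuler 𝒦 0 0
  | add_smul {f : E → ℤ} {c : ℤ} (a : ℤ) {K : Set E} : HasEuler 𝒦 f c → K ∈ 𝒦 →
      HasEuler 𝒦 (f + a • K.indicator 1) (c + a)

/-- The nonempty compact convex sets. -/
def convexBodies (E : Type*) [TopologicalSpace E] [AddCommMonoid E] [Module ℝ E] : Set (Set E) :=
  {K | IsCompact K ∧ Convex ℝ K ∧ K.Nonempty}

namespace HasEuler

section

variable {E : Type*} {𝒦 : Set (Set E)} {f g : E → ℤ} {b c : ℤ}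

theorem add (hf : HasEuler 𝒦 f b) (hg : HasEuler 𝒦 g c) : HasEuler 𝒦 (f + g) (b + c) := by
  induction hg with
  | zero => simpa using hf
  | add_smul a _ hK ih => simpa only [add_assoc] using ih.add_smul a hK

theorem zsmul (hf : HasEuler 𝒦 f b) (a : ℤ) : HasEuler 𝒦 (a • f) (a * b) := by
  induction hf with
  | zero => simpa using zero
  | add_smul a' _ hK ih => simpa only [smul_add, mul_add, smul_smul] using ih.add_smul (a * a') hK

theorem sub (hf : HasEuler 𝒦 f b) (hg : HasEuler 𝒦 g c) : HasEuler 𝒦 (f - g) (b - c) := by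
  have := hf.add (hg.zsmul (-1))
  rwa [neg_one_smul, neg_one_mul, ← sub_eq_add_neg, ← sub_eq_add_neg] at this

theorem single {K : Set E} (hK : K ∈ 𝒦) : HasEuler 𝒦 (K.indicator 1) 1 := by
  simpa using zero.add_smul 1 hK

theorem mono {𝒦' : Set (Set E)} (h : 𝒦 ⊆ 𝒦') (hf : HasEuler 𝒦 f b) : HasEuler 𝒦' f b := by
  induction hf with
  | zero => exact zero
  | add_smul a _ hK ih => exact ih.add_smul a (h hK)

theorem sum {ι : Type*} (s : Finset ι) {f : ι → E → ℤ} {c : ι → ℤ}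
    (h : ∀ i ∈ s, HasEuler 𝒦 (f i) (c i)) : HasEuler 𝒦 (∑ i ∈ s, f i) (∑ i ∈ s, c i) := by
  classical
  induction s using Finset.induction_on with
  | empty => simpa using zero
  | insert i s hi ih =>
    rw [Finset.sum_insert hi, Finset.sum_insert hi]
    exact (h i (Finset.mem_insert_self _ _)).add (ih fun j hj => h j (Finset.mem_insert_of_mem hj))

end

/-! The number `c` is determined by `f`. -/

open Filter Topology in
-- On the line the coefficient sum is the total of the jumps `f t - f (t + 0)`: a compact interval
-- jumps only at its right end, by 1. The finite set `R₀` collects the right ends.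
theorem eq_sum_sub {f : ℝ → ℤ} {c : ℤ} (h : HasEuler (convexBodies ℝ) f c) :
    ∃ R₀ : Finset ℝ, ∀ R, R₀ ⊆ R → ∀ᶠ ε in 𝓝[>] (0 : ℝ), ∑ t ∈ R, (f t - f (t + ε)) = c := by
  classical
  induction h with
  | zero => exact ⟨∅, fun R _ => by simp⟩
  | @add_smul f c a K _ hK ih =>
    obtain ⟨R₀, hR₀⟩ := ih
    obtain ⟨hK, hc, hne⟩ := hK
    obtain ⟨r, hr, hmax⟩ := hK.exists_isMaxOn hne continuousOn_id
    refine ⟨insert r R₀, fun R hR => ?_⟩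
    have key : ∀ t, ∀ᶠ ε in 𝓝[>] (0 : ℝ),
        (K.indicator 1 t - K.indicator 1 (t + ε) : ℤ) = if t = r then 1 else 0 := fun t => by
      have hlim : Tendsto (fun ε => t + ε) (𝓝[>] (0 : ℝ)) (𝓝 t) := by
        have : Tendsto (fun ε => t + ε) (𝓝 (0 : ℝ)) (𝓝 (t + 0)) :=
          (continuous_const.add continuous_id).tendsto 0
        rw [add_zero] at this
        exact this.mono_left nhdsWithin_le_nhds
      by_cases ht : t ∈ K
      · rcases (show t ≤ r from hmax ht).eq_or_lt with rfl | htr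
        · filter_upwards [self_mem_nhdsWithin] with ε hε
          have : t + ε ∉ K := fun h => by
            have h1 : t + ε ≤ t := hmax h
            have h2 : 0 < ε := hε
            linarith
          simp [ht, this]
        · filter_upwards [self_mem_nhdsWithin, hlim.eventually (gt_mem_nhds htr)] with ε hε h2
          have h1 : 0 < ε := hε
          have : t + ε ∈ K := hc.ordConnected.out ht hr ⟨by linarith, h2.le⟩
          simp [ht, this, htr.ne]
      · have h1 := hlim.eventually (hK.isClosed.isOpen_compl.mem_nhds ht)
        filter_upwards [h1] with ε h1
        have h1 : t + ε ∉ K := h1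
        have : t ≠ r := fun h => ht (h ▸ hr)
        simp [ht, h1, this]
    filter_upwards [hR₀ R ((Finset.subset_insert _ _).trans hR),
      (Filter.eventually_all_finset R).2 fun t _ => key t] with ε h1 h2
    have h3 : ∑ t ∈ R, (a * K.indicator 1 t - a * K.indicator 1 (t + ε) : ℤ) = a := by
      rw [Finset.sum_congr rfl fun t ht => by rw [← mul_sub, h2 t ht]]
      simp [hR (Finset.mem_insert_self _ _)]
    refine Eq.trans ?_ (congrArg₂ (· + ·) h1 h3)
    rw [← Finset.sum_add_distrib]
    refine Finset.sum_congr rfl fun t _ => ?_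
    simp only [Pi.add_apply, Pi.smul_apply, smul_eq_mul]
    ring

/-- Slicing by the first coordinate is compatible with coefficient sums: the slices of a convex body
are convex bodies over its projection, an interval, and empty elsewhere. -/
theorem slice {n : ℕ} {f : (Fin (n + 1) → ℝ) → ℤ} {c : ℤ}
    (h : HasEuler (convexBodies (Fin (n + 1) → ℝ)) f c) :
    ∃ g : ℝ → ℤ, HasEuler (convexBodies ℝ) g c ∧
      ∀ t, HasEuler (convexBodies (Fin n → ℝ)) (fun x => f (Fin.cons t x)) (g t) := by
  induction h with
  | zero => exact ⟨0, zero, fun t => zero⟩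
  | @add_smul f c a K _ hK ih =>
    obtain ⟨g, hg, hs⟩ := ih
    obtain ⟨hK, hc, hne⟩ := hK
    refine ⟨_, hg.add_smul a (K := (fun x => x 0) '' K) ⟨hK.image (continuous_apply 0),
      hc.linear_image (LinearMap.proj 0), hne.image _⟩, fun t => ?_⟩
    by_cases ht : ∃ x, (Fin.cons t x : Fin (n + 1) → ℝ) ∈ K
    · obtain ⟨x, hx⟩ := ht
      have h0 : t ∈ (fun x : Fin (n + 1) → ℝ => x 0) '' K := ⟨_, hx, by simp⟩
      have := (hs t).add_smul a (K := {x | (Fin.cons t x : Fin (n + 1) → ℝ) ∈ K}) ⟨?_, ?_, x, hx⟩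
      · have e : (g + a • ((fun x : Fin (n + 1) → ℝ => x 0) '' K).indicator 1 : ℝ → ℤ) t = g t + a := by
          rw [Pi.add_apply, Pi.smul_apply, Set.indicator_of_mem h0]
          simp
        rw [e]
        exact this
      · have : {x : Fin n → ℝ | (Fin.cons t x : Fin (n + 1) → ℝ) ∈ K} =
            Fin.tail '' (K ∩ {y | y 0 = t}) := by
          ext x
          constructor
          · exact fun h => ⟨_, ⟨h, by simp⟩, by simp⟩
          · rintro ⟨y, ⟨hy, rfl⟩, rfl⟩
            simpa [Fin.cons_self_tail] using hy
        rw [this]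
        refine (hK.inter_right (isClosed_eq (continuous_apply 0) continuous_const)).image ?_
        exact continuous_pi fun i => continuous_apply i.succ
      · intro x hx y hy p q hp hq hpq
        have := hc hx hy hp hq hpq
        show Fin.cons t (p • x + q • y) ∈ K
        convert this using 1
        ext i
        refine Fin.cases ?_ (fun j => ?_) i
        · simp [← add_mul, hpq]
        · simp
    · have h0 : t ∉ (fun x : Fin (n + 1) → ℝ => x 0) '' K := by
        rintro ⟨y, hy, rfl⟩
        exact ht ⟨Fin.tail y, by simpa [Fin.cons_self_tail] using hy⟩
      push Not at ht
      convert hs t using 1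
      · ext x
        simp [ht]
      · simp [h0]

/-- By induction the function of slice values vanishes, and on the line the jump formula determines
the coefficient sum. In dimension zero it is the value at the point. -/
theorem eq_zero {n : ℕ} {c : ℤ} (h : HasEuler (convexBodies (Fin n → ℝ)) 0 c) : c = 0 := by
  induction n generalizing c with
  | zero =>
    have key : ∀ f c, HasEuler (convexBodies (Fin 0 → ℝ)) f c → f 0 = c := fun f c h => by
      induction h with
      | zero => rfl
      | add_smul a _ hK ih =>
        obtain ⟨x, hx⟩ := hK.2.2
        rw [Subsingleton.elim x 0] at hx
        rw [Pi.add_apply, Pi.smul_apply, Set.indicator_of_mem hx, ih]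
        simp
    exact (key _ _ h).symm
  | succ n ih =>
    obtain ⟨g, hg, hs⟩ := h.slice
    have : g = 0 := funext fun t => ih (hs t)
    obtain ⟨R, hR⟩ := hg.eq_sum_sub
    obtain ⟨ε, h⟩ := (hR R le_rfl).exists
    rw [← h, this]
    simp

theorem unique {n : ℕ} {f : (Fin n → ℝ) → ℤ} {b c : ℤ} (hb : HasEuler (convexBodies _) f b)
    (hc : HasEuler (convexBodies _) f c) : b = c := by
  have := hb.sub hc
  rw [sub_self] at this
  exact sub_eq_zero.1 this.eq_zero

/-- Inclusion–exclusion over the cover. The coefficient sum is left unspecified; `unique` determines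
it where it is needed. -/
theorem exists_inter {E : Type*} {𝒦 : Set (Set E)} {C : Set (Set E)} (hC : C.Finite) :
    ∀ K : Set E, (∀ D ⊆ C, D.Nonempty → (K ∩ ⋂₀ D).Nonempty → K ∩ ⋂₀ D ∈ 𝒦) →
      ∃ c, HasEuler 𝒦 ((K ∩ ⋃₀ C).indicator 1) c := by
  induction C, hC using Set.Finite.induction_on with
  | empty => exact fun K _ => ⟨0, by rw [Set.sUnion_empty, Set.inter_empty, Set.indicator_empty]; exact zero⟩
  | @insert P C hP hC ih =>
    intro K hK
    obtain ⟨c₁, h₁⟩ := ih K fun D hD => hK D (hD.trans (Set.subset_insert _ _))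
    obtain ⟨c₂, h₂⟩ := ih (K ∩ P) fun D hD _ hne => by
      have := hK (insert P D) (Set.insert_subset_insert hD) (Set.insert_nonempty _ _)
      rw [Set.sInter_insert, ← Set.inter_assoc] at this
      exact this hne
    obtain ⟨c₃, h₃⟩ : ∃ c, HasEuler 𝒦 ((K ∩ P).indicator 1) c := by
      by_cases h : (K ∩ P).Nonempty
      · refine ⟨1, single ?_⟩
        have := hK {P} (by simp) (by simp)
        rw [Set.sInter_singleton] at this
        exact this h
      · rw [Set.not_nonempty_iff_eq_empty.1 h]
        rw [Set.indicator_empty]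
        exact ⟨0, zero⟩
    -- With `U = ⋃₀ C`, the indicator of `K ∩ (P ∪ U)` is the sum of those of `K ∩ U` and `K ∩ P`
    -- minus that of `K ∩ P ∩ U`.
    refine ⟨_, (h₁.add h₃).sub h₂ |> (Eq.mp (congrFun (congrArg _ ?_) _))⟩
    ext x
    by_cases h1 : x ∈ K <;> by_cases h2 : x ∈ P <;> by_cases h3 : x ∈ ⋃₀ C <;>
      simp [Set.indicator, h1, h2, h3, Set.sUnion_insert]

end HasEuler

/-! ### Faces of the standard simplex -/

section Faces

variable {L : Type} [Fintype L] [DecidableEq L]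

/-- The closed face of the standard simplex with vertices in `s`. -/
def closedFace (s : Finset L) : Set (L → ℝ) :=
  {x | (∀ v, 0 ≤ x v) ∧ ∑ v, x v = 1 ∧ ∀ v, v ∉ s → x v = 0}

/-- The labels of the nonzero coordinates. -/
noncomputable def coordSupport (x : L → ℝ) : Finset L := Finset.univ.filter (x · ≠ 0)

theorem mem_coordSupport {x : L → ℝ} {v : L} : v ∈ coordSupport x ↔ x v ≠ 0 := by
  simp [coordSupport]

/-- The relatively open face of the standard simplex with vertex set `s`. -/
def openFace (s : Finset L) : Set (L → ℝ) := {x ∈ closedFace s | coordSupport x = s}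

theorem mem_closedFace_iff {s : Finset L} {x : L → ℝ} :
    x ∈ closedFace s ↔ (∀ v, 0 ≤ x v) ∧ ∑ v, x v = 1 ∧ coordSupport x ⊆ s := by
  refine and_congr_right fun _ => and_congr_right fun _ => forall_congr' fun v => ?_
  rw [mem_coordSupport]
  exact not_imp_comm

theorem mem_openFace_iff {s : Finset L} {x : L → ℝ} :
    x ∈ openFace s ↔ (∀ v, 0 ≤ x v) ∧ ∑ v, x v = 1 ∧ coordSupport x = s :=
  ⟨fun h => ⟨h.1.1, h.1.2.1, h.2⟩, fun h => ⟨mem_closedFace_iff.2 ⟨h.1, h.2.1, h.2.2.le⟩, h.2.2⟩⟩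

theorem coordSupport_nonempty {s : Finset L} {x : L → ℝ} (hx : x ∈ closedFace s) :
    (coordSupport x).Nonempty := by
  by_contra h
  rw [Finset.not_nonempty_iff_eq_empty] at h
  have h0 : ∀ v, x v = 0 := fun v => by
    by_contra hv
    rw [← ne_eq, ← mem_coordSupport, h] at hv
    simp at hv
  have := hx.2.1
  simp [h0] at this

theorem closedFace_mem_convexBodies {s : Finset L} (hs : s.Nonempty) :
    closedFace s ∈ convexBodies (L → ℝ) := by
  refine ⟨?_, ?_, ?_⟩
  · have : closedFace s = stdSimplex ℝ L ∩ ⋂ v, {x | v ∉ s → x v = 0} := by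
      ext x
      simp [closedFace, stdSimplex, and_assoc]
    rw [this]
    refine (isCompact_stdSimplex ℝ L).inter_right (isClosed_iInter fun v => ?_)
    by_cases hv : v ∈ s
    · simp [hv]
    · simpa [hv] using isClosed_eq (continuous_apply v) continuous_const
  · intro x hx y hy a b ha hb hab
    refine ⟨fun v => ?_, ?_, fun v hv => ?_⟩
    · have := hx.1 v
      have := hy.1 v
      simp only [Pi.add_apply, Pi.smul_apply, smul_eq_mul]
      positivity
    · simp only [Pi.add_apply, Pi.smul_apply, smul_eq_mul, Finset.sum_add_distrib,
        ← Finset.mul_sum, hx.2.1, hy.2.1, mul_one, hab]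
    · simp [hx.2.2 v hv, hy.2.2 v hv]
  · obtain ⟨v, hv⟩ := hs
    refine ⟨Pi.single v 1, fun w => ?_, by simp, fun w hw => ?_⟩
    · by_cases h : w = v
      · subst h; simp
      · simp [h]
    · rw [Pi.single_eq_of_ne]
      rintro rfl
      exact hw hv

theorem indicator_closedFace (s : Finset L) :
    (closedFace s).indicator (1 : (L → ℝ) → ℤ) =
      ∑ t ∈ s.powerset with t.Nonempty, (openFace t).indicator 1 := by
  ext x
  rw [Finset.sum_apply]
  by_cases hx : x ∈ closedFace s
  · rw [Set.indicator_of_mem hx, Finset.sum_eq_single (coordSupport x)]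
    · exact (Set.indicator_of_mem (mem_openFace_iff.2 ⟨hx.1, hx.2.1, rfl⟩) _).symm
    · intro t _ ht
      exact Set.indicator_of_notMem (fun h => ht h.2.symm) _
    · intro h
      refine absurd (Finset.mem_filter.2 ⟨Finset.mem_powerset.2 ?_, coordSupport_nonempty hx⟩) h
      exact (mem_closedFace_iff.1 hx).2.2
  · rw [Set.indicator_of_notMem hx, Finset.sum_eq_zero]
    intro t ht
    refine Set.indicator_of_notMem (fun h => hx ?_) _
    have h' := mem_openFace_iff.1 h
    refine mem_closedFace_iff.2 ⟨h'.1, h'.2.1, h'.2.2.le.trans ?_⟩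
    exact Finset.mem_powerset.1 (Finset.mem_filter.1 ht).1

theorem sum_nonempty_neg_one_pow {s : Finset L} (hs : s.Nonempty) :
    ∑ t ∈ s.powerset with t.Nonempty, (-1 : ℤ) ^ (t.card - 1) = 1 := by
  have h := Finset.sum_powerset_neg_one_pow_card_of_nonempty hs
  rw [← Finset.sum_filter_add_sum_filter_not _ (fun t : Finset L => t.Nonempty)] at h
  have h2 : s.powerset.filter (fun t => ¬ t.Nonempty) = {∅} := by
    ext t
    simp only [Finset.mem_filter, Finset.mem_powerset, Finset.not_nonempty_iff_eq_empty,
      Finset.mem_singleton]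
    exact ⟨fun h => h.2, fun h => ⟨by simp [h], h⟩⟩
  rw [h2, Finset.sum_singleton, Finset.card_empty, pow_zero] at h
  have h3 : ∑ t ∈ s.powerset with t.Nonempty, (-1 : ℤ) ^ t.card =
      - ∑ t ∈ s.powerset with t.Nonempty, (-1 : ℤ) ^ (t.card - 1) := by
    rw [← Finset.sum_neg_distrib]
    refine Finset.sum_congr rfl fun t ht => ?_
    have : 0 < t.card := Finset.card_pos.2 (Finset.mem_filter.1 ht).2
    obtain ⟨m, hm⟩ := Nat.exists_eq_add_of_lt this
    rw [hm]
    simp [pow_succ]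
  linarith

/-- A closed face is the disjoint union of its open subfaces, whose signs sum to 1; solving for the
top one gives its sign. The family `𝒦` is arbitrary because the result is also needed for sets on
which a PL map is affine. -/
theorem HasEuler.openFace {𝒦 : Set (Set (L → ℝ))} (s : Finset L) (hs : s.Nonempty)
    (h : ∀ t ⊆ s, t.Nonempty → HasEuler 𝒦 ((closedFace t).indicator 1) 1) :
    HasEuler 𝒦 ((openFace s).indicator 1) ((-1) ^ (s.card - 1)) := by
  induction s using Finset.strongInduction with
  | H s ih =>
    have hmem : s ∈ s.powerset.filter (·.Nonempty) := by simpa using hs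
    have h1 := indicator_closedFace s
    have h2 := sum_nonempty_neg_one_pow hs
    rw [← Finset.sum_erase_add _ _ hmem] at h1 h2
    rw [← sub_eq_of_eq_add' h1, ← sub_eq_of_eq_add' h2.symm]
    refine (h s le_rfl hs).sub (HasEuler.sum _ fun t ht => ?_)
    simp only [Finset.mem_erase, Finset.mem_filter, Finset.mem_powerset] at ht
    exact ih t (ht.2.1.ssubset_of_ne ht.1) ht.2.2 fun t' h' => h t' (h'.trans ht.2.1)

/-- The sphere is the closed simplex minus the open one of dimension `k + 1`. -/
theorem HasEuler.stdPLSphere (k : ℕ) :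
    HasEuler (convexBodies _) ((GenTriangulation.stdPLSphere k).indicator 1) (1 + (-1) ^ k) := by
  have h1 : HasEuler (convexBodies (Fin (k + 2) → ℝ)) ((closedFace Finset.univ).indicator 1) 1 :=
    .single (closedFace_mem_convexBodies Finset.univ_nonempty)
  have h2 := HasEuler.openFace (𝒦 := convexBodies (Fin (k + 2) → ℝ)) Finset.univ
    Finset.univ_nonempty fun t _ ht => .single (closedFace_mem_convexBodies ht)
  convert h1.sub h2 using 1
  · ext y
    have hy : y ∈ GenTriangulation.stdPLSphere k ↔
        y ∈ closedFace Finset.univ ∧ y ∉ _root_.openFace Finset.univ := by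
      simp only [GenTriangulation.stdPLSphere, Set.mem_ofPred_eq, mem_closedFace_iff,
        mem_openFace_iff, Finset.eq_univ_iff_forall, mem_coordSupport]
      constructor
      · rintro ⟨h0, h1, j, hj⟩
        exact ⟨⟨h0, h1, Finset.subset_univ _⟩, fun h => h.2.2 j hj⟩
      · rintro ⟨⟨h0, h1, -⟩, h⟩
        refine ⟨h0, h1, ?_⟩
        by_contra! hj
        exact h ⟨h0, h1, hj⟩
    have hsub : y ∈ _root_.openFace Finset.univ → y ∈ closedFace Finset.univ := fun h => h.1
    by_cases h3 : y ∈ closedFace Finset.univ <;> by_cases h4 : y ∈ _root_.openFace Finset.univ <;>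
      simp_all [Set.indicator]
  · simp [pow_succ]

end Faces

namespace GenTriangulation

/-! ### The Euler characteristic of triangulated spheres -/

section Points

variable {L : Type} [Fintype L] [DecidableEq L] {T : GenTriangulation L}

theorem PointStep.symm {a b : Σ Δ : T.Facet, T.simplex Δ} (h : T.PointStep a b) :
    T.PointStep b a := by
  obtain ⟨i, g, hg, h0, h⟩ := h
  exact ⟨g i, g⁻¹, T.glue_symm hg, by rw [h, h0], fun v => by
    rw [← h]
    simp⟩

theorem coordSupport_comp {x y : L → ℝ} {g : Equiv.Perm L} (h : ∀ v, y (g v) = x v) :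
    coordSupport y = (coordSupport x).map g.toEmbedding := by
  ext v
  obtain ⟨w, rfl⟩ := g.surjective v
  rw [mem_coordSupport, h, Finset.mem_map_equiv, Equiv.symm_apply_apply, mem_coordSupport]

/-- Each identification in the chain crosses a ridge whose opposite coordinate is zero, so the
support of the point is carried along. -/
theorem carries_of_toSpace_eq {Δ Δ' : T.Facet} {x : T.simplex Δ} {y : T.simplex Δ'}
    (h : T.toSpace Δ x = T.toSpace Δ' y) :
    ∃ g, T.Carries Δ (coordSupport x.1) Δ' g ∧ ∀ v, y.1 (g v) = x.1 v := by
  have h := reflTransGen_of_eqvGen (fun _ _ h => PointStep.symm h) (Quot.eqvGen_exact h)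
  have key : ∀ b : Σ Δ : T.Facet, T.simplex Δ, Relation.ReflTransGen T.PointStep ⟨Δ, x⟩ b →
      ∃ g, T.Carries Δ (coordSupport x.1) b.1 g ∧ ∀ v, b.2.1 (g v) = x.1 v := by
    intro b h
    induction h with
    | refl => exact ⟨1, .refl, fun _ => rfl⟩
    | tail _ h ih =>
      obtain ⟨g, hg, hx⟩ := ih
      obtain ⟨i, g', hg', h0, hy⟩ := h
      refine ⟨g' * g, .step hg hg' ?_, fun v => by rw [Equiv.Perm.mul_apply, hy, hx]⟩
      rw [← coordSupport_comp hx, mem_coordSupport]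
      exact not_not_intro h0
  exact key _ h

theorem finite_fiber (Δ : T.Facet) (p : T.Space) : {x | ∃ hx, T.toSpace Δ ⟨x, hx⟩ = p}.Finite := by
  by_cases h : ∃ x hx, T.toSpace Δ ⟨x, hx⟩ = p
  · obtain ⟨x, hx, rfl⟩ := h
    refine (Set.finite_range fun g : Equiv.Perm L => x ∘ g).subset ?_
    rintro y ⟨hy, h⟩
    obtain ⟨g, -, hg⟩ := carries_of_toSpace_eq h
    exact ⟨g, funext hg⟩
  · convert Set.finite_empty
    ext x
    exact ⟨fun h' => h ⟨x, h'⟩, fun h => h.elim⟩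

/-- In a valid triangulation, the open faces of a facet are embedded. -/
theorem IsValid.toSpace_injective (hT : T.IsValid) {Δ : T.Facet} {x y : T.simplex Δ}
    (h : T.toSpace Δ x = T.toSpace Δ y) (hs : coordSupport x.1 = coordSupport y.1) : x = y := by
  obtain ⟨g, hc, hg⟩ := carries_of_toSpace_eq h
  have hmap := coordSupport_comp hg
  rw [← hs] at hmap
  have hfix := hT Δ _ (mem_closedFace_iff.1 x.2).2.2 g hc hmap.symm
  refine Subtype.ext (funext fun v => ?_)
  by_cases hv : v ∈ coordSupport x.1
  · rw [← hg v, hfix v hv]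
  · have hv' := hs ▸ hv
    rw [mem_coordSupport, not_not] at hv hv'
    rw [hv, hv']

theorem coordSupport_segment {x y : L → ℝ} (hx : ∀ v, 0 ≤ x v) (hy : ∀ v, 0 ≤ y v) {a b : ℝ}
    (ha : 0 < a) (hb : 0 < b) : coordSupport (a • x + b • y) = coordSupport x ∪ coordSupport y := by
  ext v
  have h1 := mul_nonneg ha.le (hx v)
  have h2 := mul_nonneg hb.le (hy v)
  rw [Finset.mem_union, mem_coordSupport, mem_coordSupport, mem_coordSupport, ← not_and_or]
  refine not_congr ?_
  simp only [Pi.add_apply, Pi.smul_apply, smul_eq_mul]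
  rw [add_eq_zero_iff_of_nonneg h1 h2, mul_eq_zero_iff_left ha.ne', mul_eq_zero_iff_left hb.ne']

/-- The faces of all dimensions at most `d`. -/
def AnyFace (T : GenTriangulation L) (d : ℕ) : Type := Σ k : Fin (d + 1), T.Face k

/-- The class of a face of a facet. -/
def anyFace {d : ℕ} (hd : T.HasDim d) (Δ : T.Facet) (s : Finset L) (hs : s ⊆ T.verts Δ)
    (hne : s.Nonempty) : T.AnyFace d :=
  have h1 := Finset.card_pos.2 hne
  have h2 := Finset.card_le_card hs
  ⟨⟨s.card - 1, by rw [hd] at h2; omega⟩,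
    Quot.mk _ ⟨(Δ, s), hs, (Nat.sub_add_cancel h1).symm⟩⟩

theorem anyFace_eq {d k : ℕ} (hd : T.HasDim d) (p : T.PreFace k) (hne) (hk : k < d + 1) :
    anyFace hd p.1.1 p.1.2 p.2.1 hne = ⟨⟨k, hk⟩, Quot.mk _ p⟩ := by
  obtain ⟨⟨Δ, s⟩, hs, hc⟩ := p
  obtain rfl : k = s.card - 1 := by
    have : s.card = k + 1 := hc
    omega
  rfl

theorem anyFace_glue {d : ℕ} (hd : T.HasDim d) {Δ Δ' : T.Facet} {i g} (hg : T.glue Δ i Δ' g)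
    {s s' : Finset L} (hi : i ∉ s) (hs' : s' = s.map g.toEmbedding) (h1 h2 h3 h4) :
    anyFace hd Δ s h1 h2 = anyFace hd Δ' s' h3 h4 := by
  subst hs'
  have hc := Nat.sub_add_cancel (Finset.card_pos.2 h2)
  let p : T.PreFace (s.card - 1) := ⟨(Δ, s), h1, hc.symm⟩
  have hk : s.card - 1 < d + 1 := by
    have := Finset.card_le_card h1
    rw [hd] at this
    have := Finset.card_pos.2 h2
    omega
  exact (anyFace_eq hd p h2 hk).trans ((congrArg _ (Quot.sound (p.step_move hg hi))).trans
    (anyFace_eq hd (p.move hg) h4 hk).symm)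

theorem simplex_eq (Δ : T.Facet) : T.simplex Δ = closedFace (T.verts Δ) := rfl

theorem anyFace_eq_of_toSpace_eq {d : ℕ} (hd : T.HasDim d) {Δ Δ' : T.Facet} {x : T.simplex Δ}
    {y : T.simplex Δ'} (h : T.toSpace Δ x = T.toSpace Δ' y) (h1 h2 h3 h4) :
    anyFace hd Δ (coordSupport x.1) h1 h2 = anyFace hd Δ' (coordSupport y.1) h3 h4 := by
  have h := reflTransGen_of_eqvGen (fun _ _ h => PointStep.symm h) (Quot.eqvGen_exact h)
  have key : ∀ b : Σ Δ : T.Facet, T.simplex Δ, Relation.ReflTransGen T.PointStep ⟨Δ, x⟩ b →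
      ∀ h3 h4, anyFace hd Δ (coordSupport x.1) h1 h2 =
        anyFace hd b.1 (coordSupport b.2.1) h3 h4 := by
    intro b h
    induction h with
    | refl => exact fun _ _ => rfl
    | @tail b c _ h ih =>
      obtain ⟨i, g', hg', h0, hy⟩ := h
      intro h3 h4
      refine (ih (mem_closedFace_iff.1 b.2.2).2.2 (coordSupport_nonempty b.2.2)).trans
        (anyFace_glue hd hg' ?_ (coordSupport_comp hy) _ _ _ _)
      rw [mem_coordSupport]
      exact not_not_intro h0
  exact key _ h _ _

theorem exists_toSpace_eq {k : ℕ} {p q : T.PreFace k}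
    (h : Quot.mk (PreFace.Step T k) p = Quot.mk _ q) (x : T.simplex p.1.1)
    (hx : coordSupport x.1 = p.1.2) :
    ∃ y : T.simplex q.1.1, coordSupport y.1 = q.1.2 ∧ T.toSpace _ y = T.toSpace _ x := by
  replace h := reflTransGen_of_eqvGen (fun _ _ h => PreFace.Step.symm h) (Quot.eqvGen_exact h)
  induction h with
  | refl => exact ⟨x, hx, rfl⟩
  | @tail q r _ h ih =>
    obtain ⟨y, hy, he⟩ := ih
    obtain ⟨i, g, hg, hi, hs⟩ := h
    have hv : ∀ v, (y.1 ∘ g.symm) (g v) = y.1 v := fun v => by simp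
    have hc := coordSupport_comp hv
    have hm : y.1 ∘ g.symm ∈ T.simplex r.1.1 := by
      rw [simplex_eq, mem_closedFace_iff]
      refine ⟨fun v => y.2.1 _, ?_, ?_⟩
      · rw [← y.2.2.1]
        exact Equiv.sum_comp g.symm y.1
      · rw [hc, hy, ← hs]
        exact r.2.1
    refine ⟨⟨_, hm⟩, by rw [hc, hy, hs], he ▸ (toSpace_eq hg y.2 hm ?_ hv).symm⟩
    by_contra h0
    rw [← ne_eq, ← mem_coordSupport, hy] at h0
    exact hi h0

end Points

/-! ### Pushing indicators of faces forward to the sphere -/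

section Valuation

theorem finsum_mem_single {α : Type*} {s : Set α} {f : α → ℤ} {a : α} (ha : a ∈ s)
    (h : ∀ x ∈ s, x ≠ a → f x = 0) : ∑ᶠ x ∈ s, f x = f a := by
  rw [finsum_eq_single _ a fun x hx => ?_]
  · simp [ha]
  · by_cases hs : x ∈ s
    · simp [hs, h x hs hx]
    · simp [hs]

variable {m n : ℕ} {T : GenTriangulation (Fin m)} {h : T.Space → Fin n → ℝ}

/-- The nonempty compact convex subsets of a facet on which `h` is affine. -/
def affinePieces (h : T.Space → Fin n → ℝ) (Δ : T.Facet) : Set (Set (Fin m → ℝ)) :=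
  {K ∈ convexBodies (Fin m → ℝ) | ∃ A : (Fin m → ℝ) →ᵃ[ℝ] (Fin n → ℝ),
    ∀ x ∈ K, ∃ hx, h (T.toSpace Δ ⟨x, hx⟩) = A x}

/-- If `A` identified `x` and `y`, it would be constant on their segment. The points at one third
and two thirds have equal supports, unlike possibly the endpoints, so validity of `T` forces them to
coincide. -/
theorem affinePieces_injOn (hT : T.IsValid) (hh : Function.Injective h) {Δ : T.Facet}
    {K : Set (Fin m → ℝ)} (hc : Convex ℝ K) {A : (Fin m → ℝ) →ᵃ[ℝ] (Fin n → ℝ)}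
    (hA : ∀ x ∈ K, ∃ hx, h (T.toSpace Δ ⟨x, hx⟩) = A x) : Set.InjOn A K := by
  intro x hx y hy e
  obtain ⟨hx', -⟩ := hA x hx
  obtain ⟨hy', -⟩ := hA y hy
  have h13 : (0 : ℝ) < 1 / 3 := by norm_num
  have h23 : (0 : ℝ) < 2 / 3 := by norm_num
  have hp : ∀ {a b : ℝ}, 0 < a → 0 < b → a + b = 1 → ∃ hz : a • x + b • y ∈ T.simplex Δ,
      h (T.toSpace Δ ⟨_, hz⟩) = A x ∧
        coordSupport (a • x + b • y) = coordSupport x ∪ coordSupport y := by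
    intro a b ha hb hab
    obtain ⟨hz, h1⟩ := hA _ (hc hx hy ha.le hb.le hab)
    refine ⟨hz, h1.trans ?_, coordSupport_segment hx'.1 hy'.1 ha hb⟩
    rw [Convex.combo_affine_apply hab, ← e, Convex.combo_self hab]
  obtain ⟨hz, h1, h2⟩ := hp h13 h23 (by norm_num)
  obtain ⟨hw, h3, h4⟩ := hp h23 h13 (by norm_num)
  have := hT.toSpace_injective (hh (h1.trans h3.symm)) (h2.trans h4.symm)
  have := congrArg Subtype.val this
  ext v
  have := congrFun this v
  simp only [Pi.add_apply, Pi.smul_apply, smul_eq_mul] at this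
  linarith

/-- Combinations of indicators can be pushed forward along `h`. -/
theorem HasEuler.push (hT : T.IsValid) (hh : Function.Injective h) {Δ : T.Facet}
    {f : (Fin m → ℝ) → ℤ} {c : ℤ} (hf : HasEuler (affinePieces h Δ) f c) :
    HasEuler (convexBodies (Fin n → ℝ))
      (fun y => ∑ᶠ x ∈ {x | ∃ hx, h (T.toSpace Δ ⟨x, hx⟩) = y}, f x) c := by
  have hfin : ∀ y, {x | ∃ hx, h (T.toSpace Δ ⟨x, hx⟩) = y}.Finite := fun y => by
    by_cases hy : ∃ p, h p = y
    · obtain ⟨p, rfl⟩ := hy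
      refine (finite_fiber Δ p).subset ?_
      rintro x ⟨hx, e⟩
      exact ⟨hx, hh e⟩
    · convert Set.finite_empty
      ext x
      exact ⟨fun ⟨_, h'⟩ => hy ⟨_, h'⟩, fun h => h.elim⟩
  induction hf with
  | zero =>
    convert HasEuler.zero using 1
    ext y
    simp
  | @add_smul f c a K _ hK ih =>
    obtain ⟨hK, A, hA⟩ := hK
    have hinj := affinePieces_injOn hT hh hK.2.1 hA
    have := ih.add_smul a (K := A '' K) ⟨hK.1.image A.continuous_of_finiteDimensional,
      hK.2.1.affine_image A, hK.2.2.image _⟩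
    convert this using 1
    ext y
    simp only [Pi.add_apply, Pi.smul_apply]
    rw [finsum_mem_add_distrib (hfin y)]
    congr 1
    by_cases hy : y ∈ A '' K
    · obtain ⟨x, hx, rfl⟩ := hy
      rw [finsum_mem_single (a := x), Set.indicator_of_mem hx, Set.indicator_of_mem (Set.mem_image_of_mem A hx)]
      · rfl
      · exact hA x hx
      · rintro z ⟨hz, e⟩ hzx
        rw [Set.indicator_of_notMem, smul_zero]
        intro hzK
        obtain ⟨_, e'⟩ := hA z hzK
        exact hzx (hinj hzK hx (e'.symm.trans e))
    · rw [Set.indicator_of_notMem hy, smul_zero]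
      refine finsum_mem_eq_zero_of_forall_eq_zero ?_
      rintro x ⟨hx, e⟩
      rw [Set.indicator_of_notMem, smul_zero]
      intro hxK
      obtain ⟨_, e'⟩ := hA x hxK
      exact hy ⟨x, hxK, e'.symm.trans e⟩

/-- The polyhedra on which `h` is affine cover the face, so inclusion–exclusion gives a combination
with some coefficient sum. It is 1 because the whole face is itself a convex body. -/
theorem HasEuler.closedFace_affinePieces {Δ : T.Facet}
    (hPL : IsPL (T.simplex Δ) (fun x => h (T.toSpace Δ x))) {s : Finset (Fin m)}
    (hs : s ⊆ T.verts Δ) (hne : s.Nonempty) :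
    HasEuler (affinePieces h Δ) ((closedFace s).indicator 1) 1 := by
  obtain ⟨C, hC, hpoly, hcov, haff⟩ := hPL
  have hsub : closedFace s ⊆ T.simplex Δ := fun x hx =>
    ⟨hx.1, hx.2.1, fun v hv => hx.2.2 v fun h => hv (hs h)⟩
  have hbody := closedFace_mem_convexBodies hne
  have hP : ∀ P ∈ C, _root_.IsClosed P ∧ Convex ℝ P := fun P hP => by
    obtain ⟨A, rfl⟩ := hpoly P hP
    have : {x : Fin m → ℝ | ∀ a ∈ A, 0 ≤ a x} = ⋂ a ∈ A, (a : (Fin m → ℝ) →ᵃ[ℝ] ℝ) ⁻¹' Set.Ici 0 := by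
      ext x
      simp
    rw [this]
    exact ⟨isClosed_biInter fun a _ => isClosed_Ici.preimage a.continuous_of_finiteDimensional,
      convex_iInter₂ fun a _ => (convex_Ici 0).affine_preimage a⟩
  obtain ⟨c, hc⟩ := HasEuler.exists_inter (𝒦 := affinePieces h Δ) hC (closedFace s)
    fun D hD hD0 hDne => by
      refine ⟨⟨hbody.1.inter_right (isClosed_sInter fun P h => (hP P (hD h)).1),
        hbody.2.1.inter (convex_sInter fun P h => (hP P (hD h)).2), hDne⟩, ?_⟩
      obtain ⟨P, hPD⟩ := hD0
      obtain ⟨A, hA⟩ := haff P (hD hPD)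
      exact ⟨A, fun x hx => ⟨hsub hx.1, hA ⟨x, hsub hx.1⟩ (hx.2 P hPD)⟩⟩
  rw [Set.inter_eq_left.2 (hsub.trans hcov)] at hc
  convert hc
  exact (HasEuler.single hbody).unique (hc.mono fun K hK => hK.1)

/-- The number of points above `y` in the open face `s` of `Δ` is a combination of indicators. -/
theorem HasEuler.openFace_push (hT : T.IsValid) (hh : Function.Injective h)
    (hPL : ∀ Δ, IsPL (T.simplex Δ) (fun x => h (T.toSpace Δ x))) {k : ℕ} (p : T.PreFace k) :
    HasEuler (convexBodies (Fin n → ℝ)) (fun y => ∑ᶠ x ∈ {x | ∃ hx, h (T.toSpace p.1.1 ⟨x, hx⟩) = y},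
      (openFace p.1.2).indicator (1 : (Fin m → ℝ) → ℤ) x) ((-1) ^ k) := by
  have hk : p.1.2.card - 1 = k := by rw [p.2.2, Nat.add_sub_cancel]
  have := HasEuler.push hT hh (HasEuler.openFace p.1.2
    (Finset.card_pos.1 (by rw [p.2.2]; omega)) fun t ht hne =>
      HasEuler.closedFace_affinePieces (hPL p.1.1) (ht.trans p.2.1) hne)
  rwa [hk] at this

instance {L : Type} [Fintype L] [DecidableEq L] (T : GenTriangulation L) (k : ℕ) :
    Finite (T.Face k) := by
  have := T.finite_facet
  have : Finite (T.PreFace k) := by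
    unfold PreFace
    infer_instance
  exact inferInstanceAs (Finite (Quot _))

/-- Choose one occurrence of each face and push its open face forward along `h`. Every point of the
space lies over exactly one open face, exactly once, so the sum is the indicator of the sphere.
Comparing coefficient sums gives the formula. -/
theorem IsPLSphere.eulerChar_eq (hT : T.IsValid) {d k : ℕ} (hd : T.HasDim d)
    (hS : T.IsPLSphere k) : T.eulerChar d = 1 + (-1) ^ k := by
  classical
  obtain ⟨h, hh, hrange, hPL⟩ := hS
  have : ∀ k, Fintype (T.Face k) := fun k => Fintype.ofFinite _
  let rep : ∀ {k}, T.Face k → T.PreFace k := fun φ => φ.exists_rep.choose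
  have hrep : ∀ {k} (φ : T.Face k), Quot.mk (PreFace.Step T k) (rep φ) = φ :=
    fun φ => φ.exists_rep.choose_spec
  have hne : ∀ {k} (p : T.PreFace k), p.1.2.Nonempty := fun p =>
    Finset.card_pos.1 (by rw [p.2.2]; omega)
  have key := HasEuler.sum Finset.univ fun (φ : Σ k : Fin (d + 1), T.Face k) _ =>
    HasEuler.openFace_push hT hh hPL (rep φ.2)
  have hc : ∑ φ : Σ k : Fin (d + 1), T.Face k, (-1 : ℤ) ^ (φ.1 : ℕ) = T.eulerChar d := by
    rw [Fintype.sum_sigma, eulerChar, Finset.sum_range]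
    refine Finset.sum_congr rfl fun k _ => ?_
    simp [f, mul_comm]
  rw [hc] at key
  refine key.unique ?_
  convert HasEuler.stdPLSphere k using 1
  ext y
  rw [Finset.sum_apply, ← hrange]
  by_cases hy : y ∈ Set.range h
  · rw [Set.indicator_of_mem hy]
    obtain ⟨p, rfl⟩ := hy
    revert p
    refine space_ind fun Δ x => ?_
    have hsub : coordSupport x.1 ⊆ T.verts Δ := (mem_closedFace_iff.1 x.2).2.2
    have hx0 := coordSupport_nonempty x.2
    -- The only nonzero term belongs to the class of the support of `x`.
    refine (@Fintype.sum_eq_single (Σ k : Fin (d + 1), T.Face k) _ _ _ _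
      (anyFace hd Δ _ hsub hx0) ?_).trans ?_
    rotate_left
    · obtain ⟨z, hz, he⟩ := exists_toSpace_eq (hrep (anyFace hd Δ _ hsub hx0).2).symm x rfl
      rw [finsum_mem_single (a := z.1)]
      · exact Set.indicator_of_mem (mem_openFace_iff.2 ⟨z.2.1, z.2.2.1, hz⟩) _
      · exact ⟨z.2, congrArg h he⟩
      · rintro w ⟨hw, e⟩ hwz
        refine Set.indicator_of_notMem (fun hw' => hwz ?_) _
        exact congrArg Subtype.val (hT.toSpace_injective ((hh e).trans he.symm)
          (hw'.2.trans hz.symm))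
    · rintro φ hφ
      refine finsum_mem_eq_zero_of_forall_eq_zero ?_
      rintro w ⟨hw, e⟩
      refine Set.indicator_of_notMem (fun hw' => hφ ?_) _
      have hs : coordSupport w = (rep φ.2).1.2 := hw'.2
      have h1 := anyFace_eq_of_toSpace_eq hd (hh e) (hs ▸ (rep φ.2).2.1) (hs ▸ hne _) hsub hx0
      rw [← h1]
      have h2 := anyFace_eq hd (rep φ.2) (hne _) φ.1.2
      rw [hrep] at h2
      refine h2.symm.trans ?_
      simp only [hs]
  · rw [Set.indicator_of_notMem hy]
    refine Finset.sum_eq_zero fun φ _ => finsum_mem_eq_zero_of_forall_eq_zero ?_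
    rintro x ⟨hx, e⟩
    exact absurd ⟨_, e⟩ hy

end Valuation

end GenTriangulation

/-! ### Searching for components -/

namespace Component

/-- The number whose binary digits indicate the members of a list. -/
def bits (l : List ℕ) : ℕ := l.foldr (fun x B => B ||| 1 <<< x) 0

/-- Membership in a list of numbers. -/
def mem (x : ℕ) (l : List ℕ) : Bool := (bits l).testBit x

theorem mem_iff {x : ℕ} {l : List ℕ} : mem x l = true ↔ x ∈ l := by
  rw [mem]
  induction l with
  | nil => simp [bits]
  | cons y l ih =>
    rw [List.mem_cons, ← ih, bits, List.foldr_cons, Nat.testBit_or, Nat.one_shiftLeft,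
      Nat.testBit_two_pow, Bool.or_eq_true, decide_eq_true_iff, or_comm, eq_comm]
    rfl

/-- `x :: l`, where `x` is evaluated. -/
def cons (x : ℕ) (l : List ℕ) : List ℕ :=
  match x with
  | 0 => 0 :: l
  | y + 1 => (y + 1) :: l

theorem cons_eq (x : ℕ) (l : List ℕ) : cons x l = x :: l := by
  cases x <;> rfl

/-- Depth first search, with the stack `st`, the list `vis` of visited vertices, and the number `B`
whose binary digits indicate them; it ends when a vertex smaller than `x₀` is found. -/
def grow (nbrs : ℕ → List ℕ) (x₀ : ℕ) : ℕ → List ℕ → List ℕ → ℕ → List ℕ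
  | 0, _, vis, _ => vis
  | _ + 1, [], vis, _ => vis
  | n + 1, x :: st, vis, B =>
    bif B.testBit x then grow nbrs x₀ n st vis B
    else bif Nat.blt x x₀ then x :: vis
    else grow nbrs x₀ n (nbrs x ++ st) (x :: vis) (B ||| 1 <<< x)

/-- A list of vertices contains all their neighbours. -/
def closed (nbrs : ℕ → List ℕ) (V : List ℕ) : Bool := V.all fun y => (nbrs y).all (mem · V)

/-- The verdict that `V` allows on whether `x` is the least vertex of its component. -/
def judge (nbrs : ℕ → List ℕ) (x : ℕ) (V : List ℕ) : ℕ :=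
  bif V.any (Nat.blt · x) then 0 else bif mem x V && closed nbrs V then 1 else 1000000

/-- `1` if `x` is the least vertex of its component, `0` if it is not, `1000000` if the search
was too short to decide. -/
def verdict (nbrs : ℕ → List ℕ) (x : ℕ) : ℕ := judge nbrs x (grow nbrs x 5000 [x] [] 0)

/-- The vertices of the component of `x`. -/
def component (nbrs : ℕ → List ℕ) (x : ℕ) : List ℕ := grow nbrs 0 5000 [x] [] 0

/-- Nothing is assumed about the bit mask or the bound on the number of rounds: this only shows that
what is found belongs to the component. That nothing is missed is tested afterwards by `closed`. -/
theorem grow_sound {nbrs : ℕ → List ℕ} {p : ℕ → Prop} (hp : ∀ x, p x → ∀ y ∈ nbrs x, p y) (x₀ n : ℕ)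
    (st vis : List ℕ) (B : ℕ) (hst : ∀ x ∈ st, p x) (hvis : ∀ x ∈ vis, p x) :
    ∀ x ∈ grow nbrs x₀ n st vis B, p x := by
  induction n generalizing st vis B with
  | zero => exact hvis
  | succ n ih =>
    match st, hst with
    | [], _ => exact hvis
    | x :: st, hst =>
      have hx := hst x List.mem_cons_self
      have hst' : ∀ y ∈ st, p y := fun y hy => hst y (List.mem_cons_of_mem _ hy)
      have hvis' : ∀ y ∈ x :: vis, p y := List.forall_mem_cons.2 ⟨hx, hvis⟩
      unfold grow
      cases B.testBit x
      · cases Nat.blt x x₀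
        · exact ih _ _ _ (fun y hy => (List.mem_append.1 hy).elim (hp x hx y) (hst' y)) hvis'
        · exact hvis'
      · exact ih _ _ _ hst' hvis

/-- An inconclusive search contributes more than the whole sum, so a small sum certifies all
searches. -/
theorem verdict_le_one {nbrs : ℕ → List ℕ} {codes : List ℕ} {n : ℕ} (hn : n < 1000000)
    (h : (codes.map (verdict nbrs)).sum = n) {x : ℕ} (hx : x ∈ codes) : verdict nbrs x ≤ 1 := by
  have h1 : verdict nbrs x ≤ n := h ▸ List.le_sum_of_mem (List.mem_map_of_mem hx)
  have h2 : verdict nbrs x = 0 ∨ verdict nbrs x = 1 ∨ verdict nbrs x = 1000000 := by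
    rw [verdict, judge]
    cases (grow nbrs x 5000 [x] [] 0).any (Nat.blt · x) <;>
      cases mem x (grow nbrs x 5000 [x] [] 0) && closed nbrs (grow nbrs x 5000 [x] [] 0) <;> simp
  omega

section

variable {α : Type*} {r : α → α → Prop} (enc : α → ℕ) {nbrs : ℕ → List ℕ}

/-- The function `enc` identifies the graph of the relation `r` with a part of the graph `nbrs`. -/
structure Encodes (r : α → α → Prop) (enc : α → ℕ) (nbrs : ℕ → List ℕ) : Prop where
  symm : ∀ a b, r a b → r b a
  inj : Function.Injective enc
  mem_nbrs : ∀ a b, r a b → enc b ∈ nbrs (enc a)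
  exists_of_mem : ∀ a, ∀ y ∈ nbrs (enc a), ∃ b, r a b ∧ enc b = y

variable {enc} (H : Encodes r enc nbrs)
include H

theorem Encodes.mem_of_closed {V : List ℕ} (hV : closed nbrs V = true) {a b : α}
    (ha : enc a ∈ V) (h : Quot.mk r a = Quot.mk r b) : enc b ∈ V := by
  replace h := GenTriangulation.reflTransGen_of_eqvGen H.symm (Quot.eqvGen_exact h)
  induction h with
  | refl => exact ha
  | tail _ h ih =>
    have := List.all_eq_true.1 (List.all_eq_true.1 hV _ ih) _ (H.mem_nbrs _ _ h)
    exact mem_iff.1 this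

theorem Encodes.exists_of_mem_grow (a : α) (x₀ n : ℕ) :
    ∀ y ∈ grow nbrs x₀ n [enc a] [] 0, ∃ b, Quot.mk r b = Quot.mk r a ∧ enc b = y := by
  refine grow_sound ?_ _ _ _ _ _ ?_ ?_
  · rintro _ ⟨b, hb, rfl⟩ y hy
    obtain ⟨c, hc, rfl⟩ := H.exists_of_mem b y hy
    exact ⟨c, (Quot.sound hc).symm.trans hb, rfl⟩
  · intro y hy
    rw [List.mem_singleton] at hy
    exact ⟨a, rfl, hy.symm⟩
  · simp

theorem Encodes.mk_eq_iff {a b : α}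
    (h : (mem (enc a) (component nbrs (enc a)) && closed nbrs (component nbrs (enc a))) = true) :
    Quot.mk r b = Quot.mk r a ↔ enc b ∈ component nbrs (enc a) := by
  rw [Bool.and_eq_true, mem_iff] at h
  constructor
  · exact fun e => H.mem_of_closed h.2 h.1 e.symm
  · intro hb
    obtain ⟨c, hc, e⟩ := H.exists_of_mem_grow a _ _ _ hb
    rw [← H.inj e, hc]

theorem Encodes.le_of_verdict {a b : α} (h : verdict nbrs (enc a) = 1)
    (e : Quot.mk r a = Quot.mk r b) : enc a ≤ enc b := by
  rw [verdict, judge] at h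
  cases h1 : (grow nbrs (enc a) 5000 [enc a] [] 0).any (Nat.blt · (enc a))
  · rw [h1, cond_false] at h
    cases h2 : mem (enc a) (grow nbrs (enc a) 5000 [enc a] [] 0) &&
      closed nbrs (grow nbrs (enc a) 5000 [enc a] [] 0)
    · simp [h2] at h
    · rw [Bool.and_eq_true, mem_iff] at h2
      have := H.mem_of_closed h2.2 h2.1 e
      have := List.any_eq_false.1 h1 _ this
      simpa [Nat.blt_eq] using this
  · simp [h1] at h

theorem Encodes.exists_lt {a : α} (h : verdict nbrs (enc a) = 0) :
    ∃ b, Quot.mk r b = Quot.mk r a ∧ enc b < enc a := by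
  rw [verdict, judge] at h
  cases h1 : (grow nbrs (enc a) 5000 [enc a] [] 0).any (Nat.blt · (enc a))
  · rw [h1, cond_false] at h
    cases h2 : mem (enc a) (grow nbrs (enc a) 5000 [enc a] [] 0) &&
      closed nbrs (grow nbrs (enc a) 5000 [enc a] [] 0) <;> simp [h2] at h
  · obtain ⟨y, hy, hlt⟩ := List.any_eq_true.1 h1
    obtain ⟨b, hb, rfl⟩ := H.exists_of_mem_grow a _ _ y hy
    exact ⟨b, hb, by simpa [Nat.blt_eq] using hlt⟩

/-- Every class has a representative which is least, if the search was long enough. -/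
theorem Encodes.exists_root {codes : List ℕ} (hcodes : ∀ a, enc a ∈ codes)
    (h : ∀ x ∈ codes, verdict nbrs x ≤ 1) (φ : Quot r) :
    ∃ a, Quot.mk r a = φ ∧ verdict nbrs (enc a) = 1 := by
  induction φ using Quot.ind with
  | mk a =>
    generalize hn : enc a = n
    induction n using Nat.strong_induction_on generalizing a with
    | _ n ih =>
      subst hn
      rcases Nat.le_one_iff_eq_zero_or_eq_one.1 (h _ (hcodes a)) with h0 | h1
      · obtain ⟨b, hb, hlt⟩ := H.exists_lt h0
        rw [← hb]
        exact ih _ hlt b rfl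
      · exact ⟨a, rfl, h1⟩

/-- The number of classes is the number of least vertices of components. -/
theorem Encodes.card_quot {codes : List ℕ} (hnd : codes.Nodup) (hcodes : ∀ x, x ∈ codes ↔ ∃ a, enc a = x)
    {n : ℕ} (hn : n < 1000000) (h : (codes.map (verdict nbrs)).sum = n) : Nat.card (Quot r) = n := by
  have hle := fun x hx => verdict_le_one hn h (x := x) hx
  have hsum : ∀ l : List ℕ, (∀ x ∈ l, verdict nbrs x ≤ 1) →
      (l.filter (fun x => verdict nbrs x = 1)).length = (l.map (verdict nbrs)).sum := by
    intro l hl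
    induction l with
    | nil => rfl
    | cons x l ih =>
      rw [List.forall_mem_cons] at hl
      rw [List.map_cons, List.sum_cons, ← ih hl.2, List.filter_cons]
      rcases Nat.le_one_iff_eq_zero_or_eq_one.1 hl.1 with h | h
      · simp [h]
      · simp [h, add_comm]
  rw [← h, ← hsum codes hle, ← List.toFinset_card_of_nodup (hnd.filter _), ← Nat.card_eq_finsetCard]
  have hroot : ∀ x ∈ (codes.filter (fun x => verdict nbrs x = 1)).toFinset,
      ∃ a, enc a = x ∧ verdict nbrs (enc a) = 1 := by
    intro x hx
    rw [List.mem_toFinset, List.mem_filter, hcodes, decide_eq_true_iff] at hx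
    obtain ⟨⟨a, rfl⟩, h⟩ := hx
    exact ⟨a, rfl, h⟩
  choose f hf1 hf2 using hroot
  refine (Nat.card_congr (Equiv.ofBijective (fun x => Quot.mk r (f x.1 x.2)) ⟨?_, ?_⟩)).symm
  · rintro ⟨x, hx⟩ ⟨y, hy⟩ (e : Quot.mk r (f x hx) = Quot.mk r (f y hy))
    have h1 := H.le_of_verdict (hf2 x hx) e
    have h2 := H.le_of_verdict (hf2 y hy) e.symm
    rw [hf1, hf1] at h1 h2
    exact Subtype.ext (le_antisymm h1 h2)
  · intro φ
    obtain ⟨a, rfl, ha⟩ := H.exists_root (fun a => (hcodes _).2 ⟨a, rfl⟩) hle φ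
    have hx : enc a ∈ (codes.filter (fun x => verdict nbrs x = 1)).toFinset := by
      rw [List.mem_toFinset, List.mem_filter]
      exact ⟨(hcodes _).2 ⟨a, rfl⟩, by simpa using ha⟩
    exact ⟨⟨_, hx⟩, congrArg _ (H.inj (hf1 _ hx))⟩

end

end Component

/-! ### Triangulations whose gluings preserve the order of the labels -/

namespace Ordered

/-- The map which takes `i` to `i'` and preserves the order of the other labels. -/
def shift (i i' v : Fin 5) : Fin 5 :=
  if v = i then i' else
    let a := if v < i then v.1 else v.1 - 1
    Fin.ofNat 5 (if a < i'.1 then a else a + 1)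

theorem shift_shift : ∀ i i' v, shift i' i (shift i i' v) = v := by decide +kernel

theorem shift_self : ∀ i i', shift i i' i = i' := by decide +kernel

theorem shift_lt : ∀ i i' v w, v ≠ i → w ≠ i → (shift i i' v < shift i i' w ↔ v < w) := by
  decide +kernel

/-- A pairing of the ridges of `N` facets: `code Δ i = 5 * Δ' + i'` if the ridge `i` of `Δ` is
glued to the ridge `i'` of `Δ'`. -/
structure Pairing where
  N : ℕ
  code : ℕ → ℕ → ℕ
  div_lt : ∀ Δ : Fin N, ∀ i : Fin 5, code Δ i / 5 < N
  invol : ∀ Δ : Fin N, ∀ i : Fin 5, code (code Δ i / 5) (code Δ i % 5) = 5 * Δ + i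
  ne : ∀ Δ : Fin N, ∀ i : Fin 5, code Δ i ≠ 5 * Δ + i

namespace Pairing

variable (P : Pairing)

/-- The facet glued to the ridge `i` of `Δ`. -/
def nbr (Δ : Fin P.N) (i : Fin 5) : Fin P.N := ⟨P.code Δ i / 5, P.div_lt Δ i⟩

/-- The ridge to which the ridge `i` of `Δ` is glued. -/
def opp (Δ : Fin P.N) (i : Fin 5) : Fin 5 := Fin.ofNat 5 (P.code Δ i)

theorem opp_val (Δ : Fin P.N) (i : Fin 5) : (P.opp Δ i).1 = P.code Δ i % 5 := rfl

theorem nbr_nbr (Δ : Fin P.N) (i : Fin 5) : P.nbr (P.nbr Δ i) (P.opp Δ i) = Δ := by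
  apply Fin.ext
  show P.code (P.code Δ i / 5) (P.code Δ i % 5) / 5 = _
  rw [P.invol]
  omega

theorem opp_opp (Δ : Fin P.N) (i : Fin 5) : P.opp (P.nbr Δ i) (P.opp Δ i) = i := by
  apply Fin.ext
  show P.code (P.code Δ i / 5) (P.code Δ i % 5) % 5 = _
  rw [P.invol]
  omega

/-- The vertex of the neighbour which is identified with `v`. -/
def act (Δ : Fin P.N) (i v : Fin 5) : Fin 5 := shift i (P.opp Δ i) v

/-- The triangulation with facets `Fin N` given by the pairing. -/
def T : GenTriangulation (Fin 5) :=
  GenTriangulation.ofMaps (fun _ => Finset.univ) P.nbr P.act fun Δ i _ => by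
    refine ⟨by simp, ?_, fun v => ?_, fun h => P.ne Δ i ?_⟩
    · rw [act, shift_self, nbr_nbr]
    · rw [act, act, act, shift_self, opp_opp, shift_shift]
    · rw [act, shift_self] at h
      have h1 : P.code Δ i / 5 = Δ := congrArg (fun p => p.1.1) h
      have h2 : P.code Δ i % 5 = i := congrArg (fun p => p.2.1) h
      omega

theorem glue_iff {Δ Δ' : Fin P.N} {i : Fin 5} {g : Equiv.Perm (Fin 5)} :
    P.T.glue Δ i Δ' g ↔ P.nbr Δ i = Δ' ∧ ∀ v, g v = shift i (P.opp Δ i) v :=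
  ⟨fun h => h.2, fun h => ⟨Finset.mem_univ _, h⟩⟩

theorem isClosed : P.T.IsClosed := GenTriangulation.ofMaps_isClosed _

theorem hasDim : P.T.HasDim 4 := fun _ => rfl

/-- Each gluing is increasing on the ridge, so a carried face is carried monotonically, and a
monotone bijection of a finite set of labels onto itself is the identity. -/
theorem isValid : P.T.IsValid := by
  have key : ∀ Δ s Δ' g, P.T.Carries Δ s Δ' g → StrictMonoOn g s := by
    intro Δ s Δ' g h
    induction h with
    | refl => exact fun v _ w _ h => h
    | step _ hg hi ih =>
      intro v hv w hw h
      have hg := (P.glue_iff.1 hg).2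
      rw [Equiv.Perm.mul_apply, Equiv.Perm.mul_apply, hg, hg, shift_lt _ _ _ _ ?_ ?_]
      · exact ih hv hw h
      all_goals
        rintro rfl
        exact hi (Finset.mem_map_of_mem _ ‹_›)
  intro Δ s _ g hc hs v hv
  have hmono := key _ _ _ _ hc
  have hmaps : ∀ v ∈ s, g v ∈ s := fun v hv => by
    rw [← hs]
    exact Finset.mem_map_of_mem _ hv
  let φ : s → s := fun v => ⟨g v, hmaps v v.2⟩
  have hφ : StrictMono φ := fun v w h => hmono v.2 w.2 h
  have : φ = id := by
    have hr : Set.range φ = Set.range (id : s → s) := by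
      rw [Set.range_id, Set.range_eq_univ]
      exact Finite.surjective_of_injective hφ.injective
    exact (StrictMono.range_inj hφ strictMono_id).1 hr
  exact congrArg Subtype.val (congrFun this ⟨v, hv⟩)

theorem exists_glue (Δ : Fin P.N) (i : Fin 5) : ∃ g : Equiv.Perm (Fin 5),
    P.T.glue Δ i (P.nbr Δ i) g ∧ ∀ v, g v = shift i (P.opp Δ i) v := by
  obtain ⟨Δ', g, h⟩ := P.isClosed Δ i (Finset.mem_univ _)
  obtain ⟨rfl, hg⟩ := P.glue_iff.1 h
  exact ⟨g, h, hg⟩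

/-- Descending to a smaller neighbour leads from every facet to the facet `0`. -/
theorem facetConnected (h : ∀ Δ : Fin P.N, Δ.1 = 0 ∨ ∃ i, P.nbr Δ i < Δ) :
    P.T.FacetConnected := by
  have hsymm : Std.Symm P.T.Adj := ⟨fun _ _ h => h.symm⟩
  have key : ∀ n (hn : n < P.N), Relation.ReflTransGen P.T.Adj (⟨n, hn⟩ : Fin P.N)
      (⟨0, by omega⟩ : Fin P.N) := by
    intro n
    induction n using Nat.strong_induction_on with
    | _ n ih =>
      intro hn
      rcases h ⟨n, hn⟩ with h | ⟨i, hi⟩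
      · obtain rfl : n = 0 := h
        exact .refl
      · obtain ⟨g, hg, -⟩ := P.exists_glue ⟨n, hn⟩ i
        exact .head ⟨i, g, hg⟩ (ih _ hi _)
  intro Δ Δ'
  exact (key Δ.1 Δ.2).trans (Relation.ReflTransGen.stdSymm.symm _ _ (key Δ'.1 Δ'.2))

theorem isPseudomanifold [NeZero P.N] (h : ∀ Δ : Fin P.N, Δ.1 = 0 ∨ ∃ i, P.nbr Δ i < Δ) :
    P.T.IsPseudomanifold 4 :=
  have : Nonempty P.T.Facet := ⟨(0 : Fin P.N)⟩
  ⟨P.hasDim, P.isClosed, (P.facetConnected h).connectedSpace P.hasDim (by norm_num), P.isValid⟩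

theorem isNonsingular [NeZero P.N] (h : ∀ Δ : Fin P.N, Δ.1 = 0 ∨ ∃ i, P.nbr Δ i < Δ) :
    P.T.IsNonsingular 4 2 :=
  ⟨P.isPseudomanifold h, GenTriangulation.link_isPLSphere_one P.hasDim P.isClosed rfl⟩

/-- A 4-face has all five labels, so no gluing step applies to it and the classes are single facets.
-/
theorem f_four : P.T.f 4 = P.N := by
  have huniv : ∀ p : P.T.PreFace 4, p.1.2 = Finset.univ := fun p =>
    Finset.eq_univ_of_card _ (by rw [p.2.2]; rfl)
  have : Nat.card (P.T.Face 4) = Nat.card (Fin P.N) := by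
    refine Nat.card_congr (Equiv.ofBijective (Quot.lift (fun p => p.1.1) ?_) ⟨?_, ?_⟩)
    · rintro p q ⟨i, g, -, hi, -⟩
      exact absurd (huniv p ▸ Finset.mem_univ i) hi
    · rintro ⟨p⟩ ⟨q⟩ (h : p.1.1 = q.1.1)
      exact congrArg _ (Subtype.ext (Prod.ext h ((huniv p).trans (huniv q).symm)))
    · intro Δ
      exact ⟨Quot.mk _ ⟨(Δ, Finset.univ), Finset.subset_univ _, rfl⟩, rfl⟩
  rw [GenTriangulation.f, this, Nat.card_fin]

theorem dualGraphLoopless (h : ∀ Δ i, P.nbr Δ i ≠ Δ) : P.T.DualGraphLoopless := by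
  intro Δ i Δ' g hg
  rw [← (P.glue_iff.1 hg).1]
  exact h Δ i

end Pairing

/-! ### Numbering the faces and the faces of the links -/

/-- The number with the ternary digits `c`. -/
def ternary (c : Fin 5 → ℕ) : ℕ := c 0 + 3 * c 1 + 9 * c 2 + 27 * c 3 + 81 * c 4

/-- A digit. -/
def digit (x v : ℕ) : ℕ := x / 3 ^ v % 3

/-- The effect of a gluing of the ridges `i` and `i'` on the number of a colouring of the vertices. -/
def slide (x i i' : ℕ) : ℕ :=
  let r := x % 3 ^ i + x / 3 ^ (i + 1) * 3 ^ i
  r % 3 ^ i' + r / 3 ^ i' * 3 ^ (i' + 1)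

/-- The colours of the vertices of two disjoint faces. -/
def colour (S s : Finset (Fin 5)) (v : Fin 5) : ℕ := if v ∈ S then 1 else if v ∈ s then 2 else 0

/-- The number of a pair of disjoint faces of a facet. -/
def number (Δ : ℕ) (S s : Finset (Fin 5)) : ℕ := Δ * 243 + ternary (colour S s)

theorem ternary_lt {c : Fin 5 → ℕ} (h : ∀ v, c v < 3) : ternary c < 243 := by
  have h0 := h 0
  have h1 := h 1
  have h2 := h 2
  have h3 := h 3
  have h4 := h 4
  unfold ternary
  omega

theorem colour_lt (S s : Finset (Fin 5)) (v : Fin 5) : colour S s v < 3 := by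
  unfold colour
  split_ifs <;> omega

theorem number_div (Δ : ℕ) (S s : Finset (Fin 5)) : number Δ S s / 243 = Δ := by
  have := ternary_lt (colour_lt S s)
  unfold number
  omega

theorem number_mod (Δ : ℕ) (S s : Finset (Fin 5)) : number Δ S s % 243 = ternary (colour S s) := by
  have := ternary_lt (colour_lt S s)
  unfold number
  omega

theorem digit_ternary {c : Fin 5 → ℕ} (h : ∀ v, c v < 3) (v : Fin 5) :
    digit (ternary c) v = c v := by
  have h0 := h 0
  have h1 := h 1
  have h2 := h 2
  have h3 := h 3
  have h4 := h 4
  unfold digit ternary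
  fin_cases v <;> simp <;> omega

theorem ternary_digit : ∀ x < 243, ternary (fun v => digit x v) = x := by decide +kernel

/-- Arithmetically, an order-preserving gluing deletes the zero digit at `i` and inserts a zero at
`i'`. -/
theorem slide_ternary_aux : ∀ (i i' : Fin 5) (x : Fin 243), digit x i = 0 →
    ternary (fun v => digit x (shift i' i v)) = slide x i i' := by
  decide +kernel

theorem slide_ternary {c c' : Fin 5 → ℕ} (h : ∀ v, c v < 3) {i i' : Fin 5} (hi : c i = 0)
    (h' : ∀ v, c' (shift i i' v) = c v) : ternary c' = slide (ternary c) i i' := by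
  rw [← slide_ternary_aux i i' ⟨_, ternary_lt h⟩ (by rw [digit_ternary h, hi])]
  congr 1
  ext v
  rw [digit_ternary h, ← h', shift_shift]

namespace Pairing

variable (P : Pairing)

/-- The number of the pair of faces to which a pair is carried by the gluing of the ridge `i`. -/
def move (x i : ℕ) : ℕ :=
  P.code (x / 243) i / 5 * 243 + slide (x % 243) i (P.code (x / 243) i % 5)

/-- The numbers of the pairs of faces to which a pair is carried by a single gluing. -/
def nbrsFrom (x : ℕ) : List ℕ → List ℕ
  | [] => []
  | i :: l => bif Nat.beq (digit (x % 243) i) 0 then Component.cons (P.move x i) (nbrsFrom x l)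
    else nbrsFrom x l

/-- The numbers of the pairs of faces to which a pair is carried by a single gluing. -/
def nbrs (x : ℕ) : List ℕ := P.nbrsFrom x [0, 1, 2, 3, 4]

theorem mem_nbrs {x y : ℕ} :
    y ∈ P.nbrs x ↔ ∃ i : Fin 5, digit (x % 243) i = 0 ∧ y = P.move x i := by
  have : ∀ l, y ∈ P.nbrsFrom x l ↔ ∃ i ∈ l, digit (x % 243) i = 0 ∧ y = P.move x i := by
    intro l
    induction l with
    | nil => simp [nbrsFrom]
    | cons i l ih =>
      simp only [nbrsFrom, List.mem_cons, or_and_right, exists_or, exists_eq_left, ← ih,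
        Component.cons_eq]
      cases h : Nat.beq (digit (x % 243) i) 0
      · simp [Nat.ne_of_beq_eq_false h]
      · rw [Nat.beq_eq] at h
        simp [h]
  rw [nbrs, this]
  constructor
  · rintro ⟨i, hi, h⟩
    simp only [List.mem_cons, List.not_mem_nil, or_false] at hi
    exact ⟨⟨i, by omega⟩, h⟩
  · rintro ⟨i, h⟩
    refine ⟨i, ?_, h⟩
    simp only [List.mem_cons, List.not_mem_nil, or_false]
    omega

end Pairing

open GenTriangulation Component

namespace Pairing

variable (P : Pairing)

theorem number_map {Δ Δ' : Fin P.N} {i : Fin 5} {g : Equiv.Perm (Fin 5)} (h : P.T.glue Δ i Δ' g)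
    {S s : Finset (Fin 5)} (hS : i ∉ S) (hs : i ∉ s) :
    number Δ' (S.map g.toEmbedding) (s.map g.toEmbedding) = P.move (number Δ S s) i := by
  obtain ⟨rfl, hg⟩ := P.glue_iff.1 h
  have := slide_ternary (c' := colour (S.map g.toEmbedding) (s.map g.toEmbedding))
    (colour_lt S s) (i := i) (i' := P.opp Δ i) (by simp [colour, hS, hs]) fun v => by
      rw [← hg]
      simp [colour]
  rw [move, number_div, number_mod, ← P.opp_val, ← this]
  rfl

end Pairing

theorem digit_number (Δ : ℕ) (S s : Finset (Fin 5)) (v : Fin 5) :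
    digit (number Δ S s % 243) v = colour S s v := by
  rw [number_mod, digit_ternary (colour_lt S s)]

theorem colour_eq_zero {S s : Finset (Fin 5)} {v : Fin 5} : colour S s v = 0 ↔ v ∉ S ∧ v ∉ s := by
  unfold colour
  split_ifs <;> simp_all

theorem colour_eq_one {S s : Finset (Fin 5)} {v : Fin 5} : colour S s v = 1 ↔ v ∈ S := by
  unfold colour
  split_ifs <;> simp_all

theorem colour_eq_two {S s : Finset (Fin 5)} {v : Fin 5} : colour S s v = 2 ↔ v ∉ S ∧ v ∈ s := by
  unfold colour
  split_ifs <;> simp_all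

theorem number_inj {Δ Δ' : ℕ} {S s S' s' : Finset (Fin 5)} (h : Disjoint S s) (h' : Disjoint S' s')
    (e : number Δ S s = number Δ' S' s') : Δ = Δ' ∧ S = S' ∧ s = s' := by
  have hc : ∀ v, colour S s v = colour S' s' v := fun v => by
    rw [← digit_number Δ, e, digit_number]
  refine ⟨by rw [← number_div Δ S s, e, number_div], ?_, ?_⟩
  · ext v
    rw [← colour_eq_one (s := s), hc, colour_eq_one]
  · ext v
    have h1 := colour_eq_two (S := S) (s := s) (v := v)
    rw [hc, colour_eq_two] at h1
    have h2 : v ∈ s → v ∉ S := fun hs hS => Finset.disjoint_left.1 h hS hs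
    have h3 : v ∈ s' → v ∉ S' := fun hs hS => Finset.disjoint_left.1 h' hS hs
    tauto

/-- The vertices of a given colour. -/
def colourClass (x d : ℕ) : Finset (Fin 5) := Finset.univ.filter fun v => digit x v = d

/-- The numbers of the colourings with `a` vertices of colour `1` and `b` of colour `2`. -/
def colourings (a b : ℕ) : List ℕ :=
  (List.range 243).filter fun x =>
    Nat.beq (colourClass x 1).card a && Nat.beq (colourClass x 2).card b

/-- The numbers of the pairs of faces with `a` and `b` vertices. -/
def codes (N a b : ℕ) : List ℕ :=
  (List.range N ×ˢ colourings a b).map fun p => p.1 * 243 + p.2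

theorem mem_codes {N a b x : ℕ} : x ∈ codes N a b ↔ ∃ Δ < N, ∃ S s : Finset (Fin 5),
    Disjoint S s ∧ S.card = a ∧ s.card = b ∧ number Δ S s = x := by
  simp only [codes, colourings, List.mem_map, Prod.exists, List.mem_product, List.mem_range,
    List.mem_filter, Bool.and_eq_true, Nat.beq_eq]
  constructor
  · rintro ⟨Δ, y, ⟨hΔ, hy, ha, hb⟩, rfl⟩
    refine ⟨Δ, hΔ, colourClass y 1, colourClass y 2, ?_, ha, hb, ?_⟩
    · rw [Finset.disjoint_left]
      intro v h1 h2
      simp only [colourClass, Finset.mem_filter] at h1 h2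
      omega
    · rw [number]
      congr 1
      refine Eq.trans ?_ (ternary_digit y hy)
      congr 1
      ext v
      have : digit y v < 3 := Nat.mod_lt _ (by norm_num)
      simp only [colour, colourClass, Finset.mem_filter, Finset.mem_univ, true_and]
      split_ifs <;> omega
  · rintro ⟨Δ, hΔ, S, s, hd, rfl, rfl, rfl⟩
    refine ⟨Δ, ternary (colour S s), ⟨hΔ, ternary_lt (colour_lt S s), ?_, ?_⟩, rfl⟩
    · congr 1
      ext v
      simp [colourClass, digit_ternary (colour_lt S s), colour_eq_one]
    · congr 1
      ext v
      simp only [colourClass, digit_ternary (colour_lt S s), colour_eq_two, Finset.mem_filter,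
        Finset.mem_univ, true_and]
      exact ⟨fun h => h.2, fun h => ⟨fun h' => Finset.disjoint_left.1 hd h' h, h⟩⟩

theorem nodup_codes (N a b : ℕ) : (codes N a b).Nodup := by
  refine List.Nodup.map_on ?_ (List.nodup_range.product (List.nodup_range.filter _))
  rintro ⟨x, y⟩ h ⟨x', y'⟩ h' e
  simp only [colourings, List.mem_product, List.mem_filter, List.mem_range] at h h'
  have : x * 243 + y = x' * 243 + y' := e
  have h1 : x = x' := by omega
  rw [Prod.mk.injEq]
  omega

/-- The number of the first of two faces. -/
def firstFace (x : ℕ) : ℕ := x / 243 * 243 + ternary fun v => digit (x % 243) v % 2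

theorem firstFace_number (Δ : ℕ) (S s : Finset (Fin 5)) :
    firstFace (number Δ S s) = number Δ S ∅ := by
  rw [firstFace, number_div]
  simp only [digit_number]
  rw [number]
  congr 2
  ext v
  unfold colour
  split_ifs <;> simp_all

/-- The codes of the pairs of faces the first of which belongs to `V`. -/
def linkCodes (V : List ℕ) (N a b : ℕ) : List ℕ := (codes N a b).filter fun x => mem (firstFace x) V

namespace Pairing

variable (P : Pairing)

/-- The number of a facet. -/
def index (Δ : P.T.Facet) : ℕ := Fin.val (n := P.N) Δ

theorem index_lt (Δ : P.T.Facet) : P.index Δ < P.N := Fin.isLt (n := P.N) Δ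

theorem index_inj {Δ Δ' : P.T.Facet} (h : P.index Δ = P.index Δ') : Δ = Δ' := Fin.ext (n := P.N) h

/-- The number of a face of a facet. -/
def faceNumber {k : ℕ} (p : P.T.PreFace k) : ℕ := number (P.index p.1.1) p.1.2 ∅

theorem encodes_faceNumber (k : ℕ) : Encodes (PreFace.Step P.T k) P.faceNumber P.nbrs where
  symm _ _ h := h.symm
  inj p q h := by
    obtain ⟨h1, h2, -⟩ := number_inj (Finset.disjoint_empty_right _) (Finset.disjoint_empty_right _) h
    exact Subtype.ext (Prod.ext (P.index_inj h1) h2)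
  mem_nbrs p q h := by
    obtain ⟨i, g, hg, hi, hs⟩ := h
    have := P.number_map hg hi (Finset.notMem_empty i)
    rw [Finset.map_empty, ← hs] at this
    refine P.mem_nbrs.2 ⟨i, ?_, this⟩
    rw [faceNumber, digit_number, colour_eq_zero]
    exact ⟨hi, Finset.notMem_empty i⟩
  exists_of_mem p y hy := by
    obtain ⟨i, hi, rfl⟩ := P.mem_nbrs.1 hy
    rw [faceNumber, digit_number, colour_eq_zero] at hi
    obtain ⟨g, hg, -⟩ := P.exists_glue p.1.1 i
    refine ⟨p.move hg, p.step_move hg hi.1, ?_⟩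
    have := P.number_map hg hi.1 hi.2
    rwa [Finset.map_empty] at this

theorem mem_codes_iff_faceNumber {k x : ℕ} :
    x ∈ codes P.N (k + 1) 0 ↔ ∃ p : P.T.PreFace k, P.faceNumber p = x := by
  rw [mem_codes]
  constructor
  · rintro ⟨Δ, hΔ, S, s, -, hS, hs, rfl⟩
    rw [Finset.card_eq_zero] at hs
    subst hs
    exact ⟨⟨((⟨Δ, hΔ⟩ : Fin P.N), S), Finset.subset_univ _, hS⟩, rfl⟩
  · rintro ⟨p, rfl⟩
    exact ⟨_, P.index_lt p.1.1, p.1.2, ∅, Finset.disjoint_empty_right _, p.2.2, rfl, rfl⟩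

/-- The number of `k`-faces. -/
theorem f_eq {k n : ℕ} (hn : n < 1000000)
    (h : ((codes P.N (k + 1) 0).map (verdict P.nbrs)).sum = n) : P.T.f k = n :=
  (P.encodes_faceNumber k).card_quot (nodup_codes _ _ _) (fun _ => P.mem_codes_iff_faceNumber) hn h

/-- The faces are represented by those of least number. -/
theorem exists_root {k n : ℕ} (hn : n < 1000000)
    (h : ((codes P.N (k + 1) 0).map (verdict P.nbrs)).sum = n) (φ : P.T.Face k) :
    ∃ p, Quot.mk _ p = φ ∧ verdict P.nbrs (P.faceNumber p) = 1 :=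
  (P.encodes_faceNumber k).exists_root (fun p => P.mem_codes_iff_faceNumber.2 ⟨p, rfl⟩)
    (fun _ => verdict_le_one hn h) φ

/-- The component of a face is large enough. -/
def componentCheck (x : ℕ) (V : List ℕ) : Bool := mem x V && closed P.nbrs V

variable {k : ℕ} {σ : P.T.Face k}

/-- The number of a face of a simplex of the link. -/
def linkNumber {j : ℕ} (a : (P.T.link σ).PreFace j) : ℕ :=
  number (P.index a.1.1.1.1.1) a.1.1.1.1.2 a.1.2

theorem firstFace_linkNumber {j : ℕ} (a : (P.T.link σ).PreFace j) :
    firstFace (P.linkNumber a) = P.faceNumber a.1.1.1 := firstFace_number _ _ _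

theorem disjoint_linkFace {j : ℕ} (a : (P.T.link σ).PreFace j) : Disjoint a.1.1.1.1.2 a.1.2 :=
  Finset.disjoint_left.2 fun _ h h' => (Finset.mem_sdiff.1 (a.2.1 h')).2 h

/-- A face `s` of the link at an occurrence `S` is the pair of disjoint faces `S`, `s` of one facet,
and a gluing moves it exactly when the ridge contains both. So one graph serves the triangulation
and all its links. -/
theorem encodes_linkNumber (j : ℕ) :
    Encodes (PreFace.Step (P.T.link σ) j) P.linkNumber P.nbrs where
  symm _ _ h := h.symm
  inj a b h := by
    obtain ⟨h1, h2, h3⟩ := number_inj (P.disjoint_linkFace a) (P.disjoint_linkFace b) h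
    exact Subtype.ext (Prod.ext (Subtype.ext (Subtype.ext (Prod.ext (P.index_inj h1) h2))) h3)
  mem_nbrs a b h := by
    obtain ⟨i, g, ⟨hg, hi, hS⟩, hi', hs⟩ := h
    have := P.number_map hg hi hi'
    rw [← hS, ← hs] at this
    refine P.mem_nbrs.2 ⟨i, ?_, this⟩
    rw [linkNumber, digit_number, colour_eq_zero]
    exact ⟨hi, hi'⟩
  exists_of_mem a y hy := by
    obtain ⟨i, hi, rfl⟩ := P.mem_nbrs.1 hy
    rw [linkNumber, digit_number, colour_eq_zero] at hi
    obtain ⟨p, hp⟩ := a.1.1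
    obtain ⟨g, hg, -⟩ := P.exists_glue a.1.1.1.1.1 i
    let q : (P.T.link σ).Facet := ⟨a.1.1.1.move hg,
      (Quot.sound (a.1.1.1.step_move hg hi.1)).symm.trans a.1.1.2⟩
    have hg' : (P.T.link σ).glue a.1.1 i q g := ⟨hg, hi.1, rfl⟩
    exact ⟨a.move hg', a.step_move hg' hi.2, P.number_map hg hi.1 hi.2⟩

theorem mem_linkCodes_iff {p : P.T.PreFace k} (hp : Quot.mk _ p = σ) {V : List ℕ}
    (hV : component P.nbrs (P.faceNumber p) = V)
    (h : P.componentCheck (P.faceNumber p) V = true) {j x : ℕ} :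
    x ∈ linkCodes V P.N (k + 1) (j + 1) ↔
      ∃ a : (P.T.link σ).PreFace j, P.linkNumber a = x := by
  subst hV
  have hiff := fun q => (P.encodes_faceNumber k).mk_eq_iff (b := q) h
  rw [linkCodes, List.mem_filter, mem_codes, mem_iff]
  constructor
  · rintro ⟨⟨Δ, hΔ, S, s, hd, hS, hs, rfl⟩, hx⟩
    rw [firstFace_number] at hx
    let q : P.T.PreFace k := ⟨((⟨Δ, hΔ⟩ : Fin P.N), S), Finset.subset_univ _, hS⟩
    exact ⟨⟨(⟨q, ((hiff q).2 hx).trans hp⟩, s), fun v hv => Finset.mem_sdiff.2 ⟨Finset.mem_univ _,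
      fun hv' => Finset.disjoint_left.1 hd hv' hv⟩, hs⟩, rfl⟩
  · rintro ⟨a, rfl⟩
    refine ⟨⟨_, P.index_lt a.1.1.1.1.1, _, _, P.disjoint_linkFace a, a.1.1.1.2.2, a.2.2, rfl⟩, ?_⟩
    rw [P.firstFace_linkNumber]
    exact (hiff _).1 (a.1.1.2.trans hp.symm)

/-- The number of faces of a link. -/
theorem link_f_eq {p : P.T.PreFace k} (hp : Quot.mk _ p = σ) {V : List ℕ}
    (hV : component P.nbrs (P.faceNumber p) = V)
    (h : P.componentCheck (P.faceNumber p) V = true) {j n : ℕ} (hn : n < 1000000)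
    (hsum : ((linkCodes V P.N (k + 1) (j + 1)).map (verdict P.nbrs)).sum = n) :
    (P.T.link σ).f j = n :=
  (P.encodes_linkNumber j).card_quot ((nodup_codes _ _ _).filter _)
    (fun _ => P.mem_linkCodes_iff hp hV h) hn hsum

end Pairing

/-! ### The two examples -/

/-- The pairing of the ridges of the 16 facets. -/
def smallCode (Δ i : ℕ) : ℕ :=
  if Δ < 4 then
    -- The cycle of the central pentachora; `Δ + 3` is the predecessor modulo 4.
    if i = 3 then 5 * ((Δ + 1) % 4) + 2
    else if i = 2 then 5 * ((Δ + 3) % 4) + 3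
    -- The ridges 0, 1, 4 of `Δ` are capped by the pentachora `4 + 3Δ`, `5 + 3Δ`, `6 + 3Δ` along
    -- their ridges 4.
    else 5 * (4 + 3 * Δ + (if i = 4 then 2 else i)) + 4
  else if i = 4 then
    5 * ((Δ - 4) / 3) + (if (Δ - 4) % 3 = 2 then 4 else (Δ - 4) % 3)
  -- The snapping: ridge 0 to ridge 1 and ridge 2 to ridge 3 of the same pentachoron.
  else 5 * Δ + (if i % 2 = 0 then i + 1 else i - 1)

/-- The pairing of the ridges of the 64 facets. -/
def largeCode (Δ i : ℕ) : ℕ :=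
  if Δ < 4 then smallCode Δ i
  else if Δ < 16 then
    -- The ridges 0, …, 3 of the formerly snapped pentachoron `Δ` go to the pentachora `4Δ`, …, `4Δ
    -- + 3`.
    if i = 4 then smallCode Δ i else 5 * (4 * Δ + i) + 4
  else if i = 4 then
    5 * (Δ / 4) + Δ % 4
  -- Two consecutive such pentachora form a pillow, which joins ridge 0 to ridge 1, or ridge 2 to
  -- ridge 3.
  else 5 * (if Δ % 2 = 0 then Δ + 1 else Δ - 1) + i

/-- The pairing of the example with 16 pentachora. -/
def small : Pairing where
  N := 16
  code := smallCode
  div_lt := by decide +kernel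
  invol := by decide +kernel
  ne := by decide +kernel

/-- The pairing of the example with 64 pentachora. -/
def large : Pairing where
  N := 64
  code := largeCode
  div_lt := by decide +kernel
  invol := by decide +kernel
  ne := by decide +kernel

/-! ### Orientations of the links of edges -/

/-- The vertices of the triangle opposite to the edge `S`, in increasing order or, if `b`, with the
first two exchanged. -/
def opposite (b : Bool) (S : Finset (Fin 5)) (k : Fin 3) : Fin 5 :=
  ((List.finRange 5).filter (· ∉ S)).getD (if b then (Equiv.swap 0 1 k).1 else k.1) 0

/-- The parity of the position of an edge. -/
def parity (S : Finset (Fin 5)) : Bool := decide ((∑ v ∈ S, v.1) % 2 = 1)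

theorem opposite_injective : ∀ (b : Bool) (S : Finset (Fin 5)), S.card = 2 → ∀ k l,
    opposite b S k = opposite b S l → k = l := by
  decide +kernel

theorem notMem_iff_opposite : ∀ (b : Bool) (S : Finset (Fin 5)), S.card = 2 → ∀ v,
    v ∉ S ↔ ∃ k, opposite b S k = v := by
  decide +kernel

/-- On all five labels `shift i i'` has the sign of `i + i'`, and bringing `S` to the front costs
the parity of the sum of its labels, up to a constant. As the gluing keeps the order on `S`, the
rest of the sign is that of the permutation of the opposite triangle. -/
theorem opposite_shift : ∀ (i i' : Fin 5) (S : Finset (Fin 5)), S.card = 2 → i ∉ S →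
    ∀ b b' : Bool, (b ^^ b') = decide ((i.1 + i'.1) % 2 = 0) →
      ∃ π : Equiv.Perm (Fin 3), Equiv.Perm.sign π = -1 ∧
        ∀ k, shift i i' (opposite (b ^^ parity S) S k) =
          opposite (b' ^^ parity (S.image (shift i i'))) (S.image (shift i i')) (π k) := by
  decide +kernel

namespace Pairing

variable (P : Pairing)

/-- The hypothesis is a coherent orientation `ε` of the whole triangulation relative to the order of
the labels. Since edges are directed consistently by that order, it induces orientations on their
links. -/
theorem link_isOrientable {ε : ℕ → Bool}
    (h : ∀ (Δ : Fin P.N) i, (ε Δ ^^ ε (P.nbr Δ i)) = decide ((i.1 + (P.opp Δ i).1) % 2 = 0))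
    (σ : P.T.Face 1) : (P.T.link σ).IsOrientable 2 := by
  refine ⟨fun p => opposite (ε (P.index p.1.1.1) ^^ parity p.1.1.2) p.1.1.2, fun p => ⟨?_, ?_⟩, ?_⟩
  · exact fun k l => opposite_injective _ _ p.1.2.2 k l
  · ext v
    rw [Set.mem_range, ← notMem_iff_opposite _ _ p.1.2.2]
    exact ⟨fun hv => Finset.mem_sdiff.2 ⟨Finset.mem_univ _, hv⟩, fun hv => (Finset.mem_sdiff.1 hv).2⟩
  · rintro p i q g ⟨hg, hi, hs⟩
    obtain ⟨hn, hg'⟩ := P.glue_iff.1 hg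
    have hs' : q.1.1.2 = p.1.1.2.image (shift i (P.opp p.1.1.1 i)) := by
      rw [hs, Finset.map_eq_image]
      exact congrArg (Finset.image · p.1.1.2) (funext hg')
    obtain ⟨π, hπ, hk⟩ := opposite_shift i (P.opp p.1.1.1 i) p.1.1.2 p.1.2.2 hi _ _
      (h p.1.1.1 i)
    refine ⟨π, hπ, fun k => (hg' _).trans ((hk k).trans ?_)⟩
    show _ = opposite (ε (P.index q.1.1.1) ^^ parity q.1.1.2) q.1.1.2 (π k)
    rw [hs', ← hn]
    rfl

/-! ### Developing tables -/

/-- The maps `φ` and `κ` identify the rows of the table `t` with occurrences of a face: the labels of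
the facet `φ n` that belong to the face go to the label that is missing in the row `n`. -/
structure Develops {m : ℕ} [NeZero m] (t : Table) (φ : Fin t.length → Fin P.N)
    (κ : Fin t.length → Fin 5 → Fin m) : Prop where
  glue : ∀ n v, κ n v ≠ t.miss m n → φ (t.nbr n (κ n v)) = P.nbr (φ n) v ∧
    ∀ w, κ (t.nbr n (κ n v)) (shift v (P.opp (φ n) v) w) = t.act n (κ n v) (κ n w)
  inj : ∀ n v w, κ n v = κ n w → κ n v = t.miss m n ∨ v = w
  surj : ∀ n j, ∃ v, κ n v = j
  ne : ∀ n n', φ n = φ n' → (∀ v, κ n v = t.miss m n ↔ κ n' v = t.miss m n') → n = n'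

/-- The rows give distinct occurrences of the face. The occurrences are closed under the gluings of
the link, and the link is connected, so they are all of its facets and the link is isomorphic to the
table. -/
theorem Develops.link_isPLSphere {P : Pairing} {m : ℕ} [NeZero m] {t : Table} {φ : Fin t.length → Fin P.N}
    {κ : Fin t.length → Fin 5 → Fin m} (H : P.Develops t φ κ) {ht : t.IsValid m} {d k : ℕ}
    (hS : (t.toGenTriangulation ht).IsPLSphere d) (h0 : 0 < t.length) {σ : P.T.Face k}
    (hrow : ∀ n, ∃ p : P.T.PreFace k, Quot.mk _ p = σ ∧ p.1.1 = φ n ∧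
      ∀ v, κ n v = t.miss m n ↔ v ∈ p.1.2) : (P.T.link σ).IsPLSphere d := by
  let S : Fin t.length → Finset (Fin 5) := fun n => Finset.univ.filter fun v => κ n v = t.miss m n
  have hmemS : ∀ n v, v ∈ S n ↔ κ n v = t.miss m n := fun n v => by simp [S]
  -- the gluings carry the faces to each other
  have hstep : ∀ n v, κ n v ≠ t.miss m n → ∀ g : Equiv.Perm (Fin 5),
      (∀ w, g w = shift v (P.opp (φ n) v) w) →
      S (t.nbr n (κ n v)) = (S n).map g.toEmbedding := by
    intro n v hv g hg
    obtain ⟨-, h2⟩ := H.glue n v hv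
    obtain ⟨k1, -, k3, -⟩ := ht n _ hv
    ext w
    obtain ⟨w, rfl⟩ := g.surjective w
    rw [hmemS, hg, h2, ← k1, Finset.mem_map_equiv, ← hg, Equiv.symm_apply_apply, hmemS]
    constructor
    · intro e
      rw [← k3 (κ n w), e, k3]
    · intro e
      rw [e]
  replace hrow : ∀ n, ∃ q : P.T.PreFace k, Quot.mk _ q = σ ∧ q.1 = (φ n, S n) := fun n => by
    obtain ⟨q, hq, h1, h2⟩ := hrow n
    refine ⟨q, hq, Prod.ext h1 ?_⟩
    ext v
    exact ((hmemS _ _).trans (h2 v)).symm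
  choose row hrowσ hrow using hrow
  let e : Fin t.length → (P.T.link σ).Facet := fun n => ⟨row n, hrowσ n⟩
  have hinj : Function.Injective e := by
    intro n n' h
    have h1 : (φ n, S n) = (φ n', S n') := by
      rw [← hrow, ← hrow]
      exact congrArg (fun q : (P.T.link σ).Facet => q.1.1) h
    refine H.ne n n' (congrArg Prod.fst h1) fun v => ?_
    rw [← hmemS, ← hmemS, show S n = S n' from congrArg Prod.snd h1]
  have hsurj : Function.Surjective e := by
    have key : ∀ q : (P.T.link σ).Facet,
        Relation.ReflTransGen (P.T.link σ).Adj (e ⟨0, h0⟩) q → ∃ n, e n = q := by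
      intro q h
      induction h with
      | refl => exact ⟨_, rfl⟩
      | tail _ h ih =>
        obtain ⟨n, rfl⟩ := ih
        obtain ⟨v, g, hg, hv, hs⟩ := h
        have hr1 : (row n).1.1 = φ n := congrArg Prod.fst (hrow n)
        have hr2 : (row n).1.2 = S n := congrArg Prod.snd (hrow n)
        rw [show (e n).1.1.1 = φ n from hr1] at hg
        rw [show (e n).1.1.2 = S n from hr2] at hv hs
        obtain ⟨hg1, hg2⟩ := P.glue_iff.1 hg
        rw [hmemS] at hv
        refine ⟨t.nbr n (κ n v), Subtype.ext (Subtype.ext ((hrow _).trans (Prod.ext ?_ ?_)))⟩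
        · exact ((H.glue n v hv).1).trans hg1
        · exact (hstep n v hv g hg2).trans hs.symm
    exact fun q => key q (link_facetConnected σ _ _)
  let E := Equiv.ofBijective e ⟨hinj, hsurj⟩
  have hE1 : ∀ q, q.1.1.1 = φ (E.symm q) := fun q => by
    conv_lhs => rw [← E.apply_symm_apply q]
    exact congrArg Prod.fst (hrow _)
  have hE2 : ∀ q, q.1.1.2 = S (E.symm q) := fun q => by
    conv_lhs => rw [← E.apply_symm_apply q]
    exact congrArg Prod.snd (hrow _)
  have hverts : ∀ q v, v ∈ (P.T.link σ).verts q ↔ κ (E.symm q) v ≠ t.miss m (E.symm q) := by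
    intro q v
    rw [ne_eq, ← hmemS, ← hE2]
    exact ⟨fun h => (Finset.mem_sdiff.1 h).2, fun h => Finset.mem_sdiff.2 ⟨Finset.mem_univ _, h⟩⟩
  refine Iso.isPLSphere (Iso.toMaps ht.maps E.symm (fun q => κ (E.symm q)) ?_ ?_ ?_)
    (link_isClosed σ P.isClosed) hS
  · intro q v hv w _ h
    exact (H.inj _ v w h).resolve_left ((hverts _ _).1 hv)
  · intro q
    ext j
    rw [Finset.mem_image, Table.verts, Finset.mem_erase]
    constructor
    · rintro ⟨v, hv, rfl⟩
      exact ⟨(hverts _ _).1 hv, Finset.mem_univ _⟩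
    · rintro ⟨hj, -⟩
      obtain ⟨v, rfl⟩ := H.surj (E.symm q) j
      exact ⟨v, (hverts _ _).2 hj, rfl⟩
  · rintro q v q' g ⟨hg, hv, hs⟩
    rw [hE2, hmemS] at hv
    rw [hE1] at hg
    obtain ⟨hg1, hg2⟩ := P.glue_iff.1 hg
    obtain ⟨h1, h2⟩ := H.glue _ v hv
    have hq' : t.nbr (E.symm q) (κ (E.symm q) v) = E.symm q' := by
      rw [Equiv.eq_symm_apply]
      refine Subtype.ext (Subtype.ext ((hrow _).trans (Prod.ext ?_ ?_)))
      · exact h1.trans hg1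
      · exact (hstep _ v hv g hg2).trans (by rw [← hE2]; exact hs.symm)
    refine ⟨hq', fun w _ => ?_⟩
    rw [← h2, hq', ← hg2]

end Pairing

/-! ### The search for developments -/

/-- The lists that arise from `l` by the insertion of `x`. -/
def insertions (x : ℕ) : List ℕ → List (List ℕ)
  | [] => [[x]]
  | y :: l => (x :: y :: l) :: (insertions x l).map (y :: ·)

/-- The permutations of a list. -/
def perms : List ℕ → List (List ℕ)
  | [] => [[]]
  | x :: l => (perms l).flatMap (insertions x)

/-- The labels of the vertices in order: `a` at the vertices of the face of number `x`, and those of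
the list at the others. -/
def labels (x a : ℕ) : List ℕ → List ℕ → List ℕ
  | [], _ => []
  | v :: vs, l => bif Nat.beq (digit (x % 243) v) 1 then a :: labels x a vs l
    else l.headD 0 :: labels x a vs l.tail

namespace Pairing

variable (P : Pairing)

/-- The facet of the row `n` and its labels, given those of some of the rows. -/
def next (t : Table) (m : ℕ) (rows : List (ℕ × List ℕ)) (n : ℕ) : ℕ × List ℕ :=
  let row := t.getD n (0, [])
  match (List.range m).find? fun i => !Nat.beq i row.1 &&
    !(rows.getD (row.2.getD i 0 / 10 ^ m) (0, [])).2.isEmpty with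
  | none => (0, [])
  | some i =>
    let n' := row.2.getD i 0 / 10 ^ m
    let j := row.2.getD i 0 / 10 ^ i % 10
    let a := (t.getD n' (0, [])).2.getD j 0
    let Δ := (rows.getD n' (0, [])).1
    let κ := (rows.getD n' (0, [])).2
    let v := κ.idxOf j
    (P.code Δ v / 5, ((κ.eraseIdx v).map fun w => a / 10 ^ w % 10).insertIdx (P.code Δ v % 5) i)

/-- The facets of the rows and their labels, after some rounds in which they are found from those
of the rows glued to them. -/
def develop (t : Table) (m : ℕ) : ℕ → List (ℕ × List ℕ) → List (ℕ × List ℕ)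
  | 0, rows => rows
  | r + 1, rows => bif Nat.beq rows.length t.length && rows.all (!·.2.isEmpty) then rows else
    develop t m r ((List.range t.length).map fun n =>
      bif (rows.getD n (0, [])).2.isEmpty then P.next t m rows n else rows.getD n (0, []))

/-- The facets and labels give a development by faces of which the numbers belong to `V`. -/
def developCheck (t : Table) (m : ℕ) [NeZero m] [NeZero P.N] (V : List ℕ)
    (rows : List (ℕ × List ℕ)) : Bool :=
  let φ := fun n : Fin t.length => Fin.ofNat P.N (rows.getD n (0, [])).1
  let κ := fun (n : Fin t.length) (v : Fin 5) => Fin.ofNat m ((rows.getD n (0, [])).2.getD v 0)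
  (decide <| ∀ n v, κ n v ≠ t.miss m n → φ (t.nbr n (κ n v)) = P.nbr (φ n) v ∧
    ∀ w, κ (t.nbr n (κ n v)) (shift v (P.opp (φ n) v) w) = t.act n (κ n v) (κ n w)) &&
  (decide <| ∀ n v w, κ n v = κ n w → κ n v = t.miss m n ∨ v = w) &&
  (decide <| ∀ n j, ∃ v, κ n v = j) &&
  (decide <| ∀ n n', φ n = φ n' → (∀ v, κ n v = t.miss m n ↔ κ n' v = t.miss m n') → n = n') &&
  (decide <| ∀ n, mem ((φ n).1 * 243 + ternary fun v => if κ n v = t.miss m n then 1 else 0) V)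

/-- The link of the face of number `x` is isomorphic to the table. -/
def linkCheck (t : Table) (m x : ℕ) [NeZero m] [NeZero P.N] : Bool :=
  let V := component P.nbrs x
  let a := (t.getD 0 (0, [])).1
  decide (0 < t.length) && Nat.beq t.length V.length &&
  -- An isomorphism is determined by the occurrence and the labelling assigned to row 0, so trying
  -- all of these is exhaustive.
  V.reverse.any fun y => (perms ((List.range m).filter (!Nat.beq · a))).any fun l =>
    P.developCheck t m V (P.develop t m t.length [(y / 243, labels y a [0, 1, 2, 3, 4] l)])

theorem link_isPLSphere_of_linkCheck {t : Table} {m : ℕ} [NeZero m] [NeZero P.N] {d k : ℕ}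
    {ht : t.IsValid m} (hS : (t.toGenTriangulation ht).IsPLSphere d) {p : P.T.PreFace k}
    (h : P.linkCheck t m (P.faceNumber p) = true) {σ : P.T.Face k} (hp : Quot.mk _ p = σ) :
    (P.T.link σ).IsPLSphere d := by
  simp only [linkCheck, Bool.and_eq_true, decide_eq_true_eq] at h
  obtain ⟨⟨h0, -⟩, h⟩ := h
  obtain ⟨y, -, h⟩ := List.any_eq_true.1 h
  obtain ⟨l, -, h⟩ := List.any_eq_true.1 h
  -- How the rows were found is irrelevant; only the final check is used.
  generalize P.develop _ _ _ _ = rows at h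
  simp only [developCheck, Bool.and_eq_true, decide_eq_true_eq] at h
  obtain ⟨⟨⟨⟨h1, h2⟩, h3⟩, h4⟩, h5⟩ := h
  refine Develops.link_isPLSphere ⟨h1, h2, h3, h4⟩ hS h0 fun n => ?_
  obtain ⟨q, hq, e⟩ := (P.encodes_faceNumber k).exists_of_mem_grow p _ _ _ (mem_iff.1 (h5 n))
  have hlt : ternary (fun v => if Fin.ofNat m ((rows.getD n (0, [])).2.getD v 0) = t.miss m n
      then 1 else 0) < 243 := ternary_lt fun v => by split_ifs <;> norm_num
  refine ⟨q, hq.trans hp, P.index_inj ?_, fun v => ?_⟩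
  · have e' := congrArg (· / 243) e
    simp only [faceNumber, number_div] at e'
    rw [e']
    show _ = (Fin.ofNat P.N (rows.getD n (0, [])).1).1
    omega
  · have e' := congrArg (fun x => digit (x % 243) v) e
    simp only [faceNumber, digit_number] at e'
    rw [Nat.mul_add_mod_of_lt hlt, digit_ternary fun v => by split_ifs <;> norm_num] at e'
    rw [← colour_eq_one (s := ∅), e']
    split_ifs with h
    · exact iff_of_true h rfl
    · exact iff_of_false h (by simp)

end Pairing

namespace Pairing

variable (P : Pairing)

/-- All faces with `a` vertices, except perhaps that of number `x₀`, have links isomorphic to one of the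
tables. -/
def linksCheck [NeZero P.N] (ts : List Table) (m a x₀ : ℕ) [NeZero m] : Bool :=
  (codes P.N a 0).all fun x =>
    !Nat.beq (verdict P.nbrs x) 1 || Nat.beq x x₀ || ts.any (P.linkCheck · m x)

/-- Every face has an occurrence with verdict 1, so testing these occurrences covers all faces. -/
theorem link_isPLSphere_of_linksCheck [NeZero P.N] {ts : List Table} {m d k n : ℕ} [NeZero m]
    (hts : ∀ t ∈ ts, ∃ ht : t.IsValid m, (t.toGenTriangulation ht).IsPLSphere d)
    {p₀ : P.T.PreFace k} {σ₀ : P.T.Face k} (hp₀ : Quot.mk _ p₀ = σ₀) (hn : n < 1000000)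
    (hsum : ((codes P.N (k + 1) 0).map (verdict P.nbrs)).sum = n)
    (h : P.linksCheck ts m (k + 1) (P.faceNumber p₀) = true) (σ : P.T.Face k) (hσ : σ ≠ σ₀) :
    (P.T.link σ).IsPLSphere d := by
  obtain ⟨p, hp, hv⟩ := P.exists_root hn hsum σ
  have := List.all_eq_true.1 h _ (P.mem_codes_iff_faceNumber.2 ⟨p, rfl⟩)
  simp only [Bool.or_eq_true, Bool.not_eq_true', hv, Nat.beq_refl, Bool.true_eq_false, false_or,
    Nat.beq_eq] at this
  rcases this with h | h
  · exact absurd (hp.symm.trans ((congrArg _ ((P.encodes_faceNumber k).inj h)).trans hp₀)) hσ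
  · obtain ⟨t, ht, h⟩ := List.any_eq_true.1 h
    obtain ⟨_, hS⟩ := hts t ht
    exact P.link_isPLSphere_of_linkCheck hS h hp

theorem link_isPseudomanifold {k e : ℕ} (σ : P.T.Face k) (h : 4 = e + k + 1) (he : 1 ≤ e) :
    (P.T.link σ).IsPseudomanifold e :=
  ⟨link_hasDim σ P.hasDim h, link_isClosed σ P.isClosed,
    (link_facetConnected σ).connectedSpace (link_hasDim σ P.hasDim h) he, link_isValid σ P.isValid⟩

theorem link_isOrientableSurface {ε : ℕ → Bool}
    (hε : ∀ (Δ : Fin P.N) i, (ε Δ ^^ ε (P.nbr Δ i)) = decide ((i.1 + (P.opp Δ i).1) % 2 = 0))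
    (σ : P.T.Face 1) {f₀ f₁ f₂ : ℕ} {g : ℕ} (h₀ : (P.T.link σ).f 0 = f₀)
    (h₁ : (P.T.link σ).f 1 = f₁) (h₂ : (P.T.link σ).f 2 = f₂)
    (hg : (f₀ : ℤ) - f₁ + f₂ = 2 - 2 * g) : (P.T.link σ).IsOrientableSurface g := by
  refine ⟨⟨P.link_isPseudomanifold σ rfl (by norm_num), fun τ => ?_⟩, P.link_isOrientable hε σ, ?_⟩
  · exact link_isPLSphere_one (link_hasDim σ P.hasDim rfl) (link_isClosed σ P.isClosed) rfl τ
  · rw [← hg, eulerChar]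
    simp only [Finset.sum_range_succ, Finset.sum_range_zero, h₀, h₁, h₂]
    ring

theorem link_not_isPLSphere (σ : P.T.Face 0) {f₀ f₁ f₂ f₃ : ℕ} (h₀ : (P.T.link σ).f 0 = f₀)
    (h₁ : (P.T.link σ).f 1 = f₁) (h₂ : (P.T.link σ).f 2 = f₂) (h₃ : (P.T.link σ).f 3 = f₃)
    (h : (f₀ : ℤ) - f₁ + f₂ - f₃ ≠ 0) : ¬ (P.T.link σ).IsPLSphere 3 := by
  intro hS
  have := hS.eulerChar_eq (link_isValid σ P.isValid) (link_hasDim σ P.hasDim (e := 3) rfl)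
  simp only [eulerChar, Finset.sum_range_succ, Finset.sum_range_zero, h₀, h₁, h₂, h₃] at this
  exact h (by linarith)

end Pairing

/-! ### The example with 16 pentachora -/

instance : NeZero small.N := ⟨by decide⟩

/-- The facets of which the orientation is opposite to the order of the labels. -/
def smallSign (Δ : ℕ) : Bool := Nat.ble 4 Δ && !Nat.beq ((Δ - 4) % 3) 1

theorem small_descends : ∀ Δ : Fin small.N, Δ.1 = 0 ∨ ∃ i, small.nbr Δ i < Δ := by decide +kernel

theorem small_sign : ∀ (Δ : Fin small.N) i, (smallSign Δ ^^ smallSign (small.nbr Δ i)) =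
    decide ((i.1 + (small.opp Δ i).1) % 2 = 0) := by decide +kernel

/-- An occurrence of the exceptional vertex. -/
def smallVertex : small.T.PreFace 0 := ⟨((0 : Fin small.N), {0}), Finset.subset_univ _, rfl⟩

/-- An occurrence of the exceptional edge. -/
def smallEdge : small.T.PreFace 1 := ⟨((0 : Fin small.N), {0, 2}), Finset.subset_univ _, rfl⟩

/-- Twelve apexes of snapped pentachora, and one further vertex. -/
theorem small_vertices : ((codes small.N 1 0).map (verdict small.nbrs)).sum = 13 := by
  decide +kernel

/-- Two edges at each of the twelve apexes, the edge with link `fan`, and the exceptional edge. -/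
theorem small_edges : ((codes small.N 2 0).map (verdict small.nbrs)).sum = 26 := by decide +kernel

theorem small_vertexLinks : small.linksCheck [Table.oneTetrahedron] 5 1 1 = true := by
  decide +kernel

/-- The number 10 = 3⁰ + 3² is that of the edge `{0, 2}` of the facet 0. -/
theorem small_edgeLinks : small.linksCheck [Table.fan, Table.snappedPair] 4 2 10 = true := by
  decide +kernel

theorem small_componentVertex : small.componentCheck 1 (component small.nbrs 1) = true := by
  decide +kernel

theorem small_componentEdge : small.componentCheck 10 (component small.nbrs 10) = true := by
  decide +kernel

/-- The Euler characteristics are 28 − 90 + 136 − 68 = 6 and 48 − 156 + 104 = −4. The 6 is 3 for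
each end of the exceptional edge, seen as a vertex of the vertex link. -/
theorem small_link_f :
    (((linkCodes (component small.nbrs 1) small.N 1 1).map (verdict small.nbrs)).sum = 28 ∧
    ((linkCodes (component small.nbrs 1) small.N 1 2).map (verdict small.nbrs)).sum = 90 ∧
    ((linkCodes (component small.nbrs 1) small.N 1 3).map (verdict small.nbrs)).sum = 136 ∧
    ((linkCodes (component small.nbrs 1) small.N 1 4).map (verdict small.nbrs)).sum = 68) ∧
    ((linkCodes (component small.nbrs 10) small.N 2 1).map (verdict small.nbrs)).sum = 48 ∧
    ((linkCodes (component small.nbrs 10) small.N 2 2).map (verdict small.nbrs)).sum = 156 ∧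
    ((linkCodes (component small.nbrs 10) small.N 2 3).map (verdict small.nbrs)).sum = 104 := by
  decide +kernel

theorem small_isNonsingular : small.T.IsNonsingular 4 2 := small.isNonsingular small_descends

theorem small_f_zero : small.T.f 0 = 13 := small.f_eq (by norm_num) small_vertices

theorem small_hasOneSingularEdgeAndVertex : small.T.HasOneSingularEdgeAndVertex := by
  obtain ⟨⟨v0, v1, v2, v3⟩, e0, e1, e2⟩ := small_link_f
  refine ⟨⟨Quot.mk _ smallEdge, ?_, ?_⟩, ⟨Quot.mk _ smallVertex, ?_, ?_⟩⟩
  · have key := fun {j n} => small.link_f_eq (p := smallEdge) rfl rfl small_componentEdge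
      (j := j) (n := n)
    exact small.link_isOrientableSurface small_sign _ (key (by norm_num) e0) (key (by norm_num) e1)
      (key (by norm_num) e2) (by norm_num)
  · exact small.link_isPLSphere_of_linksCheck (by
      simpa using ⟨⟨_, Table.isPLSphere_fan⟩, ⟨_, Table.isPLSphere_snappedPair⟩⟩) rfl
      (by norm_num) small_edges small_edgeLinks
  · have key := fun {j n} => small.link_f_eq (p := smallVertex) rfl rfl small_componentVertex
      (j := j) (n := n)
    exact small.link_not_isPLSphere _ (key (by norm_num) v0) (key (by norm_num) v1)
      (key (by norm_num) v2) (key (by norm_num) v3) (by norm_num)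
  · exact small.link_isPLSphere_of_linksCheck (by
      simpa using ⟨_, Table.isPLSphere_oneTetrahedron⟩) rfl
      (by norm_num) small_vertices small_vertexLinks

/-! ### The example with 64 pentachora -/

instance : NeZero large.N := ⟨by decide⟩

/-- The facets of which the orientation is opposite to the order of the labels. -/
def largeSign (Δ : ℕ) : Bool :=
  bif Nat.blt Δ 16 then smallSign Δ else (smallSign (Δ / 4) ^^ Nat.beq (Δ % 2) 0)

theorem large_descends : ∀ Δ : Fin large.N, Δ.1 = 0 ∨ ∃ i, large.nbr Δ i < Δ := by decide +kernel

theorem large_sign : ∀ (Δ : Fin large.N) i, (largeSign Δ ^^ largeSign (large.nbr Δ i)) =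
    decide ((i.1 + (large.opp Δ i).1) % 2 = 0) := by decide +kernel

/-- An occurrence of the exceptional vertex. -/
def largeVertex : large.T.PreFace 0 := ⟨((0 : Fin large.N), {0}), Finset.subset_univ _, rfl⟩

/-- An occurrence of the exceptional edge. -/
def largeEdge : large.T.PreFace 1 := ⟨((0 : Fin large.N), {0, 2}), Finset.subset_univ _, rfl⟩

/-- The 13 vertices of the small example and the apexes of 24 pillows. -/
theorem large_vertices : ((codes large.N 1 0).map (verdict large.nbrs)).sum = 37 := by
  decide +kernel

/-- The 26 edges of the small example and four at each of the 24 pillow apexes. -/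
theorem large_edges : ((codes large.N 2 0).map (verdict large.nbrs)).sum = 122 := by decide +kernel

theorem large_vertexLinks : large.linksCheck [Table.doubleTetrahedron, Table.oneTetrahedronPillows] 5 1 1 = true := by
  decide +kernel

theorem large_edgeLinks : large.linksCheck [Table.doubleTriangle, Table.snappedPairPillows, Table.fanPillows] 4 2 10 = true := by
  decide +kernel

theorem large_componentVertex : large.componentCheck 1 (component large.nbrs 1) = true := by
  decide +kernel

theorem large_componentEdge : large.componentCheck 10 (component large.nbrs 10) = true := by
  decide +kernel

/-- The pillows leave the Euler characteristics at 100 − 306 + 424 − 212 = 6 and 116 − 360 + 240 =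
−4. -/
theorem large_link_f :
    (((linkCodes (component large.nbrs 1) large.N 1 1).map (verdict large.nbrs)).sum = 100 ∧
    ((linkCodes (component large.nbrs 1) large.N 1 2).map (verdict large.nbrs)).sum = 306 ∧
    ((linkCodes (component large.nbrs 1) large.N 1 3).map (verdict large.nbrs)).sum = 424 ∧
    ((linkCodes (component large.nbrs 1) large.N 1 4).map (verdict large.nbrs)).sum = 212) ∧
    ((linkCodes (component large.nbrs 10) large.N 2 1).map (verdict large.nbrs)).sum = 116 ∧
    ((linkCodes (component large.nbrs 10) large.N 2 2).map (verdict large.nbrs)).sum = 360 ∧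
    ((linkCodes (component large.nbrs 10) large.N 2 3).map (verdict large.nbrs)).sum = 240 := by
  decide +kernel

theorem large_isNonsingular : large.T.IsNonsingular 4 2 := large.isNonsingular large_descends

theorem large_f_zero : large.T.f 0 = 37 := large.f_eq (by norm_num) large_vertices

theorem large_hasOneSingularEdgeAndVertex : large.T.HasOneSingularEdgeAndVertex := by
  obtain ⟨⟨v0, v1, v2, v3⟩, e0, e1, e2⟩ := large_link_f
  refine ⟨⟨Quot.mk _ largeEdge, ?_, ?_⟩, ⟨Quot.mk _ largeVertex, ?_, ?_⟩⟩
  · have key := fun {j n} => large.link_f_eq (p := largeEdge) rfl rfl large_componentEdge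
      (j := j) (n := n)
    exact large.link_isOrientableSurface large_sign _ (key (by norm_num) e0) (key (by norm_num) e1)
      (key (by norm_num) e2) (by norm_num)
  · exact large.link_isPLSphere_of_linksCheck (by
      simpa using ⟨⟨_, Table.isPLSphere_doubleTriangle⟩, ⟨_, Table.isPLSphere_snappedPairPillows⟩,
        ⟨_, Table.isPLSphere_fanPillows⟩⟩) rfl
      (by norm_num) large_edges large_edgeLinks
  · have key := fun {j n} => large.link_f_eq (p := largeVertex) rfl rfl large_componentVertex
      (j := j) (n := n)
    exact large.link_not_isPLSphere _ (key (by norm_num) v0) (key (by norm_num) v1)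
      (key (by norm_num) v2) (key (by norm_num) v3) (by norm_num)
  · exact large.link_isPLSphere_of_linksCheck (by
      simpa using ⟨⟨_, Table.isPLSphere_doubleTetrahedron⟩, ⟨_, Table.isPLSphere_oneTetrahedronPillows⟩⟩) rfl
      (by norm_num) large_vertices large_vertexLinks

theorem large_loopless : ∀ Δ i, large.nbr Δ i ≠ Δ := by decide +kernel

end Ordered

theorem mainTheorem5 :
    (∃ T : GenTriangulation (Fin 5),
      T.IsNonsingular 4 2 ∧ (T.f 0 : ℚ) > (T.f 4 : ℚ) / 2 + 4) ∧
    (∃ T : GenTriangulation (Fin 5),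
      T.IsNonsingular 4 2 ∧ (T.f 0 : ℚ) > (T.f 4 : ℚ) / 2 + 4 ∧
      T.HasOneSingularEdgeAndVertex ∧ T.f 4 = 16) ∧
    (∃ T : GenTriangulation (Fin 5),
      T.IsNonsingular 4 2 ∧ (T.f 0 : ℚ) > (T.f 4 : ℚ) / 2 + 4 ∧
      T.HasOneSingularEdgeAndVertex ∧ T.f 4 = 64 ∧ T.DualGraphLoopless) := by
  have hs : (Ordered.small.T.f 0 : ℚ) > (Ordered.small.T.f 4 : ℚ) / 2 + 4 := by
    rw [Ordered.small_f_zero, show Ordered.small.T.f 4 = 16 from Ordered.small.f_four]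
    norm_num
  have hl : (Ordered.large.T.f 0 : ℚ) > (Ordered.large.T.f 4 : ℚ) / 2 + 4 := by
    rw [Ordered.large_f_zero, show Ordered.large.T.f 4 = 64 from Ordered.large.f_four]
    norm_num
  exact ⟨⟨_, Ordered.small_isNonsingular, hs⟩,
    ⟨_, Ordered.small_isNonsingular, hs, Ordered.small_hasOneSingularEdgeAndVertex,
      Ordered.small.f_four⟩,
    ⟨_, Ordered.large_isNonsingular, hl, Ordered.large_hasOneSingularEdgeAndVertex,
      Ordered.large.f_four, Ordered.large.dualGraphLoopless Ordered.large_loopless⟩⟩
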